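/- Conventions. Manifolds are smooth, finite-dimensional and second countable; they are Hausdorff, except that the manifold of arrows of a (local) Lie groupoid may be non-Hausdorff (its source and target fibres are Hausdorff). A \emph{local Lie groupoid} $G$ over $M$ is a manifold $G$ with submersions $s,t:G\to M$, a smooth unit map $u:M\to G$ with $s\circ u=t\circ u=\mathrm{id}$, a multiplication $m:\mathcal U\to G$, $(g,h)\mapsto gh$, which is a submersion defined on an open neighbourhood $\mathcal U\subset G\times_{s,t}G$ of all pairs $(g,u(s(g)))$ and $(u(t(g)),g)$, and a smooth inversion $i:\mathcal V\to\mathcal V$ defined on an open neighbourhood $\mathcal V\subset G$ of $u(M)$ with $\mathcal V\times_{s,t}\mathcal V\subset\mathcal U$, such that $s(gh)=s(h)$ and $t(gh)=t(g)$; units are two-sided identities; $s(i(g))=t(g)$, $t(i(g))=s(g)$, $i(g)g=u(s(g))$ and $g\,i(g)=u(t(g))$ for $g\in\mathcal V$; and $(gh)k$ and $g(hk)$ are defined and equal on a neighbourhood, in $G\times_{s,t}G\times_{s,t}G$, of the triples in which at least two of the arrows are units. We assume throughout that local Lie groupoids are $3$-associative: $(gh)k=g(hk)$ whenever both sides are defined.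 A Lie groupoid is the case in which $\mathcal U=G\times_{s,t}G$ and $\mathcal V=G$. The Lie algebroid of $G$ is $\ker ds|_{u(M)}$ with anchor $dt$ and the bracket of right-invariant vector fields near the units; $G$ \emph{integrates} a Lie algebroid $A\to M$ if its Lie algebroid is isomorphic to $A$ over $\mathrm{id}_M$, and $A$ is \emph{integrable} if some Lie groupoid integrates it. A \emph{word} is a tuple $(w_1,\dots,w_l)$, $l\ge1$, of arrows of $G$ with $s(w_j)=t(w_{j+1})$; a \emph{contraction} replaces two consecutive letters $(w_j,w_{j+1})\in\mathcal U$ by their product. An \emph{associator} at $x\in M$ is an arrow $g$ with $s(g)=t(g)=x$ such that some word can be contracted both to $(g)$ and to $(u(x))$. The set $\mathrm{Assoc}(G)$ of associators is \emph{uniformly discrete} if $O\cap\mathrm{Assoc}(G)=u(M)$ for some open neighbourhood $O$ of $u(M)$ in $G$. The \emph{associative completion} $\mathcal{AC}(G)$ is the quotient of the space $W(G)$ of words (the disjoint union of the spaces of composable $l$-tuples) by the equivalence relation generated by contractions. A \emph{shrinking} of $G$ is a local Lie groupoid on an open neighbourhood $G'$ of $u(M)$ in $G$ with the same source, target and unit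 maps, in which $gh$ is defined exactly if it is defined in $G$ and $g,h,gh\in G'$ (with the same value), and whose inversion is a restriction of that of $G$. A local Lie groupoid is \emph{bi-regular} if the differentials of right translations, between tangent spaces of source fibres, and of left translations, between tangent spaces of target fibres, are isomorphisms wherever they are defined. It has \emph{products connected to the axes} if for every $(g,h)\in\mathcal U$ there is a path $\gamma$ from $u(t(h))$ to $g$ with $(\gamma(\tau),h)\in\mathcal U$ for all $\tau$, or a path $\gamma$ from $u(s(g))$ to $h$ with $(g,\gamma(\tau))\in\mathcal U$ for all $\tau$. Corollary. Let $A\to M$ be a Lie algebroid. (1) $A$ is integrable if and only if there is a local Lie groupoid $G$ over $M$ integrating $A$ such that $\mathrm{Assoc}(G)$ is uniformly discrete. (2) If $G$ is a local Lie groupoid integrating $A$ with $\mathrm{Assoc}(G)$ uniformly discrete, then $G$ has a shrinking $G'$ that is bi-regular, has products connected to the axes and satisfies $\mathrm{Assoc}(G')=u(M)$, such that $\mathcal{AC}(G')$, with the smooth structure for which the projection from each component of $W(G')$ is a submersion and with source, target, units and product given by source and target of words, classes of units and juxtaposition of words, is a Lie groupoid integrating $A$. -/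

import Mathlib

open scoped Manifold ContDiff
open Set TopologicalSpace

universe u v w

noncomputable section

/-- A Lie algebroid structure on the smooth vector bundle `V → M` with fibre model `F`: a smooth
bundle map `anchor : V → TM` over the identity and a Lie bracket on the smooth sections of `V`
satisfying the Leibniz rule. -/
structure LieAlgebroid (n : ℕ) (M : Type u) [TopologicalSpace M]
    [ChartedSpace (EuclideanSpace ℝ (Fin n)) M] [IsManifold (𝓡 n) ∞ M]
    (F : Type v) [NormedAddCommGroup F] [NormedSpace ℝ F]
    (V : M → Type w) [∀ x, AddCommGroup (V x)] [∀ x, Module ℝ (V x)]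
    [TopologicalSpace (Bundle.TotalSpace F V)] [∀ x, TopologicalSpace (V x)]
    [FiberBundle F V] [VectorBundle ℝ F V] where
  anchor : ∀ x, V x →ₗ[ℝ] TangentSpace (𝓡 n) x
  contMDiff_anchor : ContMDiff ((𝓡 n).prod 𝓘(ℝ, F)) (𝓡 n).tangent ∞
    (fun p : Bundle.TotalSpace F V => (⟨p.1, anchor p.1 p.2⟩ : TangentBundle (𝓡 n) M))
  bracket : ContMDiffSection (𝓡 n) F ∞ V →ₗ[ℝ] ContMDiffSection (𝓡 n) F ∞ V →ₗ[ℝ]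
    ContMDiffSection (𝓡 n) F ∞ V
  bracket_self : ∀ α, bracket α α = 0
  jacobi : ∀ α β γ,
    bracket α (bracket β γ) + bracket β (bracket γ α) + bracket γ (bracket α β) = 0
  /-- `[α, f β] = f [α, β] + (ρ(α) f) β`; here `γ` is the section `f β`. -/
  leibniz : ∀ (α β γ : ContMDiffSection (𝓡 n) F ∞ V) (f : M → ℝ),
    ContMDiff (𝓡 n) 𝓘(ℝ, ℝ) ∞ f → (∀ x, γ x = f x • β x) →
    ∀ x, bracket α γ x = f x • bracket α β x +
      NormedSpace.fromTangentSpace (f x)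
        (mfderiv (𝓡 n) 𝓘(ℝ, ℝ) f x (anchor x (α x))) • β x

/-- Let `S` be an embedded submanifold of `X` whose tangent space at `x ∈ S` is `T x`. The
restriction of `f` to `S` is a submersion: it is smooth, and its differential at each `x ∈ S`
maps `T x` onto the tangent space of `Y` at `f x`. (A derivative of `f` within `S` is determined
on `T x`, though not on all of the tangent space of `X`.) -/
def IsSubmersionOn {E H X E' H' Y : Type*}
    [NormedAddCommGroup E] [NormedSpace ℝ E] [TopologicalSpace H] (I : ModelWithCorners ℝ E H)
    [TopologicalSpace X] [ChartedSpace H X]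
    [NormedAddCommGroup E'] [NormedSpace ℝ E'] [TopologicalSpace H']
    (I' : ModelWithCorners ℝ E' H') [TopologicalSpace Y] [ChartedSpace H' Y]
    (f : X → Y) (S : Set X) (T : X → Set E) : Prop :=
  ContMDiffOn I I' ∞ f S ∧
    ∀ x ∈ S, ∃ D : TangentSpace I x →L[ℝ] TangentSpace I' (f x),
      HasMFDerivWithinAt I I' f S x D ∧ ∀ z, ∃ v ∈ T x, D v = z

/-- A local Lie groupoid with (possibly non-Hausdorff) second countable manifold of arrows `G`
over the manifold `M`. The multiplication `m` is meaningful only on `U` and the inversion `i` only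
on `V`; their values elsewhere are irrelevant. Arrows compose from right to left. -/
structure LocalLieGroupoid (n k : ℕ) (M : Type u) [TopologicalSpace M]
    [ChartedSpace (EuclideanSpace ℝ (Fin n)) M]
    (G : Type v) [TopologicalSpace G] [ChartedSpace (EuclideanSpace ℝ (Fin k)) G] where
  secondCountable : SecondCountableTopology G
  /-- source -/
  s : G → M
  /-- target -/
  t : G → M
  /-- unit -/
  u : M → G
  /-- domain of the multiplication -/
  U : Set (G × G)
  /-- multiplication -/
  m : G → G → G
  /-- domain of the inversion -/
  V : Set G
  /-- inversion -/
  i : G → G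
  contMDiff_s : ContMDiff (𝓡 k) (𝓡 n) ∞ s
  submersion_s : ∀ g, Function.Surjective (mfderiv (𝓡 k) (𝓡 n) s g)
  contMDiff_t : ContMDiff (𝓡 k) (𝓡 n) ∞ t
  submersion_t : ∀ g, Function.Surjective (mfderiv (𝓡 k) (𝓡 n) t g)
  t2_source_fiber : ∀ x, T2Space {g : G // s g = x}
  t2_target_fiber : ∀ x, T2Space {g : G // t g = x}
  contMDiff_u : ContMDiff (𝓡 n) (𝓡 k) ∞ u
  s_u : ∀ x, s (u x) = x
  t_u : ∀ x, t (u x) = x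
  /-- `U` is an open subset of the fibre product. -/
  isOpen_U : ∃ O : Set (G × G), IsOpen O ∧ U = O ∩ {p | s p.1 = t p.2}
  unit_right_mem : ∀ g, (g, u (s g)) ∈ U
  unit_left_mem : ∀ g, (u (t g), g) ∈ U
  /-- `m : U → G` is a submersion, where the tangent space of the fibre product at `(g, h)` is
  `{(v₁, v₂) | ds v₁ = dt v₂}`. -/
  submersion_m : IsSubmersionOn ((𝓡 k).prod (𝓡 k)) (𝓡 k) (fun p : G × G => m p.1 p.2) U
    (fun p => {v | (mfderiv (𝓡 k) (𝓡 n) s p.1 v.1 : EuclideanSpace ℝ (Fin n)) =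
      mfderiv (𝓡 k) (𝓡 n) t p.2 v.2})
  isOpen_V : IsOpen V
  u_mem_V : ∀ x, u x ∈ V
  i_mem_V : ∀ g ∈ V, i g ∈ V
  contMDiffOn_i : ContMDiffOn (𝓡 k) (𝓡 k) ∞ i V
  V_subset : ∀ g ∈ V, ∀ h ∈ V, s g = t h → (g, h) ∈ U
  s_m : ∀ g h, (g, h) ∈ U → s (m g h) = s h
  t_m : ∀ g h, (g, h) ∈ U → t (m g h) = t g
  /-- Associativity near the triples in which two of the three arrows are units. -/
  assoc_near_units : ∃ O : Set (G × G × G), IsOpen O ∧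
    (∀ g, (u (t g), u (t g), g) ∈ O) ∧ (∀ g, (u (t g), g, u (s g)) ∈ O) ∧
    (∀ g, (g, u (s g), u (s g)) ∈ O) ∧
    ∀ g h l, (g, h, l) ∈ O → s g = t h → s h = t l →
      (g, h) ∈ U ∧ (m g h, l) ∈ U ∧ (h, l) ∈ U ∧ (g, m h l) ∈ U ∧ m (m g h) l = m g (m h l)
  m_unit : ∀ g, m g (u (s g)) = g
  unit_m : ∀ g, m (u (t g)) g = g
  s_i : ∀ g ∈ V, s (i g) = t g
  t_i : ∀ g ∈ V, t (i g) = s g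
  i_m : ∀ g ∈ V, m (i g) g = u (s g)
  m_i : ∀ g ∈ V, m g (i g) = u (t g)

namespace LocalLieGroupoid

section Basic

variable {n k : ℕ} {M : Type u} [TopologicalSpace M] [ChartedSpace (EuclideanSpace ℝ (Fin n)) M]
  {G : Type v} [TopologicalSpace G] [ChartedSpace (EuclideanSpace ℝ (Fin k)) G]
  (𝒢 : LocalLieGroupoid n k M G)

/-- `(gh)l = g(hl)` whenever both sides are defined. -/
def IsThreeAssociative : Prop :=
  ∀ g h l, (g, h) ∈ 𝒢.U → (𝒢.m g h, l) ∈ 𝒢.U → (h, l) ∈ 𝒢.U → (g, 𝒢.m h l) ∈ 𝒢.U →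
    𝒢.m (𝒢.m g h) l = 𝒢.m g (𝒢.m h l)

/-- A (global) Lie groupoid: all composable pairs can be multiplied, all arrows are invertible, and
the multiplication is associative. -/
def IsLieGroupoid : Prop :=
  (∀ g h, 𝒢.s g = 𝒢.t h → (g, h) ∈ 𝒢.U) ∧ (∀ g, g ∈ 𝒢.V) ∧
    ∀ g h l, 𝒢.s g = 𝒢.t h → 𝒢.s h = 𝒢.t l → 𝒢.m (𝒢.m g h) l = 𝒢.m g (𝒢.m h l)

/-- The differential at `h` of right translation by `g`, which is defined on an open subset of the
source fibre over `t g`. It is meaningful on vectors tangent to that fibre. -/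
def dR (g h : G) : TangentSpace (𝓡 k) h →L[ℝ] TangentSpace (𝓡 k) (𝒢.m h g) :=
  mfderivWithin (𝓡 k) (𝓡 k) (fun h' => 𝒢.m h' g) {h' | (h', g) ∈ 𝒢.U} h

/-- The differential at `h` of left translation by `g`, which is defined on an open subset of the
target fibre over `s g`. It is meaningful on vectors tangent to that fibre. -/
def dL (g h : G) : TangentSpace (𝓡 k) h →L[ℝ] TangentSpace (𝓡 k) (𝒢.m g h) :=
  mfderivWithin (𝓡 k) (𝓡 k) (fun h' => 𝒢.m g h') {h' | (g, h') ∈ 𝒢.U} h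

/-- The tangent space at `g` of the source fibre through `g`. -/
def tangentSource (g : G) : Set (TangentSpace (𝓡 k) g) := {v | mfderiv (𝓡 k) (𝓡 n) 𝒢.s g v = 0}

/-- The tangent space at `g` of the target fibre through `g`. -/
def tangentTarget (g : G) : Set (TangentSpace (𝓡 k) g) := {v | mfderiv (𝓡 k) (𝓡 n) 𝒢.t g v = 0}

/-- Right translations induce isomorphisms of the tangent spaces of the source fibres, and left
translations of those of the target fibres. -/
def IsBiregular : Prop :=
  (∀ g h, (h, g) ∈ 𝒢.U →
    BijOn (𝒢.dR g h) (𝒢.tangentSource h) (𝒢.tangentSource (𝒢.m h g))) ∧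
  (∀ g h, (g, h) ∈ 𝒢.U →
    BijOn (𝒢.dL g h) (𝒢.tangentTarget h) (𝒢.tangentTarget (𝒢.m g h)))

/-- For every `(g, h) ∈ U` there is a path from `t h` to `g` that can be right translated by `h`,
or a path from `s g` to `h` that can be left translated by `g`. -/
def ProductsConnectedToAxes : Prop :=
  ∀ g h, (g, h) ∈ 𝒢.U →
    (∃ γ : Path (𝒢.u (𝒢.t h)) g, ∀ τ, (γ τ, h) ∈ 𝒢.U) ∨
    (∃ γ : Path (𝒢.u (𝒢.s g)) h, ∀ τ, (g, γ τ) ∈ 𝒢.U)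

/-- The vector field `g ↦ d_{t g} R_g (a_{t g})` on `G` given by a family `a` of vectors tangent to
the source fibres at the units. -/
def rightField (a : ∀ x, TangentSpace (𝓡 k) (𝒢.u x)) (g : G) : TangentSpace (𝓡 k) g :=
  (𝒢.dR g (𝒢.u (𝒢.t g)) (a (𝒢.t g)) : EuclideanSpace ℝ (Fin k))

/-- The tuple `(w₀, …, wₗ)` of arrows is well-formed. -/
def IsComposable {l : ℕ} (w : Fin (l + 1) → G) : Prop :=
  ∀ j : Fin l, 𝒢.s (w j.castSucc) = 𝒢.t (w j.succ)

/-- The space `W(G)` of well-formed words: the disjoint union over `l` of the spaces of composable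
`(l+1)`-tuples, with its topology. -/
abbrev Word : Type v := Σ l : ℕ, {w : Fin (l + 1) → G // 𝒢.IsComposable w}

/-- The word of length one given by an arrow. -/
def letter (g : G) : 𝒢.Word := ⟨0, fun _ => g, fun j => j.elim0⟩

/-- The source of a word is the source of its last letter. -/
def wordSource (w : 𝒢.Word) : M := 𝒢.s (w.2.1 (Fin.last w.1))

/-- The target of a word is the target of its first letter. -/
def wordTarget (w : 𝒢.Word) : M := 𝒢.t (w.2.1 0)

/-- Juxtaposition of words whose source and target match. -/
def append (w w' : 𝒢.Word) (h : 𝒢.wordSource w = 𝒢.wordTarget w') : 𝒢.Word :=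
  ⟨w.1 + 1 + w'.1, Fin.append (m := w.1 + 1) (n := w'.1 + 1) w.2.1 w'.2.1, by
    obtain ⟨a, f, hf⟩ := w
    obtain ⟨b, f', hf'⟩ := w'
    intro j
    rcases lt_trichotomy j.val a with hj | hj | hj
    · have e₁ : j.castSucc = Fin.castAdd (b + 1) (⟨j, hj⟩ : Fin a).castSucc := Fin.ext rfl
      have e₂ : j.succ = Fin.castAdd (b + 1) (⟨j, hj⟩ : Fin a).succ := Fin.ext rfl
      have := hf ⟨j, hj⟩
      rw [e₁, e₂]
      simpa only [Fin.append_left] using this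
    · have e₁ : j.castSucc = Fin.castAdd (b + 1) (Fin.last a) := Fin.ext hj
      have e₂ : j.succ = Fin.natAdd (a + 1) (0 : Fin (b + 1)) := Fin.ext (by simp [hj])
      rw [e₁, e₂]
      simp only [Fin.append_left, Fin.append_right]
      exact h
    · have hb : j.val - (a + 1) < b := by
        have : j.val < a + 1 + b := j.2
        omega
      have e₁ : j.castSucc = Fin.natAdd (a + 1) (⟨j - (a + 1), hb⟩ : Fin b).castSucc :=
        Fin.ext (by simp; omega)
      have e₂ : j.succ = Fin.natAdd (a + 1) (⟨j - (a + 1), hb⟩ : Fin b).succ :=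
        Fin.ext (by simp; omega)
      have := hf' ⟨j - (a + 1), hb⟩
      rw [e₁, e₂]
      simpa only [Fin.append_right] using this⟩

/-- The word `w'` is obtained from the word `w` by contraction: two consecutive letters of `w` that
can be multiplied are replaced by their product. -/
def Contracts (w w' : 𝒢.Word) : Prop :=
  ∃ (l : ℕ) (a : Fin (l + 2) → G) (ha : 𝒢.IsComposable a)
    (b : Fin (l + 1) → G) (hb : 𝒢.IsComposable b) (j : Fin (l + 1)),
    w = ⟨l + 1, a, ha⟩ ∧ w' = ⟨l, b, hb⟩ ∧
    (∀ j', j' < j → b j' = a j'.castSucc) ∧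
    (a j.castSucc, a j.succ) ∈ 𝒢.U ∧ b j = 𝒢.m (a j.castSucc) (a j.succ) ∧
    (∀ j', j < j' → b j' = a j'.succ)

/-- The associative completion: words modulo the equivalence relation generated by contractions. -/
def AssocCompletion : Type v := Quot 𝒢.Contracts

/-- The quotient topology. -/
instance : TopologicalSpace 𝒢.AssocCompletion :=
  inferInstanceAs (TopologicalSpace (Quot 𝒢.Contracts))

/-- The class of a word in the associative completion. -/
def toCompletion (w : 𝒢.Word) : 𝒢.AssocCompletion := Quot.mk _ w

/-- The set of associators at `x`: arrows `g` from `x` to `x` such that some word can be evaluated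
by successive contractions both to `g` and to the unit at `x`. -/
def associatorsAt (x : M) : Set G :=
  {g | 𝒢.s g = x ∧ 𝒢.t g = x ∧ ∃ w : 𝒢.Word,
    Relation.ReflTransGen 𝒢.Contracts w (𝒢.letter (𝒢.u x)) ∧
    Relation.ReflTransGen 𝒢.Contracts w (𝒢.letter g)}

/-- The set of all associators. -/
def associators : Set G := ⋃ x, 𝒢.associatorsAt x

/-- Some open neighbourhood of the units contains no associators other than the units. -/
def HasUniformlyDiscreteAssociators : Prop :=
  ∃ O : Set G, IsOpen O ∧ range 𝒢.u ⊆ O ∧ O ∩ 𝒢.associators = range 𝒢.u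

/-- The smooth structure on the associative completion is the quotient of that of `W(G)`: on each
component of `W(G)`, the submanifold of composable tuples, the projection is a submersion.
(The quantifier over `f` ranges over the extensions of the projection to all tuples.) -/
def IsSmoothQuotient [ChartedSpace (EuclideanSpace ℝ (Fin k)) 𝒢.AssocCompletion] : Prop :=
  ∀ (l : ℕ) (f : (Fin (l + 1) → G) → 𝒢.AssocCompletion),
    (∀ w (hw : 𝒢.IsComposable w), f w = 𝒢.toCompletion ⟨l, w, hw⟩) →
    IsSubmersionOn (ModelWithCorners.pi fun _ : Fin (l + 1) => 𝓡 k) (𝓡 k) f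
      {w | 𝒢.IsComposable w}
      (fun w => {v | ∀ j : Fin l,
        (mfderiv (𝓡 k) (𝓡 n) 𝒢.s (w j.castSucc) (v j.castSucc) : EuclideanSpace ℝ (Fin n)) =
          mfderiv (𝓡 k) (𝓡 n) 𝒢.t (w j.succ) (v j.succ)})

/-- The structure maps of `ℋ` are those of the associative completion: source and target of words,
classes of units, and juxtaposition of words. -/
def IsCompletionStructure [ChartedSpace (EuclideanSpace ℝ (Fin k)) 𝒢.AssocCompletion]
    (ℋ : LocalLieGroupoid n k M 𝒢.AssocCompletion) : Prop :=
  (∀ w, ℋ.s (𝒢.toCompletion w) = 𝒢.wordSource w) ∧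
  (∀ w, ℋ.t (𝒢.toCompletion w) = 𝒢.wordTarget w) ∧
  (∀ x, ℋ.u x = 𝒢.toCompletion (𝒢.letter (𝒢.u x))) ∧
  (∀ w w' (h : 𝒢.wordSource w = 𝒢.wordTarget w'),
    ℋ.m (𝒢.toCompletion w) (𝒢.toCompletion w') = 𝒢.toCompletion (𝒢.append w w' h))

/-- The local Lie groupoid `𝒢'` is obtained from `𝒢` by shrinking to the open neighbourhood `O` of
the units: the product of `g, h ∈ O` is defined in `𝒢'` exactly if it is defined in `𝒢` and lies
in `O`, and the inversion is a restriction of that of `𝒢`. -/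
def ShrinksTo {O : Opens G} (𝒢' : LocalLieGroupoid n k M O) : Prop :=
  (∀ g : O, 𝒢'.s g = 𝒢.s g) ∧ (∀ g : O, 𝒢'.t g = 𝒢.t g) ∧ (∀ x, (𝒢'.u x : G) = 𝒢.u x) ∧
  (∀ g h : O, (g, h) ∈ 𝒢'.U ↔ ((g : G), (h : G)) ∈ 𝒢.U ∧ 𝒢.m g h ∈ O) ∧
  (∀ g h : O, (g, h) ∈ 𝒢'.U → (𝒢'.m g h : G) = 𝒢.m g h) ∧
  (∀ g ∈ 𝒢'.V, (g : G) ∈ 𝒢.V ∧ (𝒢'.i g : G) = 𝒢.i g)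

end Basic

/-- `𝒢` integrates `A`: there is an isomorphism `θ`, over the identity of `M`, from `A` to the Lie
algebroid of `𝒢`. The latter is the bundle of vectors tangent to the source fibres at the units,
with anchor `dt` and with the bracket of sections `a, b` given by the values at the units of the Lie
bracket of the vector fields that extend `a, b` by right translation. (Only the germ of `𝒢` along
the units matters, so there is no need to pass to a right-regular neighbourhood of the units.) -/
def Integrates {n k : ℕ} {M : Type u} [TopologicalSpace M]
    [ChartedSpace (EuclideanSpace ℝ (Fin n)) M] [IsManifold (𝓡 n) ∞ M]
    {G : Type v} [TopologicalSpace G] [ChartedSpace (EuclideanSpace ℝ (Fin k)) G]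
    [IsManifold (𝓡 k) ∞ G] (𝒢 : LocalLieGroupoid n k M G)
    {F : Type*} [NormedAddCommGroup F] [NormedSpace ℝ F]
    {V : M → Type*} [∀ x, AddCommGroup (V x)] [∀ x, Module ℝ (V x)]
    [TopologicalSpace (Bundle.TotalSpace F V)] [∀ x, TopologicalSpace (V x)]
    [FiberBundle F V] [VectorBundle ℝ F V] (A : LieAlgebroid n M F V) : Prop :=
  ∃ θ : ∀ x, V x →ₗ[ℝ] TangentSpace (𝓡 k) (𝒢.u x),
    ContMDiff ((𝓡 n).prod 𝓘(ℝ, F)) (𝓡 k).tangent ∞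
      (fun p : Bundle.TotalSpace F V =>
        (⟨𝒢.u p.1, θ p.1 p.2⟩ : TangentBundle (𝓡 k) G)) ∧
    (∀ x, Function.Injective (θ x) ∧ range (θ x) = 𝒢.tangentSource (𝒢.u x)) ∧
    (∀ x v, (mfderiv (𝓡 k) (𝓡 n) 𝒢.t (𝒢.u x) (θ x v) : EuclideanSpace ℝ (Fin n)) =
      A.anchor x v) ∧
    ∀ (α β : ContMDiffSection (𝓡 n) F ∞ V) (x : M),
      VectorField.mlieBracket (𝓡 k) (𝒢.rightField fun y => θ y (α y))
        (𝒢.rightField fun y => θ y (β y)) (𝒢.u x) = θ x (A.bracket α β x)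

end LocalLieGroupoid

/-- A Lie algebroid is integrable if there is a Lie groupoid integrating it. -/
def LieAlgebroid.IsIntegrable {n : ℕ} {M : Type u} [TopologicalSpace M]
    [ChartedSpace (EuclideanSpace ℝ (Fin n)) M] [IsManifold (𝓡 n) ∞ M]
    {F : Type*} [NormedAddCommGroup F] [NormedSpace ℝ F]
    {V : M → Type*} [∀ x, AddCommGroup (V x)] [∀ x, Module ℝ (V x)]
    [TopologicalSpace (Bundle.TotalSpace F V)] [∀ x, TopologicalSpace (V x)]
    [FiberBundle F V] [VectorBundle ℝ F V] (A : LieAlgebroid n M F V) : Prop :=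
  ∃ (k : ℕ) (G : Type u) (_ : TopologicalSpace G)
    (_ : ChartedSpace (EuclideanSpace ℝ (Fin k)) G) (_ : IsManifold (𝓡 k) ∞ G)
    (𝒢 : LocalLieGroupoid n k M G), 𝒢.IsLieGroupoid ∧ 𝒢.Integrates A

end

/-!
The theorem rests on shrinking a local Lie groupoid `𝒢` to so small a neighbourhood `𝒢'` of the
units that the associative completion of `𝒢'` can be controlled inside `𝒢`.

*Shrinking.* In coordinates `(t, κ)` near a unit, with `t` the target and `κ = 0` at the units, the
function `‖κ‖ ^ 2` is convex along short segments in the target fibres and along their left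
translates. Bounds on these norms, over a locally finite compact cover of `M`, cut out arbitrarily
small neighbourhoods of the units that are convex along the target fibres
(`LocalLieGroupoid.exists_convex_opens`). On a small one, arrows can be divided by one another in
`𝒢`, and by uniform discreteness no quotient of two of them is an associator other than a unit;
this is a fine shrinking (`LocalLieGroupoid.IsThreeAssociative.exists_isFineShrinking`).
Translation by an arrow is undone by translation by its inverse, which gives bi-regularity;
convexity gives products connected to the axes; and associators of `𝒢'` are associators of `𝒢`,
hence units.

*Arrows inject into the completion.* A contraction of `(g, h)` to `gh` in a word of `𝒢'` can be
undone by inserting `(h⁻¹, h)`, which is possible in `𝒢`. Therefore two words of `𝒢'` with the same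
class are contractions of a common word of `𝒢`
(`LocalLieGroupoid.IsFineShrinking.exists_common_expansion`). If the arrows `g` and `g'` have the
same class, then `g⁻¹ g'` is an associator, so it is a unit and `g = g'`.

*Smooth structure.* A family of elements of the completion is word-smooth if it is locally
represented by words with smooth letters. Since the multiplication of `𝒢'` has smooth local
sections, contractions can be undone smoothly, and so the word that represents the family at one
point may be prescribed (`LocalLieGroupoid.WordSmooth.exists_isLocalRep`). Every arrow is a product
of invertible arrows, by subdivision of a path to a unit, so word-smooth families are closed under
products and inverses. The charts of the completion are charts of arrows translated by bisections,
and the smooth maps to the completion are the word-smooth families; from this the axioms of a Lie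
groupoid follow (`LocalLieGroupoid.completion`), and also that the projection from words is a
submersion (`LocalLieGroupoid.isSmoothQuotient_completion`). The fibres are Hausdorff because
`(p, q) ↦ p⁻¹ q` is continuous.

*Lie algebroid.* The preferred charts of the completion at classes of arrows are charts of arrows,
so the map from arrows to their classes is the identity in the charts at the units, and the Lie
algebroid is the same (`LocalLieGroupoid.IsGermMorphism.integrates`).

*Converse.* In a Lie groupoid the product of the letters of a word is invariant under contraction,
so the associators are the units and are uniformly discrete.
-/

open Filter Topology

noncomputable section

/-! ### Inverse functions and linear algebra -/

section InverseFunction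

theorem eventually_bijective_of_continuousAt {Z E E' : Type*} [TopologicalSpace Z]
    [NormedAddCommGroup E] [NormedSpace ℝ E] [CompleteSpace E] [NormedAddCommGroup E']
    [NormedSpace ℝ E'] {D : Z → E →L[ℝ] E'} {z₀ : Z} (hD : ContinuousAt D z₀)
    (e : E ≃L[ℝ] E') (he : (e : E →L[ℝ] E') = D z₀) :
    ∀ᶠ z in 𝓝 z₀, ∃ e' : E ≃L[ℝ] E', (e' : E →L[ℝ] E') = D z := by
  have := hD.eventually_mem (ContinuousLinearEquiv.isOpen.mem_nhds ⟨e, he⟩)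
  exact this

/-- A local inverse of a smooth map with invertible differential is smooth on a whole neighbourhood,
not only at the image of the base point. -/
theorem ContDiffAt.exists_local_inverse {E E' : Type*}
    [NormedAddCommGroup E] [NormedSpace ℝ E] [CompleteSpace E] [NormedAddCommGroup E']
    [NormedSpace ℝ E'] {f : E → E'} {z₀ : E} (hf : ∀ᶠ z in 𝓝 z₀, ContDiffAt ℝ ∞ f z)
    (e : E ≃L[ℝ] E') (he : HasFDerivAt f (e : E →L[ℝ] E') z₀) :
    ∃ g : E' → E, g (f z₀) = z₀ ∧ (∀ᶠ y in 𝓝 (f z₀), ContDiffAt ℝ ∞ g y ∧ f (g y) = y) ∧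
      ∀ᶠ z in 𝓝 z₀, g (f z) = z := by
  have hf0 := hf.self_of_nhds
  set Φ := hf0.toOpenPartialHomeomorph f he (by simp) with hΦ
  have hΦf : (Φ : E → E') = f := rfl
  have hs : z₀ ∈ Φ.source := hf0.mem_toOpenPartialHomeomorph_source he (by simp)
  have ht : f z₀ ∈ Φ.target := hf0.image_mem_toOpenPartialHomeomorph_target he (by simp)
  have hinv : Φ.symm (f z₀) = z₀ := Φ.left_inv hs
  refine ⟨Φ.symm, hinv, ?_, Φ.eventually_left_inverse hs⟩
  have hcont : ContinuousAt (fderiv ℝ f) z₀ :=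
    (hf0.fderiv_right (m := 0) (by simp)).continuousAt
  have hev : ∀ᶠ z in 𝓝 z₀, ∃ e' : E ≃L[ℝ] E', (e' : E →L[ℝ] E') = fderiv ℝ f z :=
    eventually_bijective_of_continuousAt hcont e he.fderiv.symm
  have hΦc : Tendsto Φ.symm (𝓝 (f z₀)) (𝓝 z₀) := by
    have := Φ.continuousAt_symm ht
    rwa [ContinuousAt, hinv] at this
  filter_upwards [hΦc.eventually hev, hΦc.eventually hf, Φ.open_target.mem_nhds ht]
    with y ⟨e', he'⟩ hfy hy
  refine ⟨Φ.contDiffAt_symm (f₀' := e') hy ?_ (by simpa [hΦf] using hfy), Φ.right_inv hy⟩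
  rw [he', hΦf]
  exact (hfy.differentiableAt (by simp)).hasFDerivAt

variable {E H E' H' X Y : Type*} [NormedAddCommGroup E] [NormedSpace ℝ E] [FiniteDimensional ℝ E]
  [TopologicalSpace H] {I : ModelWithCorners ℝ E H} [I.Boundaryless] [TopologicalSpace X]
  [ChartedSpace H X] [IsManifold I ∞ X]
  [NormedAddCommGroup E'] [NormedSpace ℝ E']
  [TopologicalSpace H'] {I' : ModelWithCorners ℝ E' H'} [I'.Boundaryless] [TopologicalSpace Y]
  [ChartedSpace H' Y] [IsManifold I' ∞ Y]

/-- The inverse function theorem for germs of smooth maps between manifolds without boundary. -/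
theorem exists_local_inverse {f : X → Y} {x : X} (hf : ∀ᶠ z in 𝓝 x, ContMDiffAt I I' ∞ f z)
    (hbij : Function.Bijective (mfderiv I I' f x)) :
    ∃ g : Y → X, g (f x) = x ∧ (∀ᶠ y in 𝓝 (f x), ContMDiffAt I' I ∞ g y ∧ f (g y) = y) ∧
      ∀ᶠ z in 𝓝 x, g (f z) = z := by
  have hfx := hf.self_of_nhds
  set φ := extChartAt I x with hφ
  set ψ := extChartAt I' (f x) with hψ
  have hφs : Tendsto φ.symm (𝓝 (φ x)) (𝓝 x) := by
    have := (continuousAt_extChartAt_symm (I := I) x)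
    rwa [ContinuousAt, extChartAt_to_inv] at this
  have hφt : ∀ᶠ z in 𝓝 (φ x), z ∈ φ.target := extChartAt_target_mem_nhds x
  have hψs : Tendsto ψ.symm (𝓝 (ψ (f x))) (𝓝 (f x)) := by
    have := (continuousAt_extChartAt_symm (I := I') (f x))
    rwa [ContinuousAt, extChartAt_to_inv] at this
  have hφsm : ∀ᶠ z in 𝓝 (φ x), ContMDiffAt 𝓘(ℝ, E) I ∞ φ.symm z := by
    filter_upwards [eventually_eventually_nhds.2 hφt] with z hz
    exact (contMDiffOn_extChartAt_symm x).contMDiffAt hz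
  have hψm : ∀ᶠ y in 𝓝 (f x), ContMDiffAt I' 𝓘(ℝ, E') ∞ ψ y := by
    filter_upwards [(chartAt H' (f x)).open_source.mem_nhds (mem_chart_source H' (f x))]
      with y hy using contMDiffAt_extChartAt' hy
  have hφm : ∀ᶠ y in 𝓝 x, ContMDiffAt I 𝓘(ℝ, E) ∞ φ y := by
    filter_upwards [(chartAt H x).open_source.mem_nhds (mem_chart_source H x)]
      with y hy using contMDiffAt_extChartAt' hy
  have hψsm : ∀ᶠ z in 𝓝 (ψ (f x)), ContMDiffAt 𝓘(ℝ, E') I' ∞ ψ.symm z := by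
    filter_upwards [eventually_eventually_nhds.2 (extChartAt_target_mem_nhds (I := I') (f x))]
      with z hz using (contMDiffOn_extChartAt_symm (f x)).contMDiffAt hz
  have hfc : Tendsto f (𝓝 x) (𝓝 (f x)) := hfx.continuousAt
  -- `f` in the preferred charts
  set F : E → E' := ψ ∘ f ∘ φ.symm with hF
  have hF0 : F (φ x) = ψ (f x) := by simp [hF, hφ]
  have hFs : ∀ᶠ z in 𝓝 (φ x), ContDiffAt ℝ ∞ F z := by
    filter_upwards [hφsm, hφs.eventually hf, hφs.eventually (hfc.eventually hψm)] with z h1 h2 h3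
    exact ContMDiffAt.contDiffAt (h3.comp z (h2.comp z h1))
  have hder : fderiv ℝ F (φ x) = mfderiv I I' f x := by
    rw [(hfx.mdifferentiableAt (by simp)).mfderiv, I.range_eq_univ, fderivWithin_univ]
    rfl
  have hfd : HasFDerivAt F (mfderiv I I' f x) (φ x) := by
    rw [← hder]
    exact (hFs.self_of_nhds.differentiableAt (by simp)).hasFDerivAt
  set A : E →L[ℝ] E' := mfderiv I I' f x with hA
  let e : E ≃L[ℝ] E' :=
    (LinearEquiv.ofBijective (A : E →ₗ[ℝ] E') hbij).toContinuousLinearEquiv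
  have hee : (e : E →L[ℝ] E') = A := by ext v; rfl
  obtain ⟨g, hg0, hg1, hg2⟩ := ContDiffAt.exists_local_inverse hFs e (by rw [hee]; exact hfd)
  rw [hF0] at hg0 hg1
  have hgc : Tendsto g (𝓝 (ψ (f x))) (𝓝 (φ x)) := by
    have := hg1.self_of_nhds.1.continuousAt
    rwa [ContinuousAt, hg0] at this
  have hψc : Tendsto ψ (𝓝 (f x)) (𝓝 (ψ (f x))) := hψm.self_of_nhds.continuousAt
  have hφc : Tendsto φ (𝓝 x) (𝓝 (φ x)) := hφm.self_of_nhds.continuousAt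
  refine ⟨φ.symm ∘ g ∘ ψ, by simp [hg0, hφ], ?_, ?_⟩
  · have h5 : Tendsto (fun y => f (φ.symm (g (ψ y)))) (𝓝 (f x)) (𝓝 (f x)) :=
      hfc.comp (hφs.comp (hgc.comp hψc))
    filter_upwards [hψm, hψc.eventually hg1, hψc.eventually (hgc.eventually hφsm),
      (extChartAt_source_mem_nhds (I := I') (f x)),
      h5.eventually (extChartAt_source_mem_nhds (I := I') (f x))] with y h1 h2 h3 h4 h6
    refine ⟨h3.comp y ((h2.1.contMDiffAt).comp y h1), ?_⟩
    have := h2.2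
    exact ψ.injOn h6 h4 this
  · filter_upwards [hφc.eventually hg2, extChartAt_source_mem_nhds (I := I) x] with z h1 h2
    have : φ.symm (φ z) = z := φ.left_inv h2
    have h3 : F (φ z) = ψ (f z) := by simp [hF, this]
    rw [h3] at h1
    simp [h1, this]

end InverseFunction

/-- Two surjective linear maps to the same space have a common complement of their kernels: the
range of one linear map `j` whose composites with both of them are bijective. -/
theorem exists_bijective_comp_comp {E F : Type*} [AddCommGroup E] [Module ℝ E] [AddCommGroup F]
    [Module ℝ F] [FiniteDimensional ℝ F] {A B : E →ₗ[ℝ] F} (hA : Function.Surjective A)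
    (hB : Function.Surjective B) :
    ∃ j : F →ₗ[ℝ] E, Function.Bijective (A ∘ₗ j) ∧ Function.Bijective (B ∘ₗ j) := by
  obtain ⟨a, ha⟩ := A.exists_rightInverse_of_surjective (LinearMap.range_eq_top.2 hA)
  obtain ⟨b, hb⟩ := B.exists_rightInverse_of_surjective (LinearMap.range_eq_top.2 hB)
  -- `A (a - μ b)` and `B (a - μ b)` are `1 - μ A b` and `B a - μ`, which are singular for
  -- finitely many `μ` only.
  have h1 : (((B ∘ₗ a).charpoly.rootSet ℝ) ∪
      ((fun μ : ℝ => μ⁻¹) '' ((A ∘ₗ b).charpoly.rootSet ℝ)) ∪ {0}).Finite :=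
    (((Polynomial.rootSet_finite _ _).union ((Polynomial.rootSet_finite _ _).image _))).union
      (Set.finite_singleton _)
  obtain ⟨μ, hμ⟩ := h1.infinite_compl.nonempty
  simp only [mem_compl_iff, mem_union, not_or, mem_singleton_iff] at hμ
  obtain ⟨⟨hμ1, hμ2⟩, hμ0⟩ := hμ
  have key : ∀ (f : F →ₗ[ℝ] F) (ν : ℝ), ν ∉ f.charpoly.rootSet ℝ →
      ∀ v, f v = ν • v → v = 0 := by
    intro f ν hν v hv
    by_contra hv0
    apply hν
    rw [Polynomial.mem_rootSet_of_ne f.charpoly_monic.ne_zero]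
    have : Module.End.HasEigenvalue f ν := Module.End.hasEigenvalue_of_hasEigenvector
      (Module.End.hasEigenvector_iff.2 ⟨Module.End.mem_eigenspace_iff.2 hv, hv0⟩)
    have := (Module.End.hasEigenvalue_iff_isRoot_charpoly f ν).1 this
    simpa [Polynomial.aeval_def, Polynomial.eval₂_eq_eval_map] using this
  have bij : ∀ f : F →ₗ[ℝ] F, (∀ v, f v = 0 → v = 0) → Function.Bijective f := fun f h =>
    have hi : Function.Injective f := (injective_iff_map_eq_zero f).2 h
    ⟨hi, LinearMap.injective_iff_surjective.1 hi⟩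
  refine ⟨a - μ • b, bij _ fun v hv => ?_, bij _ fun v hv => ?_⟩
  all_goals
    have hav : A (a v) = v := LinearMap.congr_fun ha v
    have hbv : B (b v) = v := LinearMap.congr_fun hb v
    simp only [LinearMap.comp_apply, LinearMap.sub_apply, LinearMap.smul_apply, map_sub,
      map_smul, hav, hbv] at hv
  · refine key (A ∘ₗ b) μ⁻¹ (fun h => hμ2 ⟨_, h, inv_inv μ⟩) v ?_
    rw [sub_eq_zero] at hv
    nth_rewrite 2 [hv]
    rw [smul_smul, inv_mul_cancel₀ hμ0, one_smul]; rfl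
  · exact key (B ∘ₗ a) μ hμ1 v (sub_eq_zero.1 hv)

/-! ### Submersions and bisections -/

section Submersion

variable {E H E' H' X Y : Type*} [NormedAddCommGroup E] [NormedSpace ℝ E]
  [TopologicalSpace H] {I : ModelWithCorners ℝ E H} [TopologicalSpace X]
  [ChartedSpace H X]
  [NormedAddCommGroup E'] [NormedSpace ℝ E']
  [TopologicalSpace H'] {I' : ModelWithCorners ℝ E' H'} [TopologicalSpace Y]
  [ChartedSpace H' Y]

variable (I I') in
/-- The differential of `f` at `x`, as a linear map between the model spaces. -/
abbrev modelDeriv (f : X → Y) (x : X) : E →L[ℝ] E' := mfderiv I I' f x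

/-- The tangent space at `x` is the model space by way of the preferred chart at `x`, so in this
chart the differential of the chart itself is the identity. -/
theorem hasMFDerivAt_extChartAt_self (x : X) :
    HasMFDerivAt I 𝓘(ℝ, E) (extChartAt I x) x (ContinuousLinearMap.id ℝ E) := by
  refine ⟨continuousAt_extChartAt x, ?_⟩
  have : writtenInExtChartAt I 𝓘(ℝ, E) x (extChartAt I x) =ᶠ[𝓝[range I] (extChartAt I x x)] id := by
    filter_upwards [extChartAt_target_mem_nhdsWithin (I := I) x] with z hz
    simp only [writtenInExtChartAt, extChartAt_model_space_eq_id, PartialEquiv.refl_coe,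
      Function.comp_apply, id]
    exact (extChartAt I x).right_inv hz
  exact (hasFDerivWithinAt_id _ _).congr_of_eventuallyEq this
    (this.self_of_nhdsWithin (mem_range_self _))

theorem hasMFDerivAt_extChartAt_symm_self [I.Boundaryless] (x : X) :
    HasMFDerivAt 𝓘(ℝ, E) I (extChartAt I x).symm (extChartAt I x x)
      (ContinuousLinearMap.id ℝ E) := by
  refine ⟨continuousAt_extChartAt_symm x, ?_⟩
  have : writtenInExtChartAt 𝓘(ℝ, E) I (extChartAt I x x) (extChartAt I x).symm =ᶠ[𝓝
      (extChartAt I x x)] id := by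
    filter_upwards [extChartAt_target_mem_nhds (I := I) x] with z hz
    simp only [writtenInExtChartAt, extChartAt_model_space_eq_id, PartialEquiv.refl_coe,
      Function.comp_apply, PartialEquiv.refl_symm, id, extChartAt_to_inv]
    exact (extChartAt I x).right_inv hz
  have h2 : HasFDerivAt (writtenInExtChartAt 𝓘(ℝ, E) I (extChartAt I x x) (extChartAt I x).symm)
      (ContinuousLinearMap.id ℝ E) (extChartAt I x x) :=
    (hasFDerivAt_id _).congr_of_eventuallyEq this
  exact h2.hasFDerivWithinAt

variable [IsManifold I ∞ X]

theorem eventually_contMDiffAt_extChartAt (x : X) :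
    ∀ᶠ y in 𝓝 x, ContMDiffAt I 𝓘(ℝ, E) ∞ (extChartAt I x) y := by
  filter_upwards [(chartAt H x).open_source.mem_nhds (mem_chart_source H x)]
    with y hy using contMDiffAt_extChartAt' hy

theorem eventually_contMDiffAt_extChartAt_symm [I.Boundaryless] (x : X) :
    ∀ᶠ z in 𝓝 (extChartAt I x x), ContMDiffAt 𝓘(ℝ, E) I ∞ (extChartAt I x).symm z := by
  filter_upwards [eventually_eventually_nhds.2 (extChartAt_target_mem_nhds (I := I) x)]
    with z hz using (contMDiffOn_extChartAt_symm x).contMDiffAt hz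

variable [FiniteDimensional ℝ E] [I.Boundaryless] [IsManifold I' ∞ Y] [I'.Boundaryless]

/-- A submersion `f` is completed to a local coordinate system by the projection to `ker df` of
any function `c` whose differential is the identity on `ker df`. -/
theorem exists_submersion_coordinates {f : X → Y} {x : X} {c : X → E}
    (hf : ∀ᶠ z in 𝓝 x, ContMDiffAt I I' ∞ f z)
    (hs : Function.Surjective (mfderiv I I' f x))
    (hc : ∀ᶠ z in 𝓝 x, ContMDiffAt I 𝓘(ℝ, E) ∞ c z) (hc0 : c x = 0)
    (hdc : ∀ v : E, (mfderiv I I' f x v : E') = 0 → (mfderiv I 𝓘(ℝ, E) c x v : E) = v) :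
    ∃ (P : E →L[ℝ] E) (ι : Y × E → X), (∀ v, (mfderiv I I' f x (P v) : E') = 0) ∧
      (∀ v, (mfderiv I I' f x v : E') = 0 → P v = v) ∧ ι (f x, 0) = x ∧
      (∀ᶠ z in 𝓝 x, ι (f z, P (c z)) = z) ∧
      ∀ᶠ q in 𝓝 (f x, (0 : E)), ContMDiffAt (I'.prod 𝓘(ℝ, E)) I ∞ ι q ∧ f (ι q) = q.1 ∧
        P (c (ι q)) = P q.2 := by
  set A : E →L[ℝ] E' := mfderiv I I' f x with hA
  set K : Submodule ℝ E := LinearMap.ker (A : E →ₗ[ℝ] E') with hK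
  obtain ⟨P₀, hP₀⟩ := K.subtype.exists_leftInverse_of_injective (by simp)
  let P' : E →L[ℝ] K := LinearMap.toContinuousLinearMap P₀
  have hP' : ∀ v : K, P' v = v := fun v => LinearMap.congr_fun hP₀ v
  -- By the assumption on `dc`, the map `Ψ` has bijective differential: it is inverted to give `ι`.
  set Ψ : X → Y × K := fun z => (f z, P' (c z)) with hΨ
  have hΨs : ∀ᶠ z in 𝓝 x, ContMDiffAt I (I'.prod 𝓘(ℝ, K)) ∞ Ψ z := by
    filter_upwards [hf, hc] with z h1 h2
    exact h1.prodMk (P'.contMDiff.contMDiffAt.comp z h2)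
  set D : E →L[ℝ] E := mfderiv I 𝓘(ℝ, E) c x with hD
  have hder : HasMFDerivAt I (I'.prod 𝓘(ℝ, K)) Ψ x (A.prod (P'.comp D)) := by
    have h1 : HasMFDerivAt I I' f x A := (hf.self_of_nhds.mdifferentiableAt (by simp)).hasMFDerivAt
    have h2 : HasMFDerivAt I 𝓘(ℝ, E) c x D :=
      (hc.self_of_nhds.mdifferentiableAt (by simp)).hasMFDerivAt
    exact h1.prodMk ((P'.hasMFDerivAt (x := c x)).comp x h2)
  have hbij : Function.Bijective (mfderiv I (I'.prod 𝓘(ℝ, K)) Ψ x) := by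
    rw [hder.mfderiv]
    constructor
    · refine (injective_iff_map_eq_zero (A.prod (P'.comp D))).2 fun v hv => ?_
      have h1 : A v = 0 := congrArg Prod.fst hv
      have h2 : P' (D v) = 0 := congrArg Prod.snd hv
      rw [show D v = v from hdc v h1] at h2
      have h3 := hP' ⟨v, h1⟩
      simp only [h2] at h3
      exact (congrArg Subtype.val h3).symm
    · rintro ⟨a, b⟩
      obtain ⟨v, hv⟩ : ∃ v : E, A v = a := hs a
      have hb : A (b : E) = 0 := b.2
      have hw : A ((P' (D v) : K) : E) = 0 := (P' (D v)).2
      refine ⟨v + (b : E) - ((P' (D v) : K) : E), ?_⟩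
      have e1 : A (v + (b : E) - ((P' (D v) : K) : E)) = a := by
        rw [map_sub, map_add, hb, hw, add_zero, sub_zero, hv]
      have e2 : P' (D (v + (b : E) - ((P' (D v) : K) : E))) = b := by
        rw [map_sub, map_add, show D b = b from hdc _ hb,
          show D ((P' (D v) : K) : E) = ((P' (D v) : K) : E) from hdc _ hw, map_sub, map_add, hP', hP']
        abel
      exact Prod.ext e1 e2
  obtain ⟨g, hg0, hg1, hg2⟩ := exists_local_inverse hΨs hbij
  have hΨx : Ψ x = (f x, 0) := by simp [hΨ, hc0]
  rw [hΨx] at hg0 hg1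
  have hPK : ∀ k : K, P' (k : E) = k := hP'
  refine ⟨K.subtypeL.comp P', fun q => g (q.1, P' q.2), fun v => (P' v).2, fun v hv => ?_,
    by simpa using hg0, ?_, ?_⟩
  · exact congrArg Subtype.val (hP' ⟨v, hv⟩)
  · filter_upwards [hg2] with z hz
    simp only [ContinuousLinearMap.comp_apply, Submodule.subtypeL_apply, hPK]
    exact hz
  · have hT : ContMDiff (I'.prod 𝓘(ℝ, E)) (I'.prod 𝓘(ℝ, K)) ∞
        (fun q : Y × E => (q.1, P' q.2)) :=
      contMDiff_fst.prodMk (P'.contMDiff.comp contMDiff_snd)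
    have hTc : Tendsto (fun q : Y × E => (q.1, P' q.2)) (𝓝 (f x, 0)) (𝓝 (f x, 0)) := by
      have := hT.continuous.tendsto (f x, 0)
      simpa using this
    filter_upwards [hTc.eventually hg1] with q hq
    refine ⟨hq.1.comp q hT.contMDiffAt, congrArg Prod.fst hq.2, ?_⟩
    have := congrArg Prod.snd hq.2
    simp only [hΨ] at this
    simp only [ContinuousLinearMap.comp_apply, Submodule.subtypeL_apply]
    rw [this]

/-- Near a point where `f` is a submersion there is a smooth retraction onto the fibre of `f`. -/
theorem exists_fiber_retraction {f : X → Y} {x : X}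
    (hf : ∀ᶠ z in 𝓝 x, ContMDiffAt I I' ∞ f z)
    (hs : Function.Surjective (mfderiv I I' f x)) :
    ∃ (r : X → X) (D : E →L[ℝ] E), r x = x ∧ (∀ᶠ z in 𝓝 x, f (r z) = f x) ∧
      HasMFDerivAt I I r x D ∧ ∀ v : E, (mfderiv I I' f x v : E') = 0 → D v = v := by
  set c : X → E := fun z => extChartAt I x z - extChartAt I x x with hc
  have hcd : HasMFDerivAt I 𝓘(ℝ, E) c x (ContinuousLinearMap.id ℝ E) := by
    have := (hasMFDerivAt_extChartAt_self (I := I) x).sub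
      (hasMFDerivAt_const (extChartAt I x x) x)
    exact this.congr_mfderiv (sub_zero _)
  have hcs : ∀ᶠ z in 𝓝 x, ContMDiffAt I 𝓘(ℝ, E) ∞ c z := by
    filter_upwards [eventually_contMDiffAt_extChartAt (I := I) x] with z hz
    exact hz.sub contMDiffAt_const
  -- In the coordinates `(f, P c)` the retraction replaces the first coordinate by `f x`.
  obtain ⟨P, ι, hP1, hP2, hι0, hι1, hι2⟩ := exists_submersion_coordinates hf hs hcs (by simp [hc])
    (fun v _ => by rw [hcd.mfderiv]; rfl)
  set B : E' × E →L[ℝ] E := mfderiv (I'.prod 𝓘(ℝ, E)) I ι (f x, 0) with hB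
  have hιd : HasMFDerivAt (I'.prod 𝓘(ℝ, E)) I ι (f x, 0) B :=
    (hι2.self_of_nhds.1.mdifferentiableAt (by simp)).hasMFDerivAt
  have hPc : HasMFDerivAt I 𝓘(ℝ, E) (fun z => P (c z)) x P := by
    have := (P.hasMFDerivAt (x := c x)).comp x hcd
    exact this
  have hPx : P (c x) = 0 := by simp [hc]
  set A : E →L[ℝ] E' := mfderiv I I' f x with hA
  have hfd : HasMFDerivAt I I' f x A := (hf.self_of_nhds.mdifferentiableAt (by simp)).hasMFDerivAt
  have h1 : HasMFDerivAt I (I'.prod 𝓘(ℝ, E)) (fun z => (f x, P (c z))) x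
      ((0 : E →L[ℝ] E').prod P) := (hasMFDerivAt_const (f x) x).prodMk hPc
  have h2 : HasMFDerivAt I (I'.prod 𝓘(ℝ, E)) (fun z => (f z, P (c z))) x (A.prod P) :=
    hfd.prodMk hPc
  have h3 : HasMFDerivAt I I (fun z => ι (f z, P (c z))) x (B.comp (A.prod P)) :=
    HasMFDerivAt.comp x (by rw [hPx]; exact hιd) h2
  have h4 : HasMFDerivAt I I (fun z => ι (f x, P (c z))) x (B.comp ((0 : E →L[ℝ] E').prod P)) :=
    HasMFDerivAt.comp x (by rw [hPx]; exact hιd) h1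
  -- differentiate `ι (f z, P (c z)) = z`
  have h5 : B.comp (A.prod P) = ContinuousLinearMap.id ℝ E :=
    hasMFDerivAt_unique h3 ((hasMFDerivAt_id x).congr_of_eventuallyEq
      (by filter_upwards [hι1] with z hz using hz))
  refine ⟨fun z => ι (f x, P (c z)), _, by simp only [hPx, hι0], ?_, h4, fun v hv => ?_⟩
  · have : Tendsto (fun z => (f x, P (c z))) (𝓝 x) (𝓝 (f x, 0)) := by
      have := h1.continuousAt
      rwa [ContinuousAt, hPx] at this
    filter_upwards [this.eventually hι2] with z hz using hz.2.1
  · have h6 : B (A v, P v) = v := congrArg (fun T : E →L[ℝ] E => T v) h5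
    rwa [show A v = 0 from hv] at h6

/-- Two derivatives of the same function within a set that contains the fibre of a submersion agree
on the tangent space of the fibre. -/
theorem HasMFDerivWithinAt.eq_on_ker {E'' H'' Z : Type*} [NormedAddCommGroup E'']
    [NormedSpace ℝ E''] [TopologicalSpace H''] {I'' : ModelWithCorners ℝ E'' H''}
    [TopologicalSpace Z] [ChartedSpace H'' Z] {f : X → Y} {x : X}
    (hf : ContMDiff I I' ∞ f) (hs : Function.Surjective (mfderiv I I' f x))
    {F : X → Z} {A : Set X} {D₁ D₂ : E →L[ℝ] E''} (hA : ∀ᶠ z in 𝓝 x, f z = f x → z ∈ A)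
    (h₁ : HasMFDerivWithinAt I I'' F A x D₁) (h₂ : HasMFDerivWithinAt I I'' F A x D₂)
    {v : E} (hv : (mfderiv I I' f x v : E') = 0) : D₁ v = D₂ v := by
  obtain ⟨r, D, hr0, hr1, hr2, hr3⟩ :=
    exists_fiber_retraction (Eventually.of_forall fun z => hf z) hs
  have hrA : ∀ᶠ z in 𝓝 x, r z ∈ A := by
    have : Tendsto r (𝓝 x) (𝓝 x) := by
      have := hr2.continuousAt
      rwa [ContinuousAt, hr0] at this
    filter_upwards [this.eventually hA, hr1] with z h1 h2 using h1 h2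
  -- After composition with a retraction onto the fibre, the derivatives are derivatives at `x` and
  -- hence unique.
  have key : ∀ {D' : E →L[ℝ] E''}, HasMFDerivWithinAt I I'' F A x D' →
      HasMFDerivAt I I'' (F ∘ r) x (D'.comp D) := fun {D'} h => by
    have h' : HasMFDerivWithinAt I I'' F A (r x) D' := by rw [hr0]; exact h
    have := h'.comp x (hr2.hasMFDerivWithinAt (s := r ⁻¹' A)) Subset.rfl
    exact this.hasMFDerivAt hrA
  have := hasMFDerivAt_unique (key h₁) (key h₂)
  have : D₁ (D v) = D₂ (D v) := congrArg (fun T : E →L[ℝ] E'' => T v) this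
  rwa [hr3 v hv] at this

end Submersion

section Bisection

variable {n k : ℕ} {M : Type*} [TopologicalSpace M] [ChartedSpace (EuclideanSpace ℝ (Fin n)) M]
  [IsManifold (𝓡 n) ∞ M] {G : Type*} [TopologicalSpace G]
  [ChartedSpace (EuclideanSpace ℝ (Fin k)) G] [IsManifold (𝓡 k) ∞ G]

/-- A pair of submersions to the same manifold has local bisections: through every point `g₀` there
is a local section `β` of `t` for which `s ∘ β` is a local diffeomorphism, with inverse `b`. -/
theorem exists_local_bisection {s t : G → M} (hs : ContMDiff (𝓡 k) (𝓡 n) ∞ s)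
    (ht : ContMDiff (𝓡 k) (𝓡 n) ∞ t) {g₀ : G}
    (hss : Function.Surjective (mfderiv (𝓡 k) (𝓡 n) s g₀))
    (hts : Function.Surjective (mfderiv (𝓡 k) (𝓡 n) t g₀)) :
    ∃ (β : M → G) (b : M → M), β (t g₀) = g₀ ∧ b (s g₀) = t g₀ ∧
      (∀ᶠ y in 𝓝 (t g₀), ContMDiffAt (𝓡 n) (𝓡 k) ∞ β y ∧ t (β y) = y ∧ b (s (β y)) = y) ∧
      ∀ᶠ z in 𝓝 (s g₀), ContMDiffAt (𝓡 n) (𝓡 n) ∞ b z ∧ s (β (b z)) = z := by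
  set φ := extChartAt (𝓡 k) g₀ with hφ
  obtain ⟨j, hj1, hj2⟩ := exists_bijective_comp_comp
    (A := (modelDeriv (𝓡 k) (𝓡 n) s g₀).toLinearMap)
    (B := (modelDeriv (𝓡 k) (𝓡 n) t g₀).toLinearMap) hss hts
  let J : EuclideanSpace ℝ (Fin n) →L[ℝ] EuclideanSpace ℝ (Fin k) :=
    LinearMap.toContinuousLinearMap j
  -- `σ` is a slice through `g₀` in a direction complementary to the kernels of both `ds` and
  -- `dt`, so `s ∘ σ` and `t ∘ σ` have local inverses `ς` and `τ`.
  set L : EuclideanSpace ℝ (Fin n) → EuclideanSpace ℝ (Fin k) := fun z => φ g₀ + J z with hL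
  have hL0 : L 0 = φ g₀ := by simp [hL]
  have hLd : HasMFDerivAt (𝓡 n) (𝓡 k) L 0 J := by
    refine HasFDerivAt.hasMFDerivAt ?_
    exact J.hasFDerivAt.const_add _
  have hLs : ContMDiff (𝓡 n) (𝓡 k) ∞ L := by
    refine ContDiff.contMDiff ?_
    exact contDiff_const.add J.contDiff
  set σ : EuclideanSpace ℝ (Fin n) → G := fun z => φ.symm (L z) with hσ
  have hσ0 : σ 0 = g₀ := by simp [hσ, hL0, hφ]
  have hσs : ∀ᶠ z in 𝓝 (0 : EuclideanSpace ℝ (Fin n)), ContMDiffAt (𝓡 n) (𝓡 k) ∞ σ z := by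
    have : Tendsto L (𝓝 0) (𝓝 (φ g₀)) := by
      have := hLs.continuous.tendsto 0
      rwa [hL0] at this
    filter_upwards [this.eventually (eventually_contMDiffAt_extChartAt_symm (I := 𝓡 k) g₀)]
      with z hz
    exact hz.comp z hLs.contMDiffAt
  have hσd : HasMFDerivAt (𝓡 n) (𝓡 k) σ 0 J := by
    have h1 : HasMFDerivAt (𝓡 k) (𝓡 k) φ.symm (L 0)
        (ContinuousLinearMap.id ℝ (EuclideanSpace ℝ (Fin k))) := by
      rw [hL0]; exact hasMFDerivAt_extChartAt_symm_self g₀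
    exact h1.comp 0 hLd
  have hg : ∀ {f : G → M}, ContMDiff (𝓡 k) (𝓡 n) ∞ f →
      Function.Bijective ((modelDeriv (𝓡 k) (𝓡 n) f g₀).toLinearMap ∘ₗ j) →
      ∃ g : M → EuclideanSpace ℝ (Fin n), g (f g₀) = 0 ∧
        (∀ᶠ y in 𝓝 (f g₀), ContMDiffAt (𝓡 n) (𝓡 n) ∞ g y ∧ f (σ (g y)) = y) ∧
        ∀ᶠ z in 𝓝 (0 : EuclideanSpace ℝ (Fin n)), g (f (σ z)) = z := by
    intro f hf hb
    have hd : HasMFDerivAt (𝓡 n) (𝓡 n) (fun z => f (σ z)) 0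
        ((modelDeriv (𝓡 k) (𝓡 n) f g₀).comp J) := by
      have h1 : HasMFDerivAt (𝓡 k) (𝓡 n) f (σ 0) (modelDeriv (𝓡 k) (𝓡 n) f g₀) := by
        rw [hσ0]; exact (hf.mdifferentiableAt (by simp)).hasMFDerivAt
      exact h1.comp 0 hσd
    have := exists_local_inverse (I := 𝓡 n) (I' := 𝓡 n) (f := fun z => f (σ z)) (x := 0)
      (by filter_upwards [hσs] with z hz using hf.contMDiffAt.comp z hz)
      (by rw [hd.mfderiv]; exact hb)
    simpa only [hσ0] using this
  obtain ⟨ς, hς0, hς1, hς2⟩ := hg hs hj1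
  obtain ⟨τ, hτ0, hτ1, hτ2⟩ := hg ht hj2
  have hτc : Tendsto τ (𝓝 (t g₀)) (𝓝 0) := by
    have := hτ1.self_of_nhds.1.continuousAt
    rwa [ContinuousAt, hτ0] at this
  have hςc : Tendsto ς (𝓝 (s g₀)) (𝓝 0) := by
    have := hς1.self_of_nhds.1.continuousAt
    rwa [ContinuousAt, hς0] at this
  refine ⟨σ ∘ τ, t ∘ σ ∘ ς, by simp [hτ0, hσ0], by simp [hς0, hσ0], ?_, ?_⟩
  · filter_upwards [hτ1, hτc.eventually hσs, hτc.eventually hς2] with y h1 h2 h3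
    refine ⟨h2.comp y h1.1, h1.2, ?_⟩
    simp only [Function.comp_apply]
    rw [h3, h1.2]
  · filter_upwards [hς1, hςc.eventually hσs, hςc.eventually hτ2] with z h1 h2 h3
    refine ⟨ht.contMDiffAt.comp z (h2.comp z h1.1), ?_⟩
    simp only [Function.comp_apply]
    rw [h3, h1.2]

end Bisection

/-! ### Quasiconvexity of norms, and locally finite covers -/

section Convexity

/-- Along short segments in the directions in which the differential of `f` is injective, the norm
of `f` is quasiconvex near a zero of `f`: there `‖f‖ ^ 2` is convex. -/
theorem eventually_norm_segment_le {A K K' : Type*} [NormedAddCommGroup A] [NormedSpace ℝ A]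
    [NormedAddCommGroup K] [NormedSpace ℝ K] [FiniteDimensional ℝ K] [NormedAddCommGroup K']
    [InnerProductSpace ℝ K'] {f : A × K → K'} {a₀ : A} (hf : ContDiffAt ℝ 2 f (a₀, 0))
    (hf0 : f (a₀, 0) = 0) (hinj : ∀ y, fderiv ℝ f (a₀, 0) (0, y) = 0 → y = 0) :
    ∀ᶠ q in 𝓝 (a₀, (0 : K)), ∀ τ ∈ Icc (0 : ℝ) 1,
      ‖f (q.1, τ • q.2)‖ ≤ max ‖f (q.1, 0)‖ ‖f q‖ := by
  set L : A × K →L[ℝ] K' := fderiv ℝ f (a₀, 0) with hL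
  obtain ⟨c', hc'0, hc'⟩ := (L.comp (ContinuousLinearMap.inr ℝ A K)).toLinearMap.exists_antilipschitzWith
    (LinearMap.ker_eq_bot'.2 fun y hy => hinj y hy)
  obtain ⟨c, hc0, hc⟩ : ∃ c : ℝ, 0 < c ∧ ∀ y : K, c * ‖y‖ ≤ ‖L (0, y)‖ := by
    refine ⟨(c' : ℝ)⁻¹, by positivity, fun y => ?_⟩
    have h := hc'.le_mul_dist y 0
    simp only [dist_zero_right, map_zero] at h
    rw [inv_mul_le_iff₀ (by positivity)]
    exact h
  have hfd : ContDiffAt ℝ 1 (fderiv ℝ f) (a₀, 0) := hf.fderiv_right (by norm_num)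
  obtain ⟨C, S, hS, hC⟩ := hfd.exists_lipschitzOnWith
  -- `η` bounds the variation of the differential and `ε` the norm of `f`: they are so small that
  -- the growth of the derivative of `‖f‖ ^ 2` along a segment is dominated by its leading term.
  set η : ℝ := c / 4 with hη
  set ε : ℝ := c ^ 2 / (4 * (C + 1)) with hε
  have hε0 : 0 < ε := by positivity
  have hev : ∀ᶠ p in 𝓝 (a₀, (0 : K)), p ∈ S ∧ ‖fderiv ℝ f p - L‖ ≤ η ∧ ‖f p‖ ≤ ε ∧
      DifferentiableAt ℝ f p := by
    refine (eventually_mem_set.2 hS).and (Eventually.and ?_ (Eventually.and ?_ ?_))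
    · have := hfd.continuousAt.tendsto
      have h2 := this.eventually (Metric.closedBall_mem_nhds L (show (0 : ℝ) < η by positivity))
      filter_upwards [h2] with p hp
      simpa [dist_eq_norm] using hp
    · have := hf.continuousAt.tendsto
      rw [hf0] at this
      have h2 := this.eventually (Metric.closedBall_mem_nhds (0 : K') hε0)
      filter_upwards [h2] with p hp
      simpa [dist_eq_norm] using hp
    · have := hf.eventually (by simp)
      filter_upwards [this] with p hp using hp.differentiableAt (by simp)
  obtain ⟨δ, hδ, hball⟩ := Metric.eventually_nhds_iff_ball.1 hev
  filter_upwards [Metric.ball_mem_nhds _ hδ] with q hq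
  obtain ⟨a, y⟩ := q
  have hmem : ∀ τ ∈ Icc (0 : ℝ) 1, (a, τ • y) ∈ Metric.ball (a₀, (0 : K)) δ := by
    intro τ hτ
    rw [Metric.mem_ball, Prod.dist_eq, max_lt_iff] at hq ⊢
    refine ⟨hq.1, lt_of_le_of_lt ?_ hq.2⟩
    simp only [dist_zero_right, norm_smul, Real.norm_eq_abs, abs_of_nonneg hτ.1]
    exact mul_le_of_le_one_left (norm_nonneg _) hτ.2
  -- It is enough that the derivative `2 ⟪p, p'⟫` of `‖p‖ ^ 2` is monotone.
  set p : ℝ → K' := fun τ => f (a, τ • y) with hp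
  set p' : ℝ → K' := fun τ => fderiv ℝ f (a, τ • y) (0, y) with hp'
  have hder : ∀ τ ∈ Icc (0 : ℝ) 1, HasDerivAt p (p' τ) τ := by
    intro τ hτ
    have h1 : HasDerivAt (fun τ : ℝ => (a, τ • y)) ((0 : A), y) τ := by
      have h2 : HasDerivAt (fun τ : ℝ => τ • y) y τ := by
        simpa using (hasDerivAt_id τ).smul_const y
      exact (hasDerivAt_const τ a).prodMk h2
    exact (hball _ (hmem τ hτ)).2.2.2.hasFDerivAt.comp_hasDerivAt τ h1
  have hder2 : ∀ τ ∈ Icc (0 : ℝ) 1,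
      HasDerivAt (fun τ => ‖p τ‖ ^ 2) (2 * inner ℝ (p τ) (p' τ)) τ := fun τ hτ =>
    (hder τ hτ).norm_sq
  set l : K' := L (0, y) with hl
  have hΛ : η * ‖y‖ ≤ ‖l‖ / 4 := by
    have := hc y
    rw [hη]; linarith
  have hmono : ∀ σ ∈ Icc (0 : ℝ) 1, ∀ τ ∈ Icc (0 : ℝ) 1, σ ≤ τ →
      inner ℝ (p σ) (p' σ) ≤ (inner ℝ (p τ) (p' τ) : ℝ) := by
    intro σ hσ τ hτ hστ
    have e1 : ‖p τ - p σ - (τ - σ) • l‖ ≤ (τ - σ) * (‖l‖ / 4) := by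
      have h1 := (convex_ball (a₀, (0 : K)) δ).norm_image_sub_le_of_norm_hasFDerivWithin_le'
        (f := f) (f' := fderiv ℝ f) (φ := L) (C := η) (x := (a, σ • y)) (y := (a, τ • y))
        (fun z hz => (hball z hz).2.2.2.hasFDerivAt.hasFDerivWithinAt)
        (fun z hz => (hball z hz).2.1) (hmem σ hσ) (hmem τ hτ)
      have h2 : ((a, τ • y) - (a, σ • y) : A × K) = (τ - σ) • (0, y) := by
        simp [sub_smul]
      rw [h2, map_smul, norm_smul, Real.norm_eq_abs, abs_of_nonneg (sub_nonneg.2 hστ)] at h1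
      have h3 : ‖((0 : A), y)‖ = ‖y‖ := by simp
      rw [h3] at h1
      calc _ ≤ η * ((τ - σ) * ‖y‖) := h1
        _ = (τ - σ) * (η * ‖y‖) := by ring
        _ ≤ _ := mul_le_mul_of_nonneg_left hΛ (sub_nonneg.2 hστ)
    have e2 : ‖p' τ - l‖ ≤ ‖l‖ / 4 := by
      have h1 : p' τ - l = (fderiv ℝ f (a, τ • y) - L) (0, y) := by simp [hp', hl]
      rw [h1]
      refine ((ContinuousLinearMap.le_opNorm _ _).trans ?_).trans hΛ
      have h3 : ‖((0 : A), y)‖ = ‖y‖ := by simp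
      rw [h3]
      exact mul_le_mul_of_nonneg_right (hball _ (hmem τ hτ)).2.1 (norm_nonneg _)
    have e3 : ‖p' τ - p' σ‖ ≤ C * (τ - σ) * ‖y‖ ^ 2 := by
      have h1 : p' τ - p' σ = (fderiv ℝ f (a, τ • y) - fderiv ℝ f (a, σ • y)) (0, y) := by
        simp [hp']
      have h2 := hC.dist_le_mul _ (hball _ (hmem τ hτ)).1 _ (hball _ (hmem σ hσ)).1
      have h3 : dist (a, τ • y) (a, σ • y) = (τ - σ) * ‖y‖ := by
        rw [Prod.dist_eq, dist_self, dist_eq_norm, ← sub_smul, norm_smul, Real.norm_eq_abs,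
          abs_of_nonneg (sub_nonneg.2 hστ)]
        exact max_eq_right (mul_nonneg (sub_nonneg.2 hστ) (norm_nonneg _))
      rw [h3, dist_eq_norm] at h2
      rw [h1]
      refine (ContinuousLinearMap.le_opNorm _ _).trans ?_
      have h4 : ‖((0 : A), y)‖ = ‖y‖ := by simp
      rw [h4]
      calc _ ≤ C * ((τ - σ) * ‖y‖) * ‖y‖ := mul_le_mul_of_nonneg_right h2 (norm_nonneg _)
        _ = _ := by ring
    have e4 : ‖p σ‖ ≤ ε := (hball _ (hmem σ hσ)).2.2.1
    -- `⟪p τ, p' τ⟫ - ⟪p σ, p' σ⟫ = ⟪p τ - p σ, p' τ⟫ + ⟪p σ, p' τ - p' σ⟫`, where the first term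
    -- is at least `(1 - 1/4 - 1/4 - 1/16) (τ - σ) ‖l‖ ^ 2` and the second at least
    -- `-1/4 (τ - σ) ‖l‖ ^ 2`.
    have i1 : (τ - σ) * (7 / 16 * ‖l‖ ^ 2) ≤ (inner ℝ (p τ - p σ) (p' τ) : ℝ) := by
      set x1 := p τ - p σ - (τ - σ) • l with hx1
      set x2 := p' τ - l with hx2
      have h1 : p τ - p σ = (τ - σ) • l + x1 := by rw [hx1]; abel
      have h2 : p' τ = l + x2 := by rw [hx2]; abel
      rw [h1, h2, inner_add_left, inner_add_right, inner_add_right, real_inner_smul_left,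
        real_inner_smul_left, real_inner_self_eq_norm_sq]
      have b1 := neg_le_of_abs_le (abs_real_inner_le_norm l x2)
      have b2 := neg_le_of_abs_le (abs_real_inner_le_norm x1 l)
      have b3 := neg_le_of_abs_le (abs_real_inner_le_norm x1 x2)
      have d0 : 0 ≤ τ - σ := sub_nonneg.2 hστ
      have c1 : ‖l‖ * ‖x2‖ ≤ ‖l‖ * (‖l‖ / 4) := mul_le_mul_of_nonneg_left e2 (norm_nonneg _)
      have c2 : ‖x1‖ * ‖l‖ ≤ (τ - σ) * (‖l‖ / 4) * ‖l‖ :=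
        mul_le_mul_of_nonneg_right e1 (norm_nonneg _)
      have c3 : ‖x1‖ * ‖x2‖ ≤ (τ - σ) * (‖l‖ / 4) * (‖l‖ / 4) :=
        mul_le_mul e1 e2 (norm_nonneg _) (by positivity)
      have c4 : (τ - σ) * (-(‖l‖ * (‖l‖ / 4))) ≤ (τ - σ) * inner ℝ l x2 :=
        mul_le_mul_of_nonneg_left (by linarith) d0
      nlinarith [c4, c2, c3, b2, b3]
    have i2 : -((τ - σ) * (1 / 4 * ‖l‖ ^ 2)) ≤ (inner ℝ (p σ) (p' τ - p' σ) : ℝ) := by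
      have b1 := neg_le_of_abs_le (abs_real_inner_le_norm (p σ) (p' τ - p' σ))
      have c1 : ‖p σ‖ * ‖p' τ - p' σ‖ ≤ ε * (C * (τ - σ) * ‖y‖ ^ 2) :=
        mul_le_mul e4 e3 (norm_nonneg _) hε0.le
      have c2 : ε * C ≤ c ^ 2 / 4 := by
        rw [hε, div_mul_eq_mul_div, div_le_div_iff₀ (by positivity) (by norm_num)]
        nlinarith [sq_nonneg c]
      have c3 : c ^ 2 * ‖y‖ ^ 2 ≤ ‖l‖ ^ 2 := by
        rw [← mul_pow]
        exact pow_le_pow_left₀ (by positivity) (hc y) 2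
      have d0 : 0 ≤ τ - σ := sub_nonneg.2 hστ
      have c4 : ε * (C * (τ - σ) * ‖y‖ ^ 2) ≤ (τ - σ) * (1 / 4 * ‖l‖ ^ 2) := by
        calc ε * (C * (τ - σ) * ‖y‖ ^ 2) = (τ - σ) * (ε * C * ‖y‖ ^ 2) := by ring
          _ ≤ (τ - σ) * (c ^ 2 / 4 * ‖y‖ ^ 2) := by gcongr
          _ = (τ - σ) * (1 / 4 * (c ^ 2 * ‖y‖ ^ 2)) := by ring
          _ ≤ _ := by gcongr
      linarith
    have h : (inner ℝ (p τ) (p' τ) : ℝ) - inner ℝ (p σ) (p' σ) =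
        inner ℝ (p τ - p σ) (p' τ) + inner ℝ (p σ) (p' τ - p' σ) := by
      rw [inner_sub_left, inner_sub_right]; ring
    have d1 : 0 ≤ (τ - σ) * ‖l‖ ^ 2 := mul_nonneg (sub_nonneg.2 hστ) (sq_nonneg _)
    nlinarith
  have hconv : ConvexOn ℝ (Icc (0 : ℝ) 1) (fun τ => ‖p τ‖ ^ 2) := by
    refine MonotoneOn.convexOn_of_deriv (convex_Icc 0 1)
      (fun τ hτ => (hder2 τ hτ).continuousAt.continuousWithinAt)
      (fun τ hτ => (hder2 τ (interior_subset hτ)).differentiableAt.differentiableWithinAt) ?_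
    intro σ hσ τ hτ hστ
    rw [(hder2 σ (interior_subset hσ)).deriv, (hder2 τ (interior_subset hτ)).deriv]
    have := hmono σ (interior_subset hσ) τ (interior_subset hτ) hστ
    linarith
  intro τ hτ
  have h := hconv.le_max_of_mem_Icc (left_mem_Icc.2 zero_le_one) (right_mem_Icc.2 zero_le_one) hτ
  have e0 : p 0 = f (a, 0) := by simp [hp]
  have e1 : p 1 = f (a, y) := by simp [hp]
  rw [e0, e1] at h
  rcases le_max_iff.1 h with h | h
  · exact le_max_of_le_left ((sq_le_sq₀ (norm_nonneg _) (norm_nonneg _)).1 h)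
  · exact le_max_of_le_right ((sq_le_sq₀ (norm_nonneg _) (norm_nonneg _)).1 h)

end Convexity

section Cover

variable {M : Type*} [TopologicalSpace M] [T2Space M] [LocallyCompactSpace M] [SigmaCompactSpace M]

/-- An assignment of an open neighbourhood to each point can be refined to a locally finite cover by
compact sets. -/
theorem exists_locallyFinite_compact_cover {W : M → Set M} (hW : ∀ x, IsOpen (W x))
    (hx : ∀ x, x ∈ W x) :
    ∃ K : M → Set M, (∀ x, IsCompact (K x)) ∧ (∀ x, K x ⊆ W x) ∧ LocallyFinite K ∧
      ∀ y, ∃ x, y ∈ K x := by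
  choose C hC hCx using fun x : M => exists_compact_mem_nhds x
  obtain ⟨v, hvo, hvc, hvf, hvW⟩ := precise_refinement (fun x => W x ∩ interior (C x))
    (fun x => (hW x).inter isOpen_interior)
    (eq_univ_of_forall fun x => mem_iUnion.2 ⟨x, hx x, mem_interior_iff_mem_nhds.2 (hCx x)⟩)
  obtain ⟨K, hK1, hK2, hK3⟩ := exists_iUnion_eq_closure_subset hvo (fun x => hvf.point_finite x) hvc
  refine ⟨fun x => closure (K x), fun x => ?_, fun x => (hK3 x).trans ((hvW x).trans
    inter_subset_left), hvf.subset hK3, fun y => ?_⟩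
  · exact (hC x).of_isClosed_subset isClosed_closure
      ((hK3 x).trans ((hvW x).trans (inter_subset_right.trans interior_subset)))
  · obtain ⟨x, hx⟩ := mem_iUnion.1 (hK1.symm ▸ mem_univ y : y ∈ ⋃ i, K i)
    exact ⟨x, subset_closure hx⟩

theorem LocallyFinite.isOpen_setOf_forall_imp {X ι : Type*} [TopologicalSpace X] {K N : ι → Set X}
    (hK : LocallyFinite K) (hKc : ∀ i, IsClosed (K i)) (hN : ∀ i, IsOpen (N i)) :
    IsOpen {x | ∀ i, x ∈ K i → x ∈ N i} := by
  have h : IsClosed (⋃ i, K i ∩ (N i)ᶜ) :=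
    (hK.subset fun i => inter_subset_left).isClosed_iUnion fun i =>
      (hKc i).inter (hN i).isClosed_compl
  convert h.isOpen_compl using 1
  ext x
  simp

/-- Given a neighbourhood `N x` of each unit `u x`, there is a neighbourhood of all units in which
any two arrows with a common end lie in a common `N x`. -/
theorem exists_isOpen_pair_mem {G : Type*} [TopologicalSpace G] {s t : G → M} {u : M → G}
    (hs : Continuous s) (ht : Continuous t) (hu : Continuous u) (hsu : ∀ x, s (u x) = x)
    (htu : ∀ x, t (u x) = x) {N : M → Set G} (hN : ∀ x, N x ∈ 𝓝 (u x)) :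
    ∃ O : Set G, IsOpen O ∧ (∀ x, u x ∈ O) ∧ ∀ a ∈ O, ∀ b ∈ O,
      (s a = s b ∨ s a = t b ∨ t a = t b) → ∃ x, a ∈ N x ∧ b ∈ N x := by
  obtain ⟨K, hKc, hKW, hKf, hK⟩ := exists_locallyFinite_compact_cover
    (W := fun x => u ⁻¹' interior (N x)) (fun x => isOpen_interior.preimage hu)
    (fun x => mem_interior_iff_mem_nhds.2 (hN x))
  refine ⟨{g | ∀ x, g ∈ s ⁻¹' K x → g ∈ interior (N x)} ∩
    {g | ∀ x, g ∈ t ⁻¹' K x → g ∈ interior (N x)}, ?_, ?_, ?_⟩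
  · exact ((hKf.preimage_continuous hs).isOpen_setOf_forall_imp
      (fun i => (hKc i).isClosed.preimage hs) fun i => isOpen_interior).inter
      ((hKf.preimage_continuous ht).isOpen_setOf_forall_imp
      (fun i => (hKc i).isClosed.preimage ht) fun i => isOpen_interior)
  · exact fun x => ⟨fun y hy => hKW y (by simpa [hsu] using hy),
      fun y hy => hKW y (by simpa [htu] using hy)⟩
  · rintro a ⟨ha1, ha2⟩ b ⟨hb1, hb2⟩ h
    rcases h with h | h | h
    · obtain ⟨x, hx⟩ := hK (s a)
      exact ⟨x, interior_subset (ha1 x hx), interior_subset (hb1 x (show s b ∈ K x from h ▸ hx))⟩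
    · obtain ⟨x, hx⟩ := hK (s a)
      exact ⟨x, interior_subset (ha1 x hx), interior_subset (hb2 x (show t b ∈ K x from h ▸ hx))⟩
    · obtain ⟨x, hx⟩ := hK (t a)
      exact ⟨x, interior_subset (ha2 x hx), interior_subset (hb2 x (show t b ∈ K x from h ▸ hx))⟩

end Cover

/-! ### Neighbourhoods of the units that are convex along target fibres -/

theorem eventually_forall_segment {A K : Type*} [TopologicalSpace A] [NormedAddCommGroup K]
    [NormedSpace ℝ K] {a₀ : A} {Z : A × K → Prop} (hZ : ∀ᶠ q in 𝓝 (a₀, (0 : K)), Z q) :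
    ∀ᶠ q in 𝓝 (a₀, (0 : K)), ∀ τ ∈ Icc (0 : ℝ) 1, Z (q.1, τ • q.2) := by
  rw [nhds_prod_eq] at hZ ⊢
  obtain ⟨pa, hpa, pb, hpb, h⟩ := eventually_prod_iff.1 hZ
  obtain ⟨δ, hδ, hball⟩ := Metric.eventually_nhds_iff_ball.1 hpb
  refine eventually_prod_iff.2 ⟨pa, hpa, fun y => y ∈ Metric.ball (0 : K) δ,
    Metric.ball_mem_nhds _ hδ, fun {a} ha {y} hy τ hτ => h ha (hball _ ?_)⟩
  simp only [mem_ball_zero_iff] at hy ⊢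
  rw [norm_smul, Real.norm_eq_abs, abs_of_nonneg hτ.1]
  exact lt_of_le_of_lt (mul_le_of_le_one_left (norm_nonneg _) hτ.2) hy

namespace LocalLieGroupoid

variable {n k : ℕ} {M : Type u} [TopologicalSpace M] [ChartedSpace (EuclideanSpace ℝ (Fin n)) M]
  {G : Type v} [TopologicalSpace G] [ChartedSpace (EuclideanSpace ℝ (Fin k)) G]
  (𝒢 : LocalLieGroupoid n k M G)

/-- Coordinates `(t, κ)` on a neighbourhood `D` of the unit at `x`, with values in the product of
`M` with the image of the projection `P`, for which the units have coordinate `κ = 0`. The inverse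
coordinate map is `ι`. -/
structure TargetChart (x : M) where
  D : Set G
  κ : G → EuclideanSpace ℝ (Fin k)
  ι : M × EuclideanSpace ℝ (Fin k) → G
  P : EuclideanSpace ℝ (Fin k) →L[ℝ] EuclideanSpace ℝ (Fin k)
  isOpen_D : IsOpen D
  mem_D : 𝒢.u x ∈ D
  contMDiffAt_κ : ∀ g ∈ D, ContMDiffAt (𝓡 k) (𝓡 k) ∞ κ g
  ι_κ : ∀ g ∈ D, ι (𝒢.t g, κ g) = g
  contMDiffAt_ι : ∀ g ∈ D, ContMDiffAt ((𝓡 n).prod (𝓡 k)) (𝓡 k) ∞ ι (𝒢.t g, κ g)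
  κ_u : ∀ y, κ (𝒢.u y) = 0
  P_κ : ∀ g, P (κ g) = κ g
  P_P : ∀ v, P (P v) = P v
  eventually_ι : ∀ᶠ q in 𝓝 (x, (0 : EuclideanSpace ℝ (Fin k))),
    ContMDiffAt ((𝓡 n).prod (𝓡 k)) (𝓡 k) ∞ ι q ∧ 𝒢.t (ι q) = q.1 ∧ κ (ι q) = P q.2

theorem nonempty_targetChart [IsManifold (𝓡 n) ∞ M] [IsManifold (𝓡 k) ∞ G] (x : M) :
    Nonempty (𝒢.TargetChart x) := by
  set φ := extChartAt (𝓡 k) (𝒢.u x) with hφ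
  -- `c` vanishes at the units, and its differential at `u x` is the identity on `ker dt`.
  set c : G → EuclideanSpace ℝ (Fin k) := fun g => φ g - φ (𝒢.u (𝒢.t g)) with hc
  have hut : Tendsto (fun g => 𝒢.u (𝒢.t g)) (𝓝 (𝒢.u x)) (𝓝 (𝒢.u x)) :=
    (𝒢.contMDiff_u.comp 𝒢.contMDiff_t).continuous.tendsto' _ _ (by simp [𝒢.t_u])
  have hφe := eventually_contMDiffAt_extChartAt (I := 𝓡 k) (𝒢.u x)
  have hcs : ∀ᶠ g in 𝓝 (𝒢.u x), ContMDiffAt (𝓡 k) (𝓡 k) ∞ c g := by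
    filter_upwards [hφe, hut.eventually hφe] with g h1 h2
    exact h1.sub (h2.comp g (𝒢.contMDiff_u.comp 𝒢.contMDiff_t).contMDiffAt)
  have htd : HasMFDerivAt (𝓡 k) (𝓡 n) 𝒢.t (𝒢.u x) (modelDeriv (𝓡 k) (𝓡 n) 𝒢.t (𝒢.u x)) :=
    (𝒢.contMDiff_t.mdifferentiableAt (by simp)).hasMFDerivAt
  obtain ⟨B, hB⟩ : ∃ B : EuclideanSpace ℝ (Fin n) →L[ℝ] EuclideanSpace ℝ (Fin k),
      HasMFDerivAt (𝓡 n) (𝓡 k) (fun y => φ (𝒢.u y)) (𝒢.t (𝒢.u x)) B := by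
    rw [𝒢.t_u]
    exact ⟨_, (((hφe.self_of_nhds.comp x 𝒢.contMDiff_u.contMDiffAt).mdifferentiableAt
      (by simp)).hasMFDerivAt)⟩
  have hcd : HasMFDerivAt (𝓡 k) (𝓡 k) c (𝒢.u x)
      (ContinuousLinearMap.id ℝ (EuclideanSpace ℝ (Fin k)) -
        B.comp (modelDeriv (𝓡 k) (𝓡 n) 𝒢.t (𝒢.u x))) :=
    (hasMFDerivAt_extChartAt_self (I := 𝓡 k) (𝒢.u x)).sub (hB.comp (𝒢.u x) htd)
  obtain ⟨P, ι, hP1, hP2, hι0, hι1, hι2⟩ := exists_submersion_coordinates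
    (Eventually.of_forall fun z => 𝒢.contMDiff_t z) (𝒢.submersion_t (𝒢.u x)) hcs
    (by simp [hc, 𝒢.t_u]) (fun v hv => by
      rw [hcd.mfderiv]
      have h : modelDeriv (𝓡 k) (𝓡 n) 𝒢.t (𝒢.u x) v = 0 := hv
      have h2 : v - B (modelDeriv (𝓡 k) (𝓡 n) 𝒢.t (𝒢.u x) v) = v := by rw [h]; simp
      exact h2)
  rw [𝒢.t_u] at hι0 hι2
  have hlim : Tendsto (fun g => (𝒢.t g, P (c g))) (𝓝 (𝒢.u x)) (𝓝 (x, 0)) := by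
    have h1 : ContinuousAt (fun g => (𝒢.t g, P (c g))) (𝒢.u x) :=
      𝒢.contMDiff_t.continuous.continuousAt.prodMk
        (P.continuous.continuousAt.comp hcs.self_of_nhds.continuousAt)
    rw [ContinuousAt] at h1
    simpa [hc, 𝒢.t_u] using h1
  have hPP : ∀ v, P (P v) = P v := fun v => hP2 _ (hP1 v)
  have hev := (hcs.and (hι1.and (hlim.eventually hι2)))
  obtain ⟨D, hD, hDo, hDx⟩ := eventually_nhds_iff.1 hev
  exact ⟨{ D := D, κ := fun g => P (c g), ι := ι, P := P, isOpen_D := hDo, mem_D := hDx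
           contMDiffAt_κ := fun g hg => P.contMDiff.contMDiffAt.comp g (hD g hg).1
           ι_κ := fun g hg => (hD g hg).2.1
           contMDiffAt_ι := fun g hg => (hD g hg).2.2.1
           κ_u := fun y => by simp [hc, 𝒢.t_u]
           P_κ := fun g => hPP _
           P_P := hPP
           eventually_ι := hι2 }⟩

variable {𝒢}

theorem m_u (𝒢 : LocalLieGroupoid n k M G) (x : M) : 𝒢.m (𝒢.u x) (𝒢.u x) = 𝒢.u x := by
  have := 𝒢.m_unit (𝒢.u x)
  rwa [𝒢.s_u] at this

theorem u_u_mem (𝒢 : LocalLieGroupoid n k M G) (x : M) : (𝒢.u x, 𝒢.u x) ∈ 𝒢.U := by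
  have := 𝒢.unit_right_mem (𝒢.u x)
  rwa [𝒢.s_u] at this

theorem mem_U_s_eq_t (𝒢 : LocalLieGroupoid n k M G) {g h : G} (hU : (g, h) ∈ 𝒢.U) :
    𝒢.s g = 𝒢.t h := by
  obtain ⟨O, -, hO⟩ := 𝒢.isOpen_U
  rw [hO] at hU
  exact hU.2

theorem eventually_mem_U (𝒢 : LocalLieGroupoid n k M G) {p : G × G} (hp : p ∈ 𝒢.U) :
    ∀ᶠ q in 𝓝 p, 𝒢.s q.1 = 𝒢.t q.2 → q ∈ 𝒢.U := by
  obtain ⟨O, hO, hU⟩ := 𝒢.isOpen_U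
  rw [hU] at hp ⊢
  filter_upwards [hO.mem_nhds hp.1] with q hq h using ⟨hq, h⟩

theorem contMDiffOn_m (𝒢 : LocalLieGroupoid n k M G) :
    ContMDiffOn ((𝓡 k).prod (𝓡 k)) (𝓡 k) ∞ (fun p : G × G => 𝒢.m p.1 p.2) 𝒢.U :=
  𝒢.submersion_m.1

namespace TargetChart

theorem eventually_ι_zero [IsManifold (𝓡 n) ∞ M] {x : M} (C : 𝒢.TargetChart x) :
    ∀ᶠ y in 𝓝 x, C.ι (y, 0) = 𝒢.u y := by
  have : ∀ᶠ y in 𝓝 x, 𝒢.u y ∈ C.D :=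
    𝒢.contMDiff_u.continuous.continuousAt.eventually (C.isOpen_D.mem_nhds C.mem_D)
  filter_upwards [this] with y hy
  have := C.ι_κ _ hy
  rwa [𝒢.t_u, C.κ_u] at this

/-- The norm of `κ` is quasiconvex along left translates of the segments in a target chart. -/
theorem eventually_norm_κ_m_le [IsManifold (𝓡 n) ∞ M] [IsManifold (𝓡 k) ∞ G] {x i : M}
    (C : 𝒢.TargetChart x) (C' : 𝒢.TargetChart i) (hi : 𝒢.u x ∈ C'.D) :
    ∀ᶠ p in 𝓝 (𝒢.u x, 𝒢.u x), 𝒢.s p.1 = 𝒢.t p.2 → ∀ τ ∈ Icc (0 : ℝ) 1,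
      ContinuousAt C.ι (𝒢.t p.2, τ • C.κ p.2) ∧ 𝒢.t (C.ι (𝒢.t p.2, τ • C.κ p.2)) = 𝒢.t p.2 ∧
      (p.1, C.ι (𝒢.t p.2, τ • C.κ p.2)) ∈ 𝒢.U ∧
      𝒢.m p.1 (C.ι (𝒢.t p.2, τ • C.κ p.2)) ∈ C'.D ∧
      ‖C'.κ (𝒢.m p.1 (C.ι (𝒢.t p.2, τ • C.κ p.2)))‖ ≤
        max ‖C'.κ p.1‖ ‖C'.κ (𝒢.m p.1 p.2)‖ := by
  set φ := extChartAt (𝓡 k) (𝒢.u x) with hφ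
  set e₀ := φ (𝒢.u x) with he₀
  set K := LinearMap.range C.P.toLinearMap with hK
  have hKP : ∀ y : K, C.P y = y := by
    rintro ⟨_, v, rfl⟩
    exact C.P_P v
  -- the pair `(g, h)` with coordinates `e` of `g` and `y` of `h`
  set Q : EuclideanSpace ℝ (Fin k) × K → G × G :=
    fun q => (φ.symm q.1, C.ι (𝒢.s (φ.symm q.1), (q.2 : EuclideanSpace ℝ (Fin k)))) with hQ
  have hφ0 : φ.symm e₀ = 𝒢.u x := extChartAt_to_inv _
  have hι0 : C.ι (x, 0) = 𝒢.u x := C.eventually_ι_zero.self_of_nhds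
  have hQ0 : Q (e₀, 0) = (𝒢.u x, 𝒢.u x) := by
    simp only [hQ, hφ0, 𝒢.s_u, Submodule.coe_zero, hι0]
  have hbase : ContMDiffAt ((𝓡 k).prod 𝓘(ℝ, K)) ((𝓡 n).prod (𝓡 k)) ∞
      (fun q : EuclideanSpace ℝ (Fin k) × K =>
        (𝒢.s (φ.symm q.1), (q.2 : EuclideanSpace ℝ (Fin k)))) (e₀, 0) := by
    refine ContMDiffAt.prodMk ?_ ?_
    · refine (𝒢.contMDiff_s.contMDiffAt).comp _ (ContMDiffAt.comp (e₀, (0 : K)) ?_ contMDiffAt_fst)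
      exact (eventually_contMDiffAt_extChartAt_symm (I := 𝓡 k) (𝒢.u x)).self_of_nhds
    · exact K.subtypeL.contMDiff.contMDiffAt.comp (e₀, (0 : K)) contMDiffAt_snd
  have hbase0 : (𝒢.s (φ.symm e₀), ((0 : K) : EuclideanSpace ℝ (Fin k))) = (x, 0) := by
    simp [hφ0, 𝒢.s_u]
  have hQs : ContMDiffAt ((𝓡 k).prod 𝓘(ℝ, K)) ((𝓡 k).prod (𝓡 k)) ∞ Q (e₀, 0) := by
    refine ContMDiffAt.prodMk ?_ ?_
    · refine ContMDiffAt.comp (e₀, (0 : K)) ?_ contMDiffAt_fst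
      exact (eventually_contMDiffAt_extChartAt_symm (I := 𝓡 k) (𝒢.u x)).self_of_nhds
    · refine ContMDiffAt.comp (e₀, (0 : K)) ?_ hbase
      rw [hbase0]
      exact C.eventually_ι.self_of_nhds.1
  have hbaset : Tendsto (fun q : EuclideanSpace ℝ (Fin k) × K =>
        (𝒢.s (φ.symm q.1), (q.2 : EuclideanSpace ℝ (Fin k)))) (𝓝 (e₀, 0)) (𝓝 (x, 0)) := by
    have := hbase.continuousAt
    rwa [ContinuousAt, hbase0] at this
  have hQt : Tendsto Q (𝓝 (e₀, 0)) (𝓝 (𝒢.u x, 𝒢.u x)) := by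
    have := hQs.continuousAt
    rwa [ContinuousAt, hQ0] at this
  have hQU : ∀ᶠ q in 𝓝 (e₀, (0 : K)), Q q ∈ 𝒢.U := by
    filter_upwards [hQt.eventually (𝒢.eventually_mem_U (𝒢.u_u_mem x)),
      hbaset.eventually C.eventually_ι] with q h1 h2
    exact h1 h2.2.1.symm
  have hms : ContMDiffAt ((𝓡 k).prod 𝓘(ℝ, K)) (𝓡 k) ∞
      (fun q => 𝒢.m (Q q).1 (Q q).2) (e₀, (0 : K)) := by
    have h1 : ContMDiffWithinAt ((𝓡 k).prod (𝓡 k)) (𝓡 k) ∞ (fun p : G × G => 𝒢.m p.1 p.2) 𝒢.U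
        (Q (e₀, 0)) := by
      rw [hQ0]; exact 𝒢.contMDiffOn_m _ (𝒢.u_u_mem x)
    have h2 := h1.comp (e₀, (0 : K)) (hQs.contMDiffWithinAt (s := Q ⁻¹' 𝒢.U)) Subset.rfl
    exact h2.contMDiffAt hQU
  have hm0 : 𝒢.m (Q (e₀, 0)).1 (Q (e₀, 0)).2 = 𝒢.u x := by rw [hQ0]; exact 𝒢.m_u x
  set f : EuclideanSpace ℝ (Fin k) × K → EuclideanSpace ℝ (Fin k) :=
    fun q => C'.κ (𝒢.m (Q q).1 (Q q).2) with hf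
  have hf0 : f (e₀, 0) = 0 := by simp only [hf, hm0, C'.κ_u]
  have hfs : ContDiffAt ℝ ∞ f (e₀, 0) := by
    have h1 : ContMDiffAt ((𝓡 k).prod 𝓘(ℝ, K)) (𝓡 k) ∞ f (e₀, (0 : K)) := by
      refine ContMDiffAt.comp (e₀, (0 : K)) ?_ hms
      rw [hm0]
      exact C'.contMDiffAt_κ _ hi
    rw [← modelWithCornersSelf_prod, chartedSpaceSelf_prod] at h1
    exact h1.contDiffAt
  have hinj : ∀ y, fderiv ℝ f (e₀, 0) (0, y) = 0 → y = 0 := by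
    intro y hy
    -- `f (e₀, ·)` has a differentiable left inverse
    set Θ : EuclideanSpace ℝ (Fin k) → EuclideanSpace ℝ (Fin k) := fun w => C.κ (C'.ι (x, w))
      with hΘ
    have hι' : C'.ι (x, 0) = 𝒢.u x := by
      have := C'.ι_κ _ hi
      rwa [𝒢.t_u, C'.κ_u] at this
    have hΘs : ContMDiffAt (𝓡 k) (𝓡 k) ∞ Θ 0 := by
      have h0 := C'.contMDiffAt_ι _ hi
      rw [𝒢.t_u, C'.κ_u] at h0
      have h1 : ContMDiffAt (𝓡 k) (𝓡 k) ∞ (fun w : EuclideanSpace ℝ (Fin k) => C'.ι (x, w)) 0 :=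
        ContMDiffAt.comp (I' := (𝓡 n).prod (𝓡 k)) (0 : EuclideanSpace ℝ (Fin k)) h0
          (contMDiffAt_const.prodMk contMDiffAt_id)
      refine ContMDiffAt.comp (0 : EuclideanSpace ℝ (Fin k)) ?_ h1
      rw [hι']
      exact C.contMDiffAt_κ _ C.mem_D
    have hΘd : DifferentiableAt ℝ Θ 0 := hΘs.contDiffAt.differentiableAt (by simp)
    have hfd : HasFDerivAt f (fderiv ℝ f (e₀, 0)) (e₀, 0) :=
      (hfs.differentiableAt (by simp)).hasFDerivAt
    have h1 : HasFDerivAt (fun y : K => f (e₀, y))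
        ((fderiv ℝ f (e₀, 0)).comp (ContinuousLinearMap.inr ℝ _ K)) 0 :=
      hfd.comp (0 : K) (hasFDerivAt_prodMk_right e₀ (0 : K))
    have h2 : HasFDerivAt (fun y : K => Θ (f (e₀, y))) ((fderiv ℝ Θ 0).comp
        ((fderiv ℝ f (e₀, 0)).comp (ContinuousLinearMap.inr ℝ _ K))) 0 := by
      have h0 : HasFDerivAt Θ (fderiv ℝ Θ 0) (f (e₀, 0)) := by
        rw [hf0]; exact hΘd.hasFDerivAt
      exact h0.comp (0 : K) h1
    have h3 : ∀ᶠ y : K in 𝓝 0, Θ (f (e₀, y)) = y := by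
      have hc : Tendsto (fun y : K => (e₀, y)) (𝓝 0) (𝓝 (e₀, 0)) :=
        (Continuous.prodMk_right e₀).tendsto 0
      filter_upwards [hc.eventually (hbaset.eventually C.eventually_ι),
        hc.eventually (hQt.eventually (continuousAt_snd.eventually (C'.isOpen_D.mem_nhds hi)))]
        with y h4 h5
      simp only [hQ, hφ0, 𝒢.s_u] at h4 h5
      have h6 : f (e₀, y) = C'.κ (C.ι (x, y)) := by
        simp only [hf, hQ, hφ0, 𝒢.s_u]
        congr 1
        have := 𝒢.unit_m (C.ι (x, y))
        rwa [h4.2.1] at this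
      have h7 := C'.ι_κ _ h5
      rw [h4.2.1] at h7
      simp only [hΘ]
      rw [h6, h7, h4.2.2, hKP]
    have h4 : HasFDerivAt (fun y : K => Θ (f (e₀, y))) K.subtypeL 0 :=
      K.subtypeL.hasFDerivAt.congr_of_eventuallyEq h3
    have h5 := congrArg (fun T : K →L[ℝ] _ => T y) (h2.unique h4)
    simp only [ContinuousLinearMap.comp_apply, ContinuousLinearMap.inr_apply, hy, map_zero] at h5
    exact Subtype.ext h5.symm
  have hseg := eventually_norm_segment_le
    (hfs.of_le (show (2 : WithTop ℕ∞) ≤ ∞ from ENat.LEInfty.out)) hf0 hinj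
  have hev : ∀ᶠ q in 𝓝 (e₀, (0 : K)), Q q ∈ 𝒢.U ∧ 𝒢.m (Q q).1 (Q q).2 ∈ C'.D ∧
      ContMDiffAt ((𝓡 n).prod (𝓡 k)) (𝓡 k) ∞ C.ι (𝒢.s (φ.symm q.1), (q.2 : _)) ∧
      𝒢.t (C.ι (𝒢.s (φ.symm q.1), (q.2 : EuclideanSpace ℝ (Fin k)))) = 𝒢.s (φ.symm q.1) := by
    have h1 := hms.continuousAt.tendsto
    rw [hm0] at h1
    filter_upwards [hQU, h1.eventually (C'.isOpen_D.mem_nhds hi),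
      hbaset.eventually C.eventually_ι] with q h1 h2 h3
    exact ⟨h1, h2, h3.1, h3.2.1⟩
  have hpull : Tendsto (fun p : G × G => (φ p.1, (⟨C.κ p.2, C.κ p.2, C.P_κ p.2⟩ : K)))
      (𝓝 (𝒢.u x, 𝒢.u x)) (𝓝 (e₀, 0)) := by
    refine Tendsto.prodMk_nhds ?_ ?_
    · exact (continuousAt_extChartAt (𝒢.u x)).tendsto.comp continuousAt_fst
    · rw [tendsto_subtype_rng]
      have h1 : Tendsto C.κ (𝓝 (𝒢.u x)) (𝓝 0) := by
        have := (C.contMDiffAt_κ _ C.mem_D).continuousAt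
        rwa [ContinuousAt, C.κ_u] at this
      exact h1.comp continuousAt_snd
  have hs0 : Tendsto (fun p : G × G => 𝒢.s p.1) (𝓝 (𝒢.u x, 𝒢.u x)) (𝓝 x) :=
    (𝒢.contMDiff_s.continuous.comp continuous_fst).tendsto' _ _ (by simp [𝒢.s_u])
  filter_upwards [hpull.eventually hseg, hpull.eventually (eventually_forall_segment hev),
    continuousAt_fst.eventually (extChartAt_source_mem_nhds (I := 𝓡 k) (𝒢.u x)),
    continuousAt_snd.eventually (C.isOpen_D.mem_nhds C.mem_D),
    hs0.eventually C.eventually_ι_zero] with p h1 h2 h3 h4 h5 hst τ hτ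
  have hg : φ.symm (φ p.1) = p.1 := φ.left_inv h3
  have hh : C.ι (𝒢.t p.2, C.κ p.2) = p.2 := C.ι_κ _ h4
  have h1' := h1 τ hτ
  obtain ⟨a1, a2, a3, a4⟩ := h2 τ hτ
  simp only [hf, hQ, Submodule.coe_smul, hg, hst, Submodule.coe_zero] at h1' a1 a2 a3 a4 h5
  rw [hh, h5, ← hst, 𝒢.m_unit, hst] at h1'
  exact ⟨a3.continuousAt, a4, a1, a2, h1'⟩

/-- Composable arrows `g`, `h` near a unit are joined by a path from a unit to `h` in the target
fibre of `h`, along which the norms of the coordinates `κ` of the path and of its left translate by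
`g` are at most the largest of the norms at the ends. -/
theorem eventually_exists_path [IsManifold (𝓡 n) ∞ M] [IsManifold (𝓡 k) ∞ G]
    (C : ∀ x, 𝒢.TargetChart x) {x : M} {J : Set M} (hJ : J.Finite)
    (hJD : ∀ i ∈ J, 𝒢.u x ∈ (C i).D) :
    ∀ᶠ p in 𝓝 (𝒢.u x, 𝒢.u x), 𝒢.s p.1 = 𝒢.t p.2 →
      ∃ γ : Path (𝒢.u (𝒢.s p.1)) p.2, ∀ τ, 𝒢.t (γ τ) = 𝒢.s p.1 ∧ (p.1, γ τ) ∈ 𝒢.U ∧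
        ∀ i ∈ J, γ τ ∈ (C i).D ∧ ‖(C i).κ (γ τ)‖ ≤ ‖(C i).κ p.2‖ ∧
          𝒢.m p.1 (γ τ) ∈ (C i).D ∧
          ‖(C i).κ (𝒢.m p.1 (γ τ))‖ ≤ max ‖(C i).κ p.1‖ ‖(C i).κ (𝒢.m p.1 p.2)‖ := by
  have h1 : ∀ᶠ p in 𝓝 (𝒢.u x, 𝒢.u x), ∀ i ∈ J, _ :=
    (eventually_all_finite hJ).2 fun i hi => (C x).eventually_norm_κ_m_le (C i) (hJD i hi)
  have hx := (C x).eventually_norm_κ_m_le (C x) (C x).mem_D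
  have hu : Tendsto (fun p : G × G => (𝒢.u (𝒢.t p.2), p.2)) (𝓝 (𝒢.u x, 𝒢.u x))
      (𝓝 (𝒢.u x, 𝒢.u x)) := by
    have h : Continuous (fun p : G × G => (𝒢.u (𝒢.t p.2), p.2)) :=
      ((𝒢.contMDiff_u.comp 𝒢.contMDiff_t).continuous.comp continuous_snd).prodMk continuous_snd
    simpa [𝒢.t_u] using h.tendsto (𝒢.u x, 𝒢.u x)
  have ht0 : Tendsto (fun p : G × G => 𝒢.t p.2) (𝓝 (𝒢.u x, 𝒢.u x)) (𝓝 x) :=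
    (𝒢.contMDiff_t.continuous.comp continuous_snd).tendsto' _ _ (by simp [𝒢.t_u])
  filter_upwards [h1, hu.eventually h1, hx,
    continuousAt_snd.eventually ((C x).isOpen_D.mem_nhds (C x).mem_D),
    ht0.eventually (C x).eventually_ι_zero] with p h1 h2 h3 h4 h5 hst
  refine ⟨⟨⟨fun τ => (C x).ι (𝒢.t p.2, (τ : ℝ) • (C x).κ p.2), ?_⟩, ?_, ?_⟩, fun τ => ?_⟩
  · refine continuous_iff_continuousAt.2 fun τ => ?_
    refine ContinuousAt.comp (f := fun τ : unitInterval => (𝒢.t p.2, (τ : ℝ) • (C x).κ p.2))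
      (h3 hst τ τ.2).1 ?_
    fun_prop
  · simp [hst, h5]
  · simp [(C x).ι_κ _ h4]
  · obtain ⟨-, b1, b2, -⟩ := h3 hst τ τ.2
    refine ⟨b1.trans hst.symm, b2, fun i hi => ?_⟩
    obtain ⟨-, -, -, c1, c2⟩ := h1 i hi hst τ τ.2
    obtain ⟨-, d0, -, d1, d2⟩ := h2 i hi (𝒢.s_u _) τ τ.2
    simp only [(C i).κ_u, norm_zero] at d2
    have e1 := 𝒢.unit_m ((C x).ι (𝒢.t p.2, (τ : ℝ) • (C x).κ p.2))
    rw [b1] at e1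
    rw [e1] at d1 d2
    rw [𝒢.unit_m, max_eq_right (norm_nonneg _)] at d2
    exact ⟨d1, d2, c1, c2⟩

end TargetChart

/-- Arbitrarily small neighbourhoods `O` of the units are star-shaped and convex along target
fibres: if `g`, `h` and `gh` lie in `O`, then `h` is joined to a unit by a path `γ` in its target
fibre for which `γ` and `g γ` stay in `O`. Smallness is measured by a relation `p` that holds near
the pairs `(u x, u x)` and is to hold for all pairs in `O` with a common end. -/
theorem exists_convex_opens [T2Space M] [SecondCountableTopology M] [IsManifold (𝓡 n) ∞ M]
    [IsManifold (𝓡 k) ∞ G] (𝒢 : LocalLieGroupoid n k M G) {p : G → G → Prop}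
    (hp : ∀ x, ∀ᶠ q in 𝓝 (𝒢.u x, 𝒢.u x), p q.1 q.2) :
    ∃ O : Opens G, (∀ x, 𝒢.u x ∈ O) ∧
      (∀ a ∈ O, ∀ b ∈ O, (𝒢.s a = 𝒢.s b ∨ 𝒢.s a = 𝒢.t b ∨ 𝒢.t a = 𝒢.t b) → p a b) ∧
      ∀ g ∈ O, ∀ h ∈ O, 𝒢.s g = 𝒢.t h → 𝒢.m g h ∈ O → ∃ γ : Path (𝒢.u (𝒢.s g)) h,
        ∀ τ, 𝒢.t (γ τ) = 𝒢.s g ∧ γ τ ∈ O ∧ (g, γ τ) ∈ 𝒢.U ∧ 𝒢.m g (γ τ) ∈ O := by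
  have : LocallyCompactSpace M := ChartedSpace.locallyCompactSpace (EuclideanSpace ℝ (Fin n)) M
  let C : ∀ x, 𝒢.TargetChart x := fun x => (𝒢.nonempty_targetChart x).some
  obtain ⟨K, hKc, hKW, hKf, hK⟩ := exists_locallyFinite_compact_cover
    (W := fun x => 𝒢.u ⁻¹' (C x).D) (fun x => (C x).isOpen_D.preimage 𝒢.contMDiff_u.continuous)
    (fun x => (C x).mem_D)
  have hev : ∀ x, ∀ᶠ q in 𝓝 (𝒢.u x, 𝒢.u x), p q.1 q.2 ∧
      (∀ i, 𝒢.s q.1 ∈ K i → x ∈ K i) ∧ (∀ i, 𝒢.t q.1 ∈ K i → x ∈ K i) ∧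
      (𝒢.s q.1 = 𝒢.t q.2 → ∃ γ : Path (𝒢.u (𝒢.s q.1)) q.2, ∀ τ, 𝒢.t (γ τ) = 𝒢.s q.1 ∧
        (q.1, γ τ) ∈ 𝒢.U ∧ ∀ i, x ∈ K i → γ τ ∈ (C i).D ∧ ‖(C i).κ (γ τ)‖ ≤ ‖(C i).κ q.2‖ ∧
          𝒢.m q.1 (γ τ) ∈ (C i).D ∧
          ‖(C i).κ (𝒢.m q.1 (γ τ))‖ ≤ max ‖(C i).κ q.1‖ ‖(C i).κ (𝒢.m q.1 q.2)‖) := by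
    intro x
    have hsx : Tendsto (fun q : G × G => 𝒢.s q.1) (𝓝 (𝒢.u x, 𝒢.u x)) (𝓝 x) :=
      (𝒢.contMDiff_s.continuous.comp continuous_fst).tendsto' _ _ (by simp [𝒢.s_u])
    have htx : Tendsto (fun q : G × G => 𝒢.t q.1) (𝓝 (𝒢.u x, 𝒢.u x)) (𝓝 x) :=
      (𝒢.contMDiff_t.continuous.comp continuous_fst).tendsto' _ _ (by simp [𝒢.t_u])
    have hKx : ∀ᶠ y in 𝓝 x, ∀ i, y ∈ K i → x ∈ K i :=
      hKf.eventually_subset (fun i => (hKc i).isClosed) x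
    exact (hp x).and ((hsx.eventually hKx).and ((htx.eventually hKx).and
      (TargetChart.eventually_exists_path C (J := {i | x ∈ K i}) (hKf.point_finite x)
        fun i hi => hKW i hi)))
  simp only [nhds_prod_eq] at hev
  choose N hN hNp using fun x => eventually_prod_self_iff'.1 (hev x)
  obtain ⟨O₁, hO₁, huO₁, hpair⟩ := exists_isOpen_pair_mem 𝒢.contMDiff_s.continuous
    𝒢.contMDiff_t.continuous 𝒢.contMDiff_u.continuous 𝒢.s_u 𝒢.t_u hN
  -- By compactness of `K i`, arrows of small norm `‖κ‖` over `K i` lie in `O₁`.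
  have hε : ∀ i, ∃ ε > 0, ∀ g ∈ (C i).D, 𝒢.t g ∈ K i → ‖(C i).κ g‖ < ε → g ∈ O₁ := by
    intro i
    have h1 : ∀ y ∈ K i, ∀ᶠ q in 𝓝 (y, (0 : EuclideanSpace ℝ (Fin k))), (C i).ι q ∈ O₁ := by
      intro y hy
      have h2 := (C i).contMDiffAt_ι _ (hKW i hy)
      have h3 := (C i).ι_κ _ (hKW i hy)
      rw [𝒢.t_u, (C i).κ_u] at h2 h3
      refine h2.continuousAt.eventually (hO₁.mem_nhds ?_)
      rw [h3]
      exact huO₁ y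
    have h2 : ∀ᶠ v in 𝓝 (0 : EuclideanSpace ℝ (Fin k)), ∀ y ∈ K i, (C i).ι (y, v) ∈ O₁ := by
      refine (hKc i).eventually_forall_of_forall_eventually fun y hy => ?_
      have h4 := (continuous_swap.tendsto ((0 : EuclideanSpace ℝ (Fin k)), y)).eventually (h1 y hy)
      exact h4
    obtain ⟨ε, hε, h⟩ := Metric.eventually_nhds_iff.1 h2
    refine ⟨ε, hε, fun g hg hgK hgε => ?_⟩
    have := h (y := (C i).κ g) (by simpa using hgε) _ hgK
    rwa [(C i).ι_κ g hg] at this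
  choose ε hε0 hε using hε
  -- `O` is cut out by bounds on the quasiconvex norms `‖κ‖`, locally finitely many at a time.
  set O : Set G := {g | ∀ i, g ∈ 𝒢.t ⁻¹' K i → g ∈ (C i).D ∩ (C i).κ ⁻¹' Metric.ball 0 (ε i)}
    with hO
  have hmemO : ∀ {g}, g ∈ O ↔ ∀ i, 𝒢.t g ∈ K i → g ∈ (C i).D ∧ ‖(C i).κ g‖ < ε i := by
    intro g
    simp [hO]
  have hOopen : IsOpen O := by
    refine (hKf.preimage_continuous 𝒢.contMDiff_t.continuous).isOpen_setOf_forall_imp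
      (fun i => (hKc i).isClosed.preimage 𝒢.contMDiff_t.continuous) fun i => ?_
    exact ContinuousOn.isOpen_inter_preimage
      (fun g hg => ((C i).contMDiffAt_κ g hg).continuousAt.continuousWithinAt) (C i).isOpen_D
      Metric.isOpen_ball
  have hOO₁ : ∀ g ∈ O, g ∈ O₁ := by
    intro g hg
    obtain ⟨i, hi⟩ := hK (𝒢.t g)
    have := hmemO.1 hg i hi
    exact hε i g this.1 hi this.2
  refine ⟨⟨O, hOopen⟩, fun x => hmemO.2 fun i hi => ?_, fun a ha b hb hab => ?_, ?_⟩
  · rw [𝒢.t_u] at hi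
    exact ⟨hKW i hi, by rw [(C i).κ_u, norm_zero]; exact hε0 i⟩
  · obtain ⟨x, hxa, hxb⟩ := hpair a (hOO₁ a ha) b (hOO₁ b hb) hab
    exact (hNp x a hxa b hxb).1
  · intro g hg h hh hst hgh
    obtain ⟨x, hxg, hxh⟩ := hpair g (hOO₁ g hg) h (hOO₁ h hh) (Or.inr (Or.inl hst))
    obtain ⟨-, hKs, hKt, hγ⟩ := hNp x g hxg h hxh
    obtain ⟨γ, hγ⟩ := hγ hst
    have hUgh : (g, h) ∈ 𝒢.U := by simpa using (hγ 1).2.1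
    refine ⟨γ, fun τ => ?_⟩
    obtain ⟨c1, c2, c3⟩ := hγ τ
    refine ⟨c1, hmemO.2 fun i hi => ?_, c2, hmemO.2 fun i hi => ?_⟩
    · rw [c1] at hi
      obtain ⟨d1, d2, -⟩ := c3 i (hKs i hi)
      exact ⟨d1, d2.trans_lt (hmemO.1 hh i (hst ▸ hi)).2⟩
    · have hi' : 𝒢.t g ∈ K i := by rwa [𝒢.t_m _ _ c2] at hi
      obtain ⟨-, -, d1, d2⟩ := c3 i (hKt i hi')
      refine ⟨d1, d2.trans_lt (max_lt (hmemO.1 hg i hi').2 (hmemO.1 hgh i ?_).2)⟩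
      rwa [𝒢.t_m _ _ hUgh]

end LocalLieGroupoid

/-! ### Restriction of a local Lie groupoid to an open set of arrows -/

section OpenSubmanifold

variable {E H : Type*} [NormedAddCommGroup E] [NormedSpace ℝ E] [TopologicalSpace H]
  {I : ModelWithCorners ℝ E H} {X : Type*} [TopologicalSpace X] [ChartedSpace H X]
  {E' H' : Type*} [NormedAddCommGroup E'] [NormedSpace ℝ E'] [TopologicalSpace H']
  {I' : ModelWithCorners ℝ E' H'} {Y : Type*} [TopologicalSpace Y] [ChartedSpace H' Y]

/-- The preferred charts of an open subset are those of the manifold, so the differential of the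
inclusion is the identity of the model space. -/
theorem hasMFDerivAt_subtypeVal [I.Boundaryless] {O : Opens X} (x : O) :
    HasMFDerivAt I I (Subtype.val : O → X) x (ContinuousLinearMap.id ℝ E) := by
  refine ⟨continuous_subtype_val.continuousAt, ?_⟩
  have h0 : (extChartAt I x x) = extChartAt I x.1 x.1 := rfl
  have h : writtenInExtChartAt I I x (Subtype.val : O → X) =ᶠ[𝓝 (extChartAt I x x)] id := by
    have h1 := Opens.chartAt_subtype_val_symm_eventuallyEq (H := H) O (x := x)
    have h2 : Tendsto I.symm (𝓝 (extChartAt I x x)) (𝓝 (chartAt H x.1 x.1)) := by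
      have := (I.continuous_symm.tendsto (extChartAt I x.1 x.1))
      rw [h0]
      simpa using this
    filter_upwards [h2.eventually h1, h0 ▸ extChartAt_target_mem_nhds (I := I) x.1] with z h3 h4
    have h5 : ((extChartAt I x).symm z : X) = (extChartAt I x.1).symm z := h3.symm
    simp only [writtenInExtChartAt, Function.comp_apply, h5]
    exact (extChartAt I x.1).right_inv h4
  have h' : HasFDerivAt (writtenInExtChartAt I I x (Subtype.val : O → X))
      (ContinuousLinearMap.id ℝ E) (extChartAt I x x) :=
    (hasFDerivAt_id _).congr_of_eventuallyEq h
  exact h'.hasFDerivWithinAt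

theorem HasMFDerivWithinAt.of_subtypeVal_comp {O : Opens Y} {f : X → O} {S : Set X} {x : X}
    {D : E →L[ℝ] E'} (h : HasMFDerivWithinAt I I' (fun x => (f x : Y)) S x D) :
    HasMFDerivWithinAt I I' f S x D :=
  ⟨Topology.IsInducing.subtypeVal.continuousWithinAt_iff.2 h.1, h.2⟩

end OpenSubmanifold

namespace LocalLieGroupoid

variable {n k : ℕ} {M : Type u} [TopologicalSpace M] [ChartedSpace (EuclideanSpace ℝ (Fin n)) M]
  {G : Type v} [TopologicalSpace G] [ChartedSpace (EuclideanSpace ℝ (Fin k)) G]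
  (𝒢 : LocalLieGroupoid n k M G)

section Multiplication

variable {P : Type*} [TopologicalSpace P] {S : Set P} {p₀ : P} {a b : P → G}

theorem eventually_mem_U_within (ha : ContinuousWithinAt a S p₀) (hb : ContinuousWithinAt b S p₀)
    (hst : ∀ᶠ p in 𝓝[S] p₀, 𝒢.s (a p) = 𝒢.t (b p)) (hU : (a p₀, b p₀) ∈ 𝒢.U) :
    ∀ᶠ p in 𝓝[S] p₀, (a p, b p) ∈ 𝒢.U := by
  filter_upwards [(ha.prodMk hb).eventually (𝒢.eventually_mem_U hU), hst] with p h1 h2 using h1 h2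

theorem continuousWithinAt_m (ha : ContinuousWithinAt a S p₀) (hb : ContinuousWithinAt b S p₀)
    (hst : ∀ᶠ p in 𝓝[S] p₀, 𝒢.s (a p) = 𝒢.t (b p)) (hU : (a p₀, b p₀) ∈ 𝒢.U) :
    ContinuousWithinAt (fun p => 𝒢.m (a p) (b p)) S p₀ := by
  have h1 : ContinuousWithinAt (fun p : G × G => 𝒢.m p.1 p.2) 𝒢.U (a p₀, b p₀) :=
    (𝒢.contMDiffOn_m _ hU).continuousWithinAt
  have h2 : Tendsto (fun p => (a p, b p)) (𝓝[S] p₀) (𝓝[𝒢.U] (a p₀, b p₀)) :=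
    tendsto_nhdsWithin_iff.2 ⟨ha.prodMk hb, 𝒢.eventually_mem_U_within ha hb hst hU⟩
  exact h1.tendsto.comp h2

theorem contMDiffWithinAt_m {E H : Type*} [NormedAddCommGroup E] [NormedSpace ℝ E]
    [TopologicalSpace H] {I : ModelWithCorners ℝ E H} [ChartedSpace H P]
    (ha : ContMDiffWithinAt I (𝓡 k) ∞ a S p₀) (hb : ContMDiffWithinAt I (𝓡 k) ∞ b S p₀)
    (hst : ∀ᶠ p in 𝓝[S] p₀, 𝒢.s (a p) = 𝒢.t (b p)) (hU : (a p₀, b p₀) ∈ 𝒢.U) :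
    ContMDiffWithinAt I (𝓡 k) ∞ (fun p => 𝒢.m (a p) (b p)) S p₀ := by
  have h1 := 𝒢.contMDiffOn_m _ hU
  have h2 := h1.comp (f := fun p => (a p, b p)) (t := 𝒢.U) p₀
    ((ha.prodMk hb).mono (inter_subset_left (t := (fun p => (a p, b p)) ⁻¹' 𝒢.U)))
    (inter_subset_right)
  exact h2.mono_of_mem_nhdsWithin (inter_mem self_mem_nhdsWithin
    (𝒢.eventually_mem_U_within ha.continuousWithinAt hb.continuousWithinAt hst hU))

end Multiplication

theorem i_u (x : M) : 𝒢.i (𝒢.u x) = 𝒢.u x := by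
  have h1 := 𝒢.m_unit (𝒢.i (𝒢.u x))
  have h2 := 𝒢.i_m _ (𝒢.u_mem_V x)
  rw [𝒢.s_i _ (𝒢.u_mem_V x), 𝒢.t_u] at h1
  rw [𝒢.s_u] at h2
  exact h1.symm.trans h2

theorem m_i_mem_U {g : G} (hg : g ∈ 𝒢.V) : (g, 𝒢.i g) ∈ 𝒢.U :=
  𝒢.V_subset _ hg _ (𝒢.i_mem_V _ hg) (𝒢.t_i _ hg).symm

theorem i_m_mem_U {g : G} (hg : g ∈ 𝒢.V) : (𝒢.i g, g) ∈ 𝒢.U :=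
  𝒢.V_subset _ (𝒢.i_mem_V _ hg) _ hg (𝒢.s_i _ hg)

variable {𝒢}

theorem IsThreeAssociative.i_i (h3 : 𝒢.IsThreeAssociative) {g : G} (hg : g ∈ 𝒢.V) :
    𝒢.i (𝒢.i g) = g := by
  have hg' := 𝒢.i_mem_V _ hg
  have h1 := 𝒢.i_m _ hg'
  have h2 := 𝒢.i_m _ hg
  have e1 : 𝒢.s (𝒢.i g) = 𝒢.t g := 𝒢.s_i _ hg
  have e2 : 𝒢.s (𝒢.i (𝒢.i g)) = 𝒢.s g := by rw [𝒢.s_i _ hg', 𝒢.t_i _ hg]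
  have := h3 (𝒢.i (𝒢.i g)) (𝒢.i g) g (𝒢.i_m_mem_U hg')
    (by rw [h1, e1]; exact 𝒢.unit_left_mem g) (𝒢.i_m_mem_U hg)
    (by rw [h2, ← e2]; exact 𝒢.unit_right_mem _)
  rw [h1, h2, e1, 𝒢.unit_m, ← e2, 𝒢.m_unit] at this
  exact this.symm

theorem IsThreeAssociative.m_i_cancel (h3 : 𝒢.IsThreeAssociative) {g h : G} (hU : (g, h) ∈ 𝒢.U)
    (hh : h ∈ 𝒢.V) (hU' : (𝒢.m g h, 𝒢.i h) ∈ 𝒢.U) : 𝒢.m (𝒢.m g h) (𝒢.i h) = g := by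
  have hst := 𝒢.mem_U_s_eq_t hU
  have h1 := 𝒢.m_i _ hh
  rw [h3 g h (𝒢.i h) hU hU' (𝒢.m_i_mem_U hh) (by
    rw [h1, ← hst]; exact 𝒢.unit_right_mem g), h1, ← hst, 𝒢.m_unit]

theorem IsThreeAssociative.i_m_cancel (h3 : 𝒢.IsThreeAssociative) {g h : G} (hU : (g, h) ∈ 𝒢.U)
    (hg : g ∈ 𝒢.V) (hU' : (𝒢.i g, 𝒢.m g h) ∈ 𝒢.U) : 𝒢.m (𝒢.i g) (𝒢.m g h) = h := by
  have hst := 𝒢.mem_U_s_eq_t hU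
  have h1 := 𝒢.i_m _ hg
  rw [← h3 (𝒢.i g) g h (𝒢.i_m_mem_U hg) (by
    rw [h1, hst]; exact 𝒢.unit_left_mem h) hU hU', h1, hst, 𝒢.unit_m]

variable (𝒢)

/-- The multiplication of `𝒢` on the open set `O`, with the irrelevant value `g` when the product
does not lie in `O`. -/
def restrictMul {O : Opens G} (g h : O) : O :=
  open Classical in if hm : 𝒢.m g h ∈ O then ⟨𝒢.m g h, hm⟩ else g

/-- The inversion of `𝒢` on the open set `O`, with the irrelevant value `g` when the inverse does
not lie in `O`. -/
def restrictInv {O : Opens G} (g : O) : O :=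
  open Classical in if hi : 𝒢.i g ∈ O then ⟨𝒢.i g, hi⟩ else g

variable {𝒢}

theorem coe_restrictMul {O : Opens G} {g h : O} (hm : 𝒢.m g h ∈ O) :
    (𝒢.restrictMul g h : G) = 𝒢.m g h := by
  rw [restrictMul, dif_pos hm]

theorem coe_restrictInv {O : Opens G} {g : O} (hi : 𝒢.i g ∈ O) :
    (𝒢.restrictInv g : G) = 𝒢.i g := by
  rw [restrictInv, dif_pos hi]

theorem hasMFDerivAt_comp_subtypeVal {O : Opens G} {f : G → M}
    (hf : ContMDiff (𝓡 k) (𝓡 n) ∞ f) (g : O) :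
    HasMFDerivAt (𝓡 k) (𝓡 n) (fun g : O => f g) g (modelDeriv (𝓡 k) (𝓡 n) f (g : G)) :=
  HasMFDerivAt.comp g (hf.mdifferentiableAt (by simp)).hasMFDerivAt (hasMFDerivAt_subtypeVal g)

/-- Associativity near a triple `p` persists when all products are required to lie in `O`. -/
theorem assoc_restrict (𝒢 : LocalLieGroupoid n k M G) (O : Opens G) {p : G × G × G}
    (hp1 : 𝒢.s p.1 = 𝒢.t p.2.1) (hp2 : 𝒢.s p.2.1 = 𝒢.t p.2.2)
    {W : Set (G × G × G)} (hW : W ∈ 𝓝 p)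
    (hWp : ∀ g h l, (g, h, l) ∈ W → 𝒢.s g = 𝒢.t h → 𝒢.s h = 𝒢.t l →
      (g, h) ∈ 𝒢.U ∧ (𝒢.m g h, l) ∈ 𝒢.U ∧ (h, l) ∈ 𝒢.U ∧ (g, 𝒢.m h l) ∈ 𝒢.U ∧
        𝒢.m (𝒢.m g h) l = 𝒢.m g (𝒢.m h l))
    (h1 : 𝒢.m p.1 p.2.1 ∈ O) (h2 : 𝒢.m p.2.1 p.2.2 ∈ O)
    (h3 : 𝒢.m (𝒢.m p.1 p.2.1) p.2.2 ∈ O) :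
    ∀ᶠ q : G × G × G in 𝓝 p, 𝒢.s q.1 = 𝒢.t q.2.1 → 𝒢.s q.2.1 = 𝒢.t q.2.2 →
      ((q.1, q.2.1) ∈ 𝒢.U ∧ 𝒢.m q.1 q.2.1 ∈ O) ∧
      ((𝒢.m q.1 q.2.1, q.2.2) ∈ 𝒢.U ∧ 𝒢.m (𝒢.m q.1 q.2.1) q.2.2 ∈ O) ∧
      ((q.2.1, q.2.2) ∈ 𝒢.U ∧ 𝒢.m q.2.1 q.2.2 ∈ O) ∧
      ((q.1, 𝒢.m q.2.1 q.2.2) ∈ 𝒢.U ∧ 𝒢.m q.1 (𝒢.m q.2.1 q.2.2) ∈ O) ∧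
      𝒢.m (𝒢.m q.1 q.2.1) q.2.2 = 𝒢.m q.1 (𝒢.m q.2.1 q.2.2) := by
  set S : Set (G × G × G) := {q | 𝒢.s q.1 = 𝒢.t q.2.1 ∧ 𝒢.s q.2.1 = 𝒢.t q.2.2} with hS
  obtain ⟨u1, u2, u3, u4, -⟩ := hWp p.1 p.2.1 p.2.2 (mem_of_mem_nhds hW) hp1 hp2
  have ca : ContinuousWithinAt (fun q : G × G × G => q.1) S p := continuousWithinAt_fst
  have cb : ContinuousWithinAt (fun q : G × G × G => q.2.1) S p :=
    (continuous_fst.comp continuous_snd).continuousWithinAt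
  have cc : ContinuousWithinAt (fun q : G × G × G => q.2.2) S p :=
    (continuous_snd.comp continuous_snd).continuousWithinAt
  have e1 : ∀ᶠ q in 𝓝[S] p, 𝒢.s q.1 = 𝒢.t q.2.1 := by
    filter_upwards [self_mem_nhdsWithin] with q hq using hq.1
  have e2 : ∀ᶠ q in 𝓝[S] p, 𝒢.s q.2.1 = 𝒢.t q.2.2 := by
    filter_upwards [self_mem_nhdsWithin] with q hq using hq.2
  have c1 := 𝒢.continuousWithinAt_m ca cb e1 u1
  have c2 := 𝒢.continuousWithinAt_m cb cc e2 u3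
  have e3 : ∀ᶠ q in 𝓝[S] p, 𝒢.s (𝒢.m q.1 q.2.1) = 𝒢.t q.2.2 := by
    filter_upwards [𝒢.eventually_mem_U_within ca cb e1 u1, e2] with q h1 h2
    rw [𝒢.s_m _ _ h1, h2]
  have c3 := 𝒢.continuousWithinAt_m c1 cc e3 u2
  have key : ∀ᶠ q in 𝓝[S] p, 𝒢.m q.1 q.2.1 ∈ O ∧ 𝒢.m q.2.1 q.2.2 ∈ O ∧
      𝒢.m (𝒢.m q.1 q.2.1) q.2.2 ∈ O ∧ q ∈ W :=
    (c1.eventually (O.isOpen.mem_nhds h1)).and ((c2.eventually (O.isOpen.mem_nhds h2)).and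
      ((c3.eventually (O.isOpen.mem_nhds h3)).and (mem_nhdsWithin_of_mem_nhds hW)))
  filter_upwards [eventually_nhdsWithin_iff.1 key] with q hq hs1 hs2
  obtain ⟨k1, k2, k3, k4⟩ := hq ⟨hs1, hs2⟩
  obtain ⟨v1, v2, v3, v4, v5⟩ := hWp _ _ _ k4 hs1 hs2
  exact ⟨⟨v1, k1⟩, ⟨v2, k3⟩, ⟨v3, k2⟩, ⟨v4, v5 ▸ k3⟩, v5⟩

/-- The shrinking of a local Lie groupoid to an open neighbourhood `O` of the units, with inversion
defined on `V'`. -/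
def restrict [IsManifold (𝓡 k) ∞ G] (𝒢 : LocalLieGroupoid n k M G) (O : Opens G)
    (huO : ∀ x, 𝒢.u x ∈ O) (V' : Set G) (hV' : IsOpen V') (hV'V : V' ⊆ 𝒢.V) (hV'O : V' ⊆ O)
    (huV' : ∀ x, 𝒢.u x ∈ V') (hiV' : ∀ g ∈ V', 𝒢.i g ∈ V')
    (hmV' : ∀ g ∈ V', ∀ h ∈ V', 𝒢.s g = 𝒢.t h → 𝒢.m g h ∈ O) : LocalLieGroupoid n k M O where
  secondCountable := by
    have := 𝒢.secondCountable
    infer_instance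
  s g := 𝒢.s g
  t g := 𝒢.t g
  u x := ⟨𝒢.u x, huO x⟩
  U := {p | ((p.1 : G), (p.2 : G)) ∈ 𝒢.U ∧ 𝒢.m p.1 p.2 ∈ O}
  m := 𝒢.restrictMul
  V := {g | (g : G) ∈ V'}
  i := 𝒢.restrictInv
  contMDiff_s := 𝒢.contMDiff_s.comp contMDiff_subtype_val
  submersion_s g := by
    rw [(hasMFDerivAt_comp_subtypeVal 𝒢.contMDiff_s g).mfderiv]
    exact 𝒢.submersion_s g
  contMDiff_t := 𝒢.contMDiff_t.comp contMDiff_subtype_val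
  submersion_t g := by
    rw [(hasMFDerivAt_comp_subtypeVal 𝒢.contMDiff_t g).mfderiv]
    exact 𝒢.submersion_t g
  t2_source_fiber x := by
    have := 𝒢.t2_source_fiber x
    have hf : Continuous (fun g : {g : O // 𝒢.s g = x} => (⟨g.1.1, g.2⟩ : {g : G // 𝒢.s g = x})) :=
      (continuous_subtype_val.comp continuous_subtype_val).subtype_mk _
    exact T2Space.of_injective_continuous
      (fun a b hab => Subtype.ext (Subtype.ext (congrArg (fun z => z.1) hab))) hf
  t2_target_fiber x := by
    have := 𝒢.t2_target_fiber x
    have hf : Continuous (fun g : {g : O // 𝒢.t g = x} => (⟨g.1.1, g.2⟩ : {g : G // 𝒢.t g = x})) :=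
      (continuous_subtype_val.comp continuous_subtype_val).subtype_mk _
    exact T2Space.of_injective_continuous
      (fun a b hab => Subtype.ext (Subtype.ext (congrArg (fun z => z.1) hab))) hf
  contMDiff_u := by
    rw [← ContMDiff.subtypeVal_comp_iff]
    exact 𝒢.contMDiff_u
  s_u := 𝒢.s_u
  t_u := 𝒢.t_u
  isOpen_U := by
    have hc : ContinuousOn (fun p : G × G => 𝒢.m p.1 p.2) 𝒢.U := 𝒢.contMDiffOn_m.continuousOn
    obtain ⟨W, hW, hWU⟩ := (continuousOn_iff'.1 hc) O O.isOpen
    obtain ⟨W', hW', hWU'⟩ := 𝒢.isOpen_U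
    have hj : Continuous (fun p : O × O => ((p.1 : G), (p.2 : G))) := by fun_prop
    refine ⟨(fun p : O × O => ((p.1 : G), (p.2 : G))) ⁻¹' (W ∩ W'), (hW.inter hW').preimage hj, ?_⟩
    ext p
    have h1 : ((p.1 : G), (p.2 : G)) ∈ (fun p : G × G => 𝒢.m p.1 p.2) ⁻¹' O ∩ 𝒢.U ↔
      ((p.1 : G), (p.2 : G)) ∈ W ∩ 𝒢.U := by rw [hWU]
    have h2 : ((p.1 : G), (p.2 : G)) ∈ 𝒢.U ↔ ((p.1 : G), (p.2 : G)) ∈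
      W' ∩ {p | 𝒢.s p.1 = 𝒢.t p.2} := by rw [← hWU']
    simp only [mem_inter_iff, mem_preimage, mem_ofPred_eq, SetLike.mem_coe] at h1 h2 ⊢
    tauto
  unit_right_mem g := ⟨𝒢.unit_right_mem g, by simp only [𝒢.m_unit]; exact g.2⟩
  unit_left_mem g := ⟨𝒢.unit_left_mem g, by simp only [𝒢.unit_m]; exact g.2⟩
  submersion_m := by
    have hval : ∀ p : O × O, HasMFDerivAt ((𝓡 k).prod (𝓡 k)) ((𝓡 k).prod (𝓡 k))
        (fun p : O × O => ((p.1 : G), (p.2 : G))) p (ContinuousLinearMap.id ℝ _) := fun p =>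
      (HasMFDerivAt.comp p (hasMFDerivAt_subtypeVal p.1) (hasMFDerivAt_fst p)).prodMk
        (HasMFDerivAt.comp p (hasMFDerivAt_subtypeVal p.2) (hasMFDerivAt_snd p))
    refine ⟨fun p hp => ?_, fun p hp => ?_⟩
    · rw [← ContMDiffWithinAt.subtypeVal_comp_iff]
      have h1 : ContMDiffWithinAt ((𝓡 k).prod (𝓡 k)) (𝓡 k) ∞
          (fun p : O × O => 𝒢.m p.1 p.2) {p | ((p.1 : G), (p.2 : G)) ∈ 𝒢.U ∧ 𝒢.m p.1 p.2 ∈ O} p :=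
        𝒢.contMDiffWithinAt_m
          (ContMDiffAt.comp p contMDiff_subtype_val.contMDiffAt contMDiffAt_fst).contMDiffWithinAt
          (ContMDiffAt.comp p contMDiff_subtype_val.contMDiffAt contMDiffAt_snd).contMDiffWithinAt
          (by filter_upwards [self_mem_nhdsWithin] with q hq using 𝒢.mem_U_s_eq_t hq.1) hp.1
      exact h1.congr (fun q hq => coe_restrictMul hq.2) (coe_restrictMul hp.2)
    · obtain ⟨D, hD, hDs⟩ := 𝒢.submersion_m.2 _ hp.1
      refine ⟨D, ?_, fun z => ?_⟩
      · refine HasMFDerivWithinAt.of_subtypeVal_comp ?_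
        have h1 := hD.comp p (hval p).hasMFDerivWithinAt (fun q hq => hq.1 :
          {p : O × O | ((p.1 : G), (p.2 : G)) ∈ 𝒢.U ∧ 𝒢.m p.1 p.2 ∈ O} ⊆ _)
        exact h1.congr_of_eventuallyEq (by
          filter_upwards [self_mem_nhdsWithin] with q hq using coe_restrictMul hq.2)
          (coe_restrictMul hp.2)
      · obtain ⟨v, hv, hz⟩ := hDs z
        refine ⟨v, ?_, hz⟩
        rw [mem_ofPred_eq, (hasMFDerivAt_comp_subtypeVal 𝒢.contMDiff_s p.1).mfderiv,
          (hasMFDerivAt_comp_subtypeVal 𝒢.contMDiff_t p.2).mfderiv]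
        exact hv
  isOpen_V := hV'.preimage continuous_subtype_val
  u_mem_V := huV'
  i_mem_V g hg := by
    have h := hiV' _ hg
    rw [mem_ofPred_eq, coe_restrictInv (hV'O h)]
    exact h
  contMDiffOn_i g hg := by
    rw [← ContMDiffWithinAt.subtypeVal_comp_iff]
    have h1 : ContMDiffWithinAt (𝓡 k) (𝓡 k) ∞ (fun g : O => 𝒢.i g) {g | (g : G) ∈ V'} g :=
      ((𝒢.contMDiffOn_i _ (hV'V hg)).comp g
        (contMDiff_subtype_val.contMDiffAt (x := g)).contMDiffWithinAt
        fun q hq => hV'V hq)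
    exact h1.congr (fun q hq => coe_restrictInv (hV'O (hiV' _ hq)))
      (coe_restrictInv (hV'O (hiV' _ hg)))
  V_subset g hg h hh hst := ⟨𝒢.V_subset _ (hV'V hg) _ (hV'V hh) hst, hmV' _ hg _ hh hst⟩
  s_m g h hU := by rw [coe_restrictMul hU.2, 𝒢.s_m _ _ hU.1]
  t_m g h hU := by rw [coe_restrictMul hU.2, 𝒢.t_m _ _ hU.1]
  assoc_near_units := by
    obtain ⟨W, hW, w1, w2, w3, hWp⟩ := 𝒢.assoc_near_units
    set j : O × O × O → G × G × G := fun p => (p.1, p.2.1, p.2.2) with hj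
    have hjc : Continuous j := by fun_prop
    refine ⟨interior {p | ∀ (_ : 𝒢.s p.1 = 𝒢.t p.2.1) (_ : 𝒢.s p.2.1 = 𝒢.t p.2.2),
      (((p.1 : G), (p.2.1 : G)) ∈ 𝒢.U ∧ 𝒢.m p.1 p.2.1 ∈ O) ∧
      ((𝒢.m p.1 p.2.1, (p.2.2 : G)) ∈ 𝒢.U ∧ 𝒢.m (𝒢.m p.1 p.2.1) p.2.2 ∈ O) ∧
      (((p.2.1 : G), (p.2.2 : G)) ∈ 𝒢.U ∧ 𝒢.m p.2.1 p.2.2 ∈ O) ∧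
      (((p.1 : G), 𝒢.m p.2.1 p.2.2) ∈ 𝒢.U ∧ 𝒢.m p.1 (𝒢.m p.2.1 p.2.2) ∈ O) ∧
      𝒢.m (𝒢.m p.1 p.2.1) p.2.2 = 𝒢.m p.1 (𝒢.m p.2.1 p.2.2)}, isOpen_interior, ?_, ?_, ?_, ?_⟩
    · intro g
      have h := 𝒢.assoc_restrict O (p := (𝒢.u (𝒢.t g), 𝒢.u (𝒢.t g), (g : G)))
        (by simp only [𝒢.s_u, 𝒢.t_u]) (by simp only [𝒢.s_u]) (hW.mem_nhds (w1 g)) hWp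
        (by simp only [𝒢.m_u]; exact huO _) (by simp only [𝒢.unit_m]; exact g.2)
        (by simp only [𝒢.m_u, 𝒢.unit_m]; exact g.2)
      exact mem_interior_iff_mem_nhds.2 ((hjc.tendsto
        ((⟨𝒢.u (𝒢.t g), huO _⟩ : O), (⟨𝒢.u (𝒢.t g), huO _⟩ : O), g)).eventually h)
    · intro g
      have h := 𝒢.assoc_restrict O (p := (𝒢.u (𝒢.t g), (g : G), 𝒢.u (𝒢.s g)))
        (by simp only [𝒢.s_u]) (by simp only [𝒢.t_u]) (hW.mem_nhds (w2 g)) hWp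
        (by simp only [𝒢.unit_m]; exact g.2) (by simp only [𝒢.m_unit]; exact g.2)
        (by simp only [𝒢.unit_m, 𝒢.m_unit]; exact g.2)
      exact mem_interior_iff_mem_nhds.2 ((hjc.tendsto
        ((⟨𝒢.u (𝒢.t g), huO _⟩ : O), g, (⟨𝒢.u (𝒢.s g), huO _⟩ : O))).eventually h)
    · intro g
      have h := 𝒢.assoc_restrict O (p := ((g : G), 𝒢.u (𝒢.s g), 𝒢.u (𝒢.s g)))
        (by simp only [𝒢.t_u]) (by simp only [𝒢.s_u, 𝒢.t_u]) (hW.mem_nhds (w3 g)) hWp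
        (by simp only [𝒢.m_unit]; exact g.2) (by simp only [𝒢.m_u]; exact huO _)
        (by simp only [𝒢.m_unit]; exact g.2)
      exact mem_interior_iff_mem_nhds.2 ((hjc.tendsto
        (g, (⟨𝒢.u (𝒢.s g), huO _⟩ : O), (⟨𝒢.u (𝒢.s g), huO _⟩ : O))).eventually h)
    · intro g h l hmem hs1 hs2
      obtain ⟨v1, v2, v3, v4, v5⟩ := interior_subset hmem hs1 hs2
      have e1 : (𝒢.restrictMul g h : G) = 𝒢.m g h := coe_restrictMul v1.2
      have e3 : (𝒢.restrictMul h l : G) = 𝒢.m h l := coe_restrictMul v3.2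
      have w2 : ((𝒢.restrictMul g h : G), (l : G)) ∈ 𝒢.U ∧ 𝒢.m (𝒢.restrictMul g h) l ∈ O := by
        rw [e1]; exact v2
      have w4 : ((g : G), (𝒢.restrictMul h l : G)) ∈ 𝒢.U ∧ 𝒢.m g (𝒢.restrictMul h l) ∈ O := by
        rw [e3]; exact v4
      refine ⟨v1, w2, v3, w4, Subtype.ext ?_⟩
      rw [coe_restrictMul w2.2, coe_restrictMul w4.2, e1, e3]
      exact v5
  m_unit g := Subtype.ext (by
    have h := 𝒢.m_unit g
    rw [coe_restrictMul (by simp only [h]; exact g.2), h])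
  unit_m g := Subtype.ext (by
    have h := 𝒢.unit_m g
    rw [coe_restrictMul (by simp only [h]; exact g.2), h])
  s_i g hg := by rw [coe_restrictInv (hV'O (hiV' _ hg)), 𝒢.s_i _ (hV'V hg)]
  t_i g hg := by rw [coe_restrictInv (hV'O (hiV' _ hg)), 𝒢.t_i _ (hV'V hg)]
  i_m g hg := Subtype.ext (by
    have h := 𝒢.i_m _ (hV'V hg)
    have hi := coe_restrictInv (hV'O (hiV' _ hg))
    rw [coe_restrictMul (by rw [hi, h]; exact huO _), hi, h])
  m_i g hg := Subtype.ext (by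
    have h := 𝒢.m_i _ (hV'V hg)
    have hi := coe_restrictInv (hV'O (hiV' _ hg))
    rw [coe_restrictMul (by rw [hi, h]; exact huO _), hi, h])

end LocalLieGroupoid

/-! ### Words as lists of arrows -/

namespace LocalLieGroupoid

variable {n k : ℕ} {M : Type u} [TopologicalSpace M] [ChartedSpace (EuclideanSpace ℝ (Fin n)) M]
  {G : Type v} [TopologicalSpace G] [ChartedSpace (EuclideanSpace ℝ (Fin k)) G]
  (𝒢 : LocalLieGroupoid n k M G)

/-- Contraction for words given as lists of arrows. -/
def ListContracts (L L' : List G) : Prop :=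
  ∃ (pre : List G) (a b : G) (post : List G), (a, b) ∈ 𝒢.U ∧ L = pre ++ a :: b :: post ∧
    L' = pre ++ 𝒢.m a b :: post

/-- A list of arrows that forms a word. -/
def IsWord (L : List G) : Prop := L ≠ [] ∧ L.IsChain fun a b => 𝒢.s a = 𝒢.t b

/-- The list of letters of a word. -/
def toList (w : 𝒢.Word) : List G := List.ofFn w.2.1

variable {𝒢}

theorem toList_injective : Function.Injective 𝒢.toList := by
  rintro ⟨l, w, hw⟩ ⟨l', w', hw'⟩ h
  have h1 := List.ofFn_inj'.1 h
  obtain rfl : l = l' := by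
    have := congrArg Sigma.fst h1
    simpa using this
  obtain rfl : w = w' := by simpa using h1
  rfl

theorem isWord_toList (w : 𝒢.Word) : 𝒢.IsWord (𝒢.toList w) := by
  obtain ⟨l, w, hw⟩ := w
  refine ⟨fun h => ?_, List.isChain_iff_getElem.2 fun i hi => ?_⟩
  · have := congrArg List.length h
    simp [toList] at this
  · simp only [toList, List.getElem_ofFn]
    have hi' : i < l := by simpa [toList] using hi
    exact hw ⟨i, hi'⟩

theorem exists_toList_eq {L : List G} (hL : 𝒢.IsWord L) : ∃ w : 𝒢.Word, 𝒢.toList w = L := by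
  obtain ⟨l, hl⟩ := Nat.exists_eq_succ_of_ne_zero (List.length_pos_iff.2 hL.1).ne'
  refine ⟨⟨l, fun j => L[j.1]'(hl ▸ j.2), fun j => ?_⟩, ?_⟩
  · exact List.isChain_iff_getElem.1 hL.2 j.1 (by have := j.2; omega)
  · refine List.ext_getElem (by simp [toList, hl]) fun i h1 h2 => ?_
    simp only [toList, List.getElem_ofFn]

@[simp]
theorem toList_letter (g : G) : 𝒢.toList (𝒢.letter g) = [g] := by
  simp [toList, letter]

@[simp]
theorem toList_append (w w' : 𝒢.Word) (h : 𝒢.wordSource w = 𝒢.wordTarget w') :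
    𝒢.toList (𝒢.append w w' h) = 𝒢.toList w ++ 𝒢.toList w' :=
  List.ofFn_fin_append w.2.1 w'.2.1

theorem wordTarget_eq {w : 𝒢.Word} {a : G} {L : List G} (h : 𝒢.toList w = a :: L) :
    𝒢.wordTarget w = 𝒢.t a := by
  rw [toList, List.ofFn_succ, List.cons.injEq] at h
  rw [wordTarget, h.1]

theorem wordSource_eq {w : 𝒢.Word} {a : G} {L : List G} (h : 𝒢.toList w = L ++ [a]) :
    𝒢.wordSource w = 𝒢.s a := by
  rw [toList, List.ofFn_succ', List.concat_eq_append] at h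
  have := (List.append_inj' h rfl).2
  rw [List.cons.injEq] at this
  rw [wordSource, this.1]

/-- Contractions of words are contractions of the lists of their letters, which are free of the
indices in `Fin`. -/
theorem contracts_iff {w w' : 𝒢.Word} :
    𝒢.Contracts w w' ↔ 𝒢.ListContracts (𝒢.toList w) (𝒢.toList w') := by
  constructor
  · rintro ⟨l, a, ha, b, hb, j, rfl, rfl, h1, h2, h3, h4⟩
    have hj := j.2
    refine ⟨(List.ofFn a).take j, a j.castSucc, a j.succ, (List.ofFn a).drop (j + 2), h2, ?_, ?_⟩
    · refine List.ext_getElem (by simp [toList]; omega) fun i i1 i2 => ?_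
      simp only [toList, List.length_ofFn] at i1
      simp only [toList, List.getElem_ofFn]
      rcases lt_trichotomy i j.1 with h | h | h
      · rw [List.getElem_append_left (by simp; omega)]
        simp only [List.getElem_take, List.getElem_ofFn]
      · rw [List.getElem_append_right (by simp; omega)]
        simp only [h, List.length_take, List.length_ofFn]
        simp only [show min j.1 (l + 2) = j.1 by omega, Nat.sub_self, List.getElem_cons_zero]
        rfl
      · rw [List.getElem_append_right (by simp; omega)]
        simp only [List.length_take, List.length_ofFn, show min j.1 (l + 2) = j.1 by omega]
        obtain ⟨d, rfl⟩ : ∃ d, i = j.1 + (d + 1) := ⟨i - j.1 - 1, by omega⟩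
        cases d with
        | zero => simp only [show j.1 + (0 + 1) - j.1 = 0 + 1 by omega, List.getElem_cons_succ,
            List.getElem_cons_zero]; rfl
        | succ d =>
          simp only [show j.1 + (d + 1 + 1) - j.1 = d + 1 + 1 by omega, List.getElem_cons_succ,
            List.getElem_drop, List.getElem_ofFn]
          congr 1
          exact Fin.ext (by simp; omega)
    · refine List.ext_getElem (by simp [toList]; omega) fun i i1 i2 => ?_
      simp only [toList, List.length_ofFn] at i1
      simp only [toList, List.getElem_ofFn]
      rcases lt_trichotomy i j.1 with h | h | h
      · rw [List.getElem_append_left (by simp; omega)]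
        simp only [List.getElem_take, List.getElem_ofFn]
        exact h1 ⟨i, i1⟩ h
      · rw [List.getElem_append_right (by simp; omega)]
        simp only [h, List.length_take, List.length_ofFn]
        simp [show min j.1 (l + 2) = j.1 by omega, ← h3]
      · rw [List.getElem_append_right (by simp; omega)]
        simp only [List.length_take, List.length_ofFn, show min j.1 (l + 2) = j.1 by omega]
        obtain ⟨d, rfl⟩ : ∃ d, i = j.1 + (d + 1) := ⟨i - j.1 - 1, by omega⟩
        simp only [show j.1 + (d + 1) - j.1 = d + 1 by omega, List.getElem_cons_succ,
            List.getElem_drop, List.getElem_ofFn]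
        rw [h4 ⟨_, i1⟩ h]
        congr 1
        exact Fin.ext (by simp; omega)
  · obtain ⟨l, a, ha⟩ := w
    obtain ⟨l', b, hb⟩ := w'
    rintro ⟨pre, g, h, post, hU, e1, e2⟩
    have n1 := congrArg List.length e1
    have n2 := congrArg List.length e2
    simp only [toList, List.length_ofFn, List.length_append, List.length_cons] at n1 n2
    obtain rfl : l = l' + 1 := by omega
    have g1 : ∀ i (hi : i < l' + 1 + 1), a ⟨i, hi⟩ = (pre ++ g :: h :: post)[i]'(by simp; omega) := by
      intro i hi
      have : (List.ofFn a)[i]'(by simpa using hi) = _ :=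
        List.getElem_of_eq e1 (by simpa [toList] using Nat.le_of_lt_succ hi)
      rwa [List.getElem_ofFn] at this
    have g2 : ∀ i (hi : i < l' + 1), b ⟨i, hi⟩ = (pre ++ 𝒢.m g h :: post)[i]'(by simp; omega) := by
      intro i hi
      have : (List.ofFn b)[i]'(by simpa using hi) = _ :=
        List.getElem_of_eq e2 (by simpa [toList] using Nat.le_of_lt_succ hi)
      rwa [List.getElem_ofFn] at this
    have ea : a ⟨pre.length, by omega⟩ = g := by rw [g1]; simp
    have eb : a ⟨pre.length + 1, by omega⟩ = h := by
      rw [g1, List.getElem_append_right (by omega)]; simp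
    have ec : b ⟨pre.length, by omega⟩ = 𝒢.m g h := by rw [g2]; simp
    refine ⟨l', a, ha, b, hb, ⟨pre.length, by omega⟩, rfl, rfl, ?_, ?_, ?_, ?_⟩
    · rintro ⟨i, hi⟩ hij
      have hij : i < pre.length := hij
      have : (⟨i, hi⟩ : Fin (l' + 1)).castSucc = ⟨i, by omega⟩ := rfl
      rw [g2, this, g1, List.getElem_append_left hij, List.getElem_append_left hij]
    · have e1 : (⟨pre.length, by omega⟩ : Fin (l' + 1)).castSucc = ⟨pre.length, by omega⟩ := rfl
      have e2 : (⟨pre.length, by omega⟩ : Fin (l' + 1)).succ = ⟨pre.length + 1, by omega⟩ := rfl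
      rwa [e1, e2, ea, eb]
    · have e1 : (⟨pre.length, by omega⟩ : Fin (l' + 1)).castSucc = ⟨pre.length, by omega⟩ := rfl
      have e2 : (⟨pre.length, by omega⟩ : Fin (l' + 1)).succ = ⟨pre.length + 1, by omega⟩ := rfl
      rw [e1, e2, ea, eb, ec]
    · rintro ⟨i, hi⟩ hij
      have hij : pre.length < i := hij
      obtain ⟨d, rfl⟩ : ∃ d, i = pre.length + (d + 1) := ⟨i - pre.length - 1, by omega⟩
      have : (⟨pre.length + (d + 1), hi⟩ : Fin (l' + 1)).succ =
        ⟨pre.length + (d + 1 + 1), by omega⟩ := rfl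
      rw [g2, this, g1, List.getElem_append_right (by omega), List.getElem_append_right (by omega)]
      simp only [Nat.add_sub_cancel_left, List.getElem_cons_succ]

theorem ListContracts.isWord_iff {L L' : List G} (h : 𝒢.ListContracts L L') :
    𝒢.IsWord L ↔ 𝒢.IsWord L' := by
  obtain ⟨pre, a, b, post, hU, rfl, rfl⟩ := h
  have h1 := 𝒢.s_m _ _ hU
  have h2 := 𝒢.t_m _ _ hU
  have h3 := 𝒢.mem_U_s_eq_t hU
  simp only [IsWord, ne_eq, List.append_eq_nil_iff, reduceCtorEq, and_false, not_false_eq_true,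
    true_and]
  rw [List.isChain_append, List.isChain_append, List.isChain_cons_cons]
  simp only [List.head?_cons, Option.mem_some_iff, forall_eq', h2]
  have : List.IsChain (fun a b => 𝒢.s a = 𝒢.t b) (b :: post) ↔
      List.IsChain (fun a b => 𝒢.s a = 𝒢.t b) (𝒢.m a b :: post) := by
    cases post with
    | nil => simp
    | cons c post => rw [List.isChain_cons_cons, List.isChain_cons_cons, h1]
  rw [this]
  tauto

theorem ListContracts.map_s_getLast? {L L' : List G} (h : 𝒢.ListContracts L L') :
    L.getLast?.map 𝒢.s = L'.getLast?.map 𝒢.s := by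
  obtain ⟨pre, a, b, post, hU, rfl, rfl⟩ := h
  cases post using List.reverseRecOn with
  | nil =>
    have := 𝒢.s_m _ _ hU
    simp [List.getLast?_append, this]
  | append_singleton post c =>
    have e1 : pre ++ a :: b :: (post ++ [c]) = (pre ++ a :: b :: post) ++ [c] := by simp
    have e2 : pre ++ 𝒢.m a b :: (post ++ [c]) = (pre ++ 𝒢.m a b :: post) ++ [c] := by simp
    rw [e1, e2, List.getLast?_concat, List.getLast?_concat]

theorem ListContracts.map_t_head? {L L' : List G} (h : 𝒢.ListContracts L L') :
    L.head?.map 𝒢.t = L'.head?.map 𝒢.t := by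
  obtain ⟨pre, a, b, post, hU, rfl, rfl⟩ := h
  cases pre with
  | nil => simp [𝒢.t_m _ _ hU]
  | cons c pre => simp

theorem ListContracts.append_left {L L' : List G} (h : 𝒢.ListContracts L L') (K : List G) :
    𝒢.ListContracts (K ++ L) (K ++ L') := by
  obtain ⟨pre, a, b, post, hU, rfl, rfl⟩ := h
  exact ⟨K ++ pre, a, b, post, hU, by simp, by simp⟩

theorem ListContracts.append_right {L L' : List G} (h : 𝒢.ListContracts L L') (K : List G) :
    𝒢.ListContracts (L ++ K) (L' ++ K) := by
  obtain ⟨pre, a, b, post, hU, rfl, rfl⟩ := h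
  exact ⟨pre, a, b, post ++ K, hU, by simp, by simp⟩

/-- `L` can be contracted to `L'` in finitely many steps. -/
abbrev ListReduces (𝒢 : LocalLieGroupoid n k M G) : List G → List G → Prop :=
  Relation.ReflTransGen 𝒢.ListContracts

theorem ListReduces.isWord_iff {L L' : List G} (h : 𝒢.ListReduces L L') :
    𝒢.IsWord L ↔ 𝒢.IsWord L' := by
  induction h with
  | refl => rfl
  | tail _ h ih => exact ih.trans h.isWord_iff

theorem ListReduces.append {L₁ L₁' L₂ L₂' : List G} (h₁ : 𝒢.ListReduces L₁ L₁')
    (h₂ : 𝒢.ListReduces L₂ L₂') : 𝒢.ListReduces (L₁ ++ L₂) (L₁' ++ L₂') :=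
  (Relation.ReflTransGen.lift (fun L => L ++ L₂)
    (fun _ _ (h : 𝒢.ListContracts _ _) => h.append_right L₂) _ _ h₁).trans
    (Relation.ReflTransGen.lift (fun L => L₁' ++ L)
    (fun _ _ (h : 𝒢.ListContracts _ _) => h.append_left L₁') _ _ h₂)

theorem ListReduces.map_s_getLast? {L L' : List G} (h : 𝒢.ListReduces L L') :
    L.getLast?.map 𝒢.s = L'.getLast?.map 𝒢.s := by
  induction h with
  | refl => rfl
  | tail _ h ih => exact ih.trans h.map_s_getLast?

theorem ListReduces.map_t_head? {L L' : List G} (h : 𝒢.ListReduces L L') :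
    L.head?.map 𝒢.t = L'.head?.map 𝒢.t := by
  induction h with
  | refl => rfl
  | tail _ h ih => exact ih.trans h.map_t_head?

theorem listReduces_pair {a b : G} (hU : (a, b) ∈ 𝒢.U) : 𝒢.ListReduces [a, b] [𝒢.m a b] :=
  Relation.ReflTransGen.single ⟨[], a, b, [], hU, rfl, rfl⟩

/-- A word that reduces to a juxtaposition is the juxtaposition of words that reduce to the two
parts. -/
theorem ListReduces.exists_of_append {L X Y : List G} (h : 𝒢.ListReduces L (X ++ Y)) :
    ∃ L₁ L₂, L = L₁ ++ L₂ ∧ 𝒢.ListReduces L₁ X ∧ 𝒢.ListReduces L₂ Y := by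
  suffices H : ∀ Z, 𝒢.ListReduces L Z → ∀ X Y, Z = X ++ Y →
      ∃ L₁ L₂, L = L₁ ++ L₂ ∧ 𝒢.ListReduces L₁ X ∧ 𝒢.ListReduces L₂ Y from H _ h _ _ rfl
  intro Z hZ
  induction hZ with
  | refl => exact fun X Y h => ⟨X, Y, h, .refl, .refl⟩
  | tail _ hc ih =>
    rintro X Y rfl
    obtain ⟨pre, a, b, post, hU, rfl, e⟩ := hc
    rcases List.append_eq_append_iff.1 e with ⟨as, rfl, h2⟩ | ⟨bs, rfl, h2⟩
    · obtain ⟨L₁, L₂, h3, h4, h5⟩ := ih X (as ++ a :: b :: post) (by simp)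
      exact ⟨L₁, L₂, h3, h4, h5.tail ⟨as, a, b, post, hU, rfl, h2⟩⟩
    · rcases List.append_eq_cons_iff.1 h2.symm with ⟨rfl, rfl⟩ | ⟨as, rfl, rfl⟩
      · obtain ⟨L₁, L₂, h3, h4, h5⟩ := ih pre (a :: b :: post) rfl
        exact ⟨L₁, L₂, h3, by simpa using h4, h5.tail ⟨[], a, b, post, hU, rfl, rfl⟩⟩
      · obtain ⟨L₁, L₂, h3, h4, h5⟩ := ih (pre ++ a :: b :: as) Y (by simp)
        exact ⟨L₁, L₂, h3, h4.tail ⟨pre, a, b, as, hU, rfl, rfl⟩, h5⟩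

theorem reduces_iff {w w' : 𝒢.Word} : Relation.ReflTransGen 𝒢.Contracts w w' ↔
    𝒢.ListReduces (𝒢.toList w) (𝒢.toList w') := by
  constructor
  · exact Relation.ReflTransGen.lift 𝒢.toList (fun _ _ h => contracts_iff.1 h) _ _
  · intro h
    suffices H : ∀ L, 𝒢.ListReduces (𝒢.toList w) L → ∀ w', 𝒢.toList w' = L →
        Relation.ReflTransGen 𝒢.Contracts w w' from H _ h _ rfl
    intro L hL
    induction hL with
    | refl => intro w' hw'; rw [toList_injective hw']
    | tail h1 h2 ih =>
      rintro w' rfl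
      obtain ⟨w₁, rfl⟩ := exists_toList_eq (h2.isWord_iff.2 (isWord_toList w'))
      exact (ih w₁ rfl).tail (contracts_iff.2 h2)

theorem mem_associators_iff {g : G} : g ∈ 𝒢.associators ↔
    ∃ x, 𝒢.s g = x ∧ 𝒢.t g = x ∧ ∃ L, 𝒢.ListReduces L [𝒢.u x] ∧ 𝒢.ListReduces L [g] := by
  simp only [associators, associatorsAt, mem_iUnion, mem_ofPred_eq, reduces_iff, toList_letter]
  refine exists_congr fun x => and_congr_right fun _ => and_congr_right fun _ =>
    ⟨fun ⟨w, h⟩ => ⟨_, h⟩, fun ⟨L, h1, h2⟩ => ?_⟩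
  obtain ⟨w, rfl⟩ := exists_toList_eq (h2.isWord_iff.2 (by simpa using isWord_toList (𝒢.letter g)))
  exact ⟨w, h1, h2⟩

theorem u_mem_associators (x : M) : 𝒢.u x ∈ 𝒢.associators :=
  mem_associators_iff.2 ⟨x, 𝒢.s_u x, 𝒢.t_u x, _, .refl, .refl⟩

theorem isWord_singleton (g : G) : 𝒢.IsWord [g] := by
  simpa using isWord_toList (𝒢.letter g)

/-- The list `L` of letters represents the element `p` of the associative completion. -/
def Rep (𝒢 : LocalLieGroupoid n k M G) (L : List G) (p : 𝒢.AssocCompletion) : Prop :=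
  ∃ w, 𝒢.toList w = L ∧ 𝒢.toCompletion w = p

theorem rep_toList (w : 𝒢.Word) : 𝒢.Rep (𝒢.toList w) (𝒢.toCompletion w) := ⟨w, rfl, rfl⟩

theorem rep_singleton (g : G) : 𝒢.Rep [g] (𝒢.toCompletion (𝒢.letter g)) :=
  ⟨_, toList_letter g, rfl⟩

theorem Rep.isWord {L : List G} {p : 𝒢.AssocCompletion} (h : 𝒢.Rep L p) : 𝒢.IsWord L := by
  obtain ⟨w, rfl, -⟩ := h
  exact isWord_toList w

theorem Rep.unique {L : List G} {p q : 𝒢.AssocCompletion} (h : 𝒢.Rep L p) (h' : 𝒢.Rep L q) :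
    p = q := by
  obtain ⟨w, rfl, rfl⟩ := h
  obtain ⟨w', hw, rfl⟩ := h'
  rw [toList_injective hw]

theorem exists_rep_of_isWord {L : List G} (h : 𝒢.IsWord L) : ∃ p, 𝒢.Rep L p := by
  obtain ⟨w, rfl⟩ := exists_toList_eq h
  exact ⟨_, rep_toList w⟩

theorem exists_rep (p : 𝒢.AssocCompletion) : ∃ L, 𝒢.Rep L p := by
  obtain ⟨w, rfl⟩ := Quot.exists_rep p
  exact ⟨_, rep_toList w⟩

theorem ListContracts.rep_iff {L L' : List G} (h : 𝒢.ListContracts L L') {p : 𝒢.AssocCompletion} :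
    𝒢.Rep L p ↔ 𝒢.Rep L' p := by
  constructor
  · rintro ⟨w, rfl, rfl⟩
    obtain ⟨w', rfl⟩ := exists_toList_eq (h.isWord_iff.1 (isWord_toList w))
    exact ⟨w', rfl, (Quot.sound (contracts_iff.2 h)).symm⟩
  · rintro ⟨w, rfl, rfl⟩
    obtain ⟨w', rfl⟩ := exists_toList_eq (h.isWord_iff.2 (isWord_toList w))
    exact ⟨w', rfl, Quot.sound (contracts_iff.2 h)⟩

theorem ListReduces.rep_iff {L L' : List G} (h : 𝒢.ListReduces L L') {p : 𝒢.AssocCompletion} :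
    𝒢.Rep L p ↔ 𝒢.Rep L' p := by
  induction h with
  | refl => rfl
  | tail _ h ih => exact ih.trans h.rep_iff

theorem Rep.eqvGen {L L' : List G} {p : 𝒢.AssocCompletion} (h : 𝒢.Rep L p) (h' : 𝒢.Rep L' p) :
    Relation.EqvGen 𝒢.ListContracts L L' := by
  obtain ⟨w, rfl, rfl⟩ := h
  obtain ⟨w', rfl, hw⟩ := h'
  induction Quot.eqvGen_exact hw.symm with
  | rel a b h => exact .rel _ _ (contracts_iff.1 h)
  | refl => exact .refl _
  | symm _ _ h ih =>
    exact .symm _ _ (ih (Quot.eqvGen_sound h).symm)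
  | trans a b c h1 h2 ih1 ih2 =>
    exact .trans _ _ _ (ih1 (Quot.eqvGen_sound h1).symm) (ih2 (Quot.eqvGen_sound h2).symm)

end LocalLieGroupoid

/-! ### Fine shrinkings -/

namespace LocalLieGroupoid

variable {n k : ℕ} {M : Type u} [TopologicalSpace M] [ChartedSpace (EuclideanSpace ℝ (Fin n)) M]
  {G : Type v} [TopologicalSpace G] [ChartedSpace (EuclideanSpace ℝ (Fin k)) G]
  {𝒢 : LocalLieGroupoid n k M G}

/-- A subword may be replaced by another word with the same class: juxtaposition is well defined on
the associative completion. -/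
theorem Rep.congr_append {L L' K K' : List G} {p r : 𝒢.AssocCompletion} (h : 𝒢.Rep L p)
    (h' : 𝒢.Rep L' p) : 𝒢.Rep (K ++ L ++ K') r ↔ 𝒢.Rep (K ++ L' ++ K') r := by
  induction h.eqvGen h' with
  | rel _ _ hc => exact ((hc.append_left K).append_right K').rep_iff
  | refl => rfl
  | symm _ _ _ ih => exact (ih h' h).symm
  | trans a b c h1 h2 ih1 ih2 =>
    have hb : 𝒢.Rep b p := by
      have : ∀ {L L' : List G}, Relation.EqvGen 𝒢.ListContracts L L' → (𝒢.Rep L p ↔ 𝒢.Rep L' p) := by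
        intro L L' h
        induction h with
        | rel _ _ h => exact h.rep_iff
        | refl => rfl
        | symm _ _ _ ih => exact ih.symm
        | trans _ _ _ _ _ ih1 ih2 => exact ih1.trans ih2
      exact (this h1).1 h
    exact (ih1 h hb).trans (ih2 hb h')

variable (𝒢)

/-- The properties of a local Lie groupoid from which the smooth structure of its associative
completion is constructed. -/
class IsCompletable : Prop where
  /-- The multiplication has smooth local sections. -/
  exists_section : ∀ g h, (g, h) ∈ 𝒢.U → ∃ a b : G → G, a (𝒢.m g h) = g ∧ b (𝒢.m g h) = h ∧
    ContMDiffAt (𝓡 k) (𝓡 k) ∞ a (𝒢.m g h) ∧ ContMDiffAt (𝓡 k) (𝓡 k) ∞ b (𝒢.m g h) ∧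
    ∀ᶠ z in 𝓝 (𝒢.m g h), (a z, b z) ∈ 𝒢.U ∧ 𝒢.m (a z) (b z) = z
  /-- Distinct arrows have distinct classes. -/
  injective : Function.Injective fun g => 𝒢.toCompletion (𝒢.letter g)
  /-- Every arrow is a product of invertible arrows. -/
  exists_invertible : ∀ g, ∃ L : List G, (∀ v ∈ L, v ∈ 𝒢.V) ∧
    𝒢.Rep L (𝒢.toCompletion (𝒢.letter g))

/-- A shrinking of `𝒢` whose arrows are so close to the units that they can be divided by one
another in `𝒢`, that no quotient of two of them is a nontrivial associator, and that they can be
joined to the units inside the target fibres. -/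
structure IsFineShrinking {O : Opens G} (𝒢' : LocalLieGroupoid n k M O) : Prop where
  shrinksTo : 𝒢.ShrinksTo 𝒢'
  mem_V : ∀ g : O, (g : G) ∈ 𝒢.V
  right_mem_U : ∀ a b : O, 𝒢.s a = 𝒢.s b → ((a : G), 𝒢.i b) ∈ 𝒢.U
  left_mem_U : ∀ a b : O, 𝒢.t a = 𝒢.t b → (𝒢.i a, (b : G)) ∈ 𝒢.U
  mem_range_u : ∀ g : O, (g : G) ∈ 𝒢.associators → (g : G) ∈ range 𝒢.u
  m_mem_range_u : ∀ a b : O, 𝒢.t a = 𝒢.t b → 𝒢.m (𝒢.i a) b ∈ 𝒢.associators →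
    𝒢.m (𝒢.i a) b ∈ range 𝒢.u
  exists_path : ∀ g h : O, (g, h) ∈ 𝒢'.U → ∃ γ : Path (𝒢'.u (𝒢'.s g)) h,
    ∀ τ, 𝒢'.t (γ τ) = 𝒢'.s g ∧ (g, γ τ) ∈ 𝒢'.U

variable {𝒢}

theorem IsThreeAssociative.m_m_i_cancel (h3 : 𝒢.IsThreeAssociative) {g h : G} (hh : h ∈ 𝒢.V)
    (hU : (g, 𝒢.i h) ∈ 𝒢.U) (hU' : (𝒢.m g (𝒢.i h), h) ∈ 𝒢.U) :
    𝒢.m (𝒢.m g (𝒢.i h)) h = g := by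
  have := h3.m_i_cancel hU (𝒢.i_mem_V _ hh) (by rwa [h3.i_i hh])
  rwa [h3.i_i hh] at this

theorem IsThreeAssociative.m_i_m_cancel (h3 : 𝒢.IsThreeAssociative) {g h : G} (hg : g ∈ 𝒢.V)
    (hU : (𝒢.i g, h) ∈ 𝒢.U) (hU' : (g, 𝒢.m (𝒢.i g) h) ∈ 𝒢.U) :
    𝒢.m g (𝒢.m (𝒢.i g) h) = h := by
  have := h3.i_m_cancel hU (𝒢.i_mem_V _ hg) (by rwa [h3.i_i hg])
  rwa [h3.i_i hg] at this

/-- Divisibility, and the absence of nontrivial associators among quotients, are conditions on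
pairs of arrows near the pairs `(u x, u x)`. They hold on a neighbourhood of the units that is
convex along target fibres, and the convexity gives the paths. -/
theorem IsThreeAssociative.exists_isFineShrinking [T2Space M] [SecondCountableTopology M]
    [IsManifold (𝓡 n) ∞ M] [IsManifold (𝓡 k) ∞ G] (h3 : 𝒢.IsThreeAssociative)
    (hd : 𝒢.HasUniformlyDiscreteAssociators) :
    ∃ (O : Opens G) (𝒢' : LocalLieGroupoid n k M O), 𝒢.IsFineShrinking 𝒢' := by
  have : LocallyCompactSpace M := ChartedSpace.locallyCompactSpace (EuclideanSpace ℝ (Fin n)) M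
  -- `Od` contains no associators but the units.
  obtain ⟨Od, hOd, huOd, hOda⟩ := hd
  have hi : ∀ x, Tendsto 𝒢.i (𝓝 (𝒢.u x)) (𝓝 (𝒢.u x)) := fun x => by
    have := (𝒢.contMDiffOn_i _ (𝒢.u_mem_V x)).contMDiffAt (𝒢.isOpen_V.mem_nhds (𝒢.u_mem_V x))
    simpa [ContinuousAt, 𝒢.i_u] using this.continuousAt
  have hmO : ∀ (x : M) {O : Set G}, IsOpen O → 𝒢.u x ∈ O →
      ∀ᶠ q in 𝓝 (𝒢.u x, 𝒢.u x), 𝒢.s q.1 = 𝒢.t q.2 → 𝒢.m q.1 q.2 ∈ O := fun x O hO hx => by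
    have := 𝒢.continuousWithinAt_m (S := {q | 𝒢.s q.1 = 𝒢.t q.2}) (p₀ := (𝒢.u x, 𝒢.u x))
      (a := Prod.fst) (b := Prod.snd) continuousWithinAt_fst continuousWithinAt_snd
      self_mem_nhdsWithin (𝒢.u_u_mem x)
    exact eventually_nhdsWithin_iff.1 (this.eventually (hO.mem_nhds (by simpa [𝒢.m_u] using hx)))
  have hp : ∀ x, ∀ᶠ q in 𝓝 (𝒢.u x, 𝒢.u x), q.1 ∈ 𝒢.V ∧ q.2 ∈ 𝒢.V ∧ q.1 ∈ Od ∧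
      (𝒢.s q.1 = 𝒢.s q.2 → (q.1, 𝒢.i q.2) ∈ 𝒢.U) ∧ (𝒢.t q.1 = 𝒢.t q.2 → (𝒢.i q.1, q.2) ∈ 𝒢.U ∧
        𝒢.m (𝒢.i q.1) q.2 ∈ Od) := by
    intro x
    have hV : ∀ᶠ g in 𝓝 (𝒢.u x), g ∈ 𝒢.V := 𝒢.isOpen_V.mem_nhds (𝒢.u_mem_V x)
    have f1 : Tendsto (fun q : G × G => (q.1, 𝒢.i q.2)) (𝓝 (𝒢.u x, 𝒢.u x))
        (𝓝 (𝒢.u x, 𝒢.u x)) :=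
      Tendsto.prodMk_nhds continuousAt_fst ((hi x).comp continuousAt_snd)
    have f2 : Tendsto (fun q : G × G => (𝒢.i q.1, q.2)) (𝓝 (𝒢.u x, 𝒢.u x))
        (𝓝 (𝒢.u x, 𝒢.u x)) :=
      Tendsto.prodMk_nhds ((hi x).comp continuousAt_fst) continuousAt_snd
    filter_upwards [continuousAt_fst.eventually hV, continuousAt_snd.eventually hV,
      continuousAt_fst.eventually (hOd.mem_nhds (huOd ⟨x, rfl⟩)),
      f1.eventually (𝒢.eventually_mem_U (𝒢.u_u_mem x)),
      f2.eventually (𝒢.eventually_mem_U (𝒢.u_u_mem x)),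
      f2.eventually (hmO x hOd (huOd ⟨x, rfl⟩))] with q a1 a2 a3 a4 a5 a6
    simp only [𝒢.s_i _ a1, 𝒢.t_i _ a2] at a4 a5 a6
    exact ⟨a1, a2, a3, a4, fun h => ⟨a5 h, a6 h⟩⟩
  obtain ⟨O, huO, hpO, hpath⟩ := 𝒢.exists_convex_opens
    (p := fun a b => a ∈ 𝒢.V ∧ b ∈ 𝒢.V ∧ a ∈ Od ∧ (𝒢.s a = 𝒢.s b → (a, 𝒢.i b) ∈ 𝒢.U) ∧
      (𝒢.t a = 𝒢.t b → (𝒢.i a, b) ∈ 𝒢.U ∧ 𝒢.m (𝒢.i a) b ∈ Od)) hp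
  have hOV : ∀ g ∈ O, g ∈ 𝒢.V := fun g hg => (hpO g hg g hg (Or.inl rfl)).1
  have hOOd : ∀ g ∈ O, g ∈ Od := fun g hg => (hpO g hg g hg (Or.inl rfl)).2.2.1
  have hN := fun x => hmO x O.isOpen (huO x)
  simp only [nhds_prod_eq] at hN
  choose N hN hNp using fun x => eventually_prod_self_iff'.1 (hN x)
  obtain ⟨O₂, hO₂, huO₂, hpair⟩ := exists_isOpen_pair_mem 𝒢.contMDiff_s.continuous
    𝒢.contMDiff_t.continuous 𝒢.contMDiff_u.continuous 𝒢.s_u 𝒢.t_u hN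
  -- Products of two arrows of `W` lie in `O`, and `W ∩ i⁻¹ W`, the domain of the inversion of the
  -- shrinking, is closed under inversion.
  set W : Set G := 𝒢.V ∩ ((O : Set G) ∩ O₂) with hW
  have hWo : IsOpen W := 𝒢.isOpen_V.inter (O.isOpen.inter hO₂)
  have hiV : ∀ g ∈ W ∩ 𝒢.i ⁻¹' W, 𝒢.i g ∈ W ∩ 𝒢.i ⁻¹' W := fun g hg =>
    ⟨hg.2, by rw [mem_preimage, h3.i_i hg.1.1]; exact hg.1⟩
  refine ⟨O, 𝒢.restrict O huO (W ∩ 𝒢.i ⁻¹' W)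
    ((𝒢.contMDiffOn_i.continuousOn.mono inter_subset_left).isOpen_inter_preimage hWo hWo)
    (fun g hg => hg.1.1) (fun g hg => hg.1.2.1) ?_ hiV ?_, ?_⟩
  · exact fun x => ⟨⟨𝒢.u_mem_V x, huO x, huO₂ x⟩, by
      rw [mem_preimage, 𝒢.i_u]; exact ⟨𝒢.u_mem_V x, huO x, huO₂ x⟩⟩
  · intro g hg h hh hst
    obtain ⟨x, h1, h2⟩ := hpair g hg.1.2.2 h hh.1.2.2 (Or.inr (Or.inl hst))
    exact hNp x g h1 h h2 hst
  · refine ⟨⟨fun _ => rfl, fun _ => rfl, fun _ => rfl, fun _ _ => Iff.rfl,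
      fun g h hgh => coe_restrictMul hgh.2, fun g hg => ⟨hg.1.1, coe_restrictInv hg.2.2.1⟩⟩,
      fun g => hOV g g.2, fun a b hab => (hpO a a.2 b b.2 (Or.inl hab)).2.2.2.1 hab,
      fun a b hab => ((hpO a a.2 b b.2 (Or.inr (Or.inr hab))).2.2.2.2 hab).1,
      fun g hg => hOda ▸ ⟨hOOd g g.2, hg⟩,
      fun a b hab h => hOda ▸ ⟨((hpO a a.2 b b.2 (Or.inr (Or.inr hab))).2.2.2.2 hab).2, h⟩,
      fun g h hgh => ?_⟩
    obtain ⟨γ, hγ⟩ := hpath g g.2 h h.2 (𝒢.mem_U_s_eq_t hgh.1) hgh.2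
    exact ⟨⟨⟨fun τ => ⟨γ τ, (hγ τ).2.1⟩, γ.continuous.subtype_mk _⟩, Subtype.ext γ.source,
      Subtype.ext γ.target⟩, fun τ => ⟨(hγ τ).1, (hγ τ).2.2⟩⟩

end LocalLieGroupoid

/-! ### Translations between fibres of a submersion -/

section

variable {E H : Type*} [NormedAddCommGroup E] [NormedSpace ℝ E] [TopologicalSpace H]
  {I : ModelWithCorners ℝ E H} {X : Type*} [TopologicalSpace X] [ChartedSpace H X]
  {E' H' : Type*} [NormedAddCommGroup E'] [NormedSpace ℝ E'] [TopologicalSpace H']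
  {I' : ModelWithCorners ℝ E' H'} {Z : Type*} [TopologicalSpace Z] [ChartedSpace H' Z]

theorem LinearMap.surjOn_ker_of_injOn [FiniteDimensional ℝ E] {A₁ A₂ : E →ₗ[ℝ] E'}
    (h₁ : Function.Surjective A₁) (h₂ : Function.Surjective A₂) {D : E →ₗ[ℝ] E}
    (hD : MapsTo D (LinearMap.ker A₁) (LinearMap.ker A₂)) (hinj : InjOn D (LinearMap.ker A₁)) :
    SurjOn D (LinearMap.ker A₁) (LinearMap.ker A₂) := by
  have e₁ := A₁.finrank_range_add_finrank_ker
  have e₂ := A₂.finrank_range_add_finrank_ker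
  rw [LinearMap.range_eq_top.2 h₁] at e₁
  rw [LinearMap.range_eq_top.2 h₂] at e₂
  have e : Module.finrank ℝ (LinearMap.ker A₁) = Module.finrank ℝ (LinearMap.ker A₂) := by omega
  have hi : Function.Injective (D.restrict (p := LinearMap.ker A₁) (q := LinearMap.ker A₂)
      fun x hx => hD hx) :=
    fun a b hab => Subtype.ext (hinj a.2 b.2 (congrArg Subtype.val hab))
  intro w hw
  obtain ⟨v, hv⟩ := (LinearMap.injective_iff_surjective_of_finrank_eq_finrank e).1 hi ⟨w, hw⟩
  exact ⟨v, v.2, congrArg Subtype.val hv⟩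

/-- The differential of an embedding `F` of one fibre of a submersion into another fibre, which is
undone by a smooth map `F'`, is an isomorphism of the tangent spaces of the fibres. -/
theorem HasMFDerivWithinAt.bijOn_ker [FiniteDimensional ℝ E] [CompleteSpace E]
    [CompleteSpace E'] [I.Boundaryless] [I'.Boundaryless]
    [IsManifold I ∞ X] [IsManifold I' ∞ Z] [FiniteDimensional ℝ E']
    {f : X → Z} (hf : ContMDiff I I' ∞ f)
    (hfs : ∀ x, Function.Surjective (mfderiv I I' f x)) {F : X → X} {A B : Set X} {x : X}
    {D D' : E →L[ℝ] E} {Y : Type*} [TopologicalSpace Y] [ChartedSpace H Y] {e F' : X → Y}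
    (hA : ∀ᶠ z in 𝓝 x, f z = f x → z ∈ A) (hx : x ∈ A) (hD : HasMFDerivWithinAt I I F A x D)
    (hF : ∀ z ∈ A, f (F z) = f (F x)) (hAB : ∀ z ∈ A, F z ∈ B)
    (hD' : HasMFDerivWithinAt I I F' B (F x) D')
    (he : HasMFDerivAt I I e x (ContinuousLinearMap.id ℝ E)) (heq : ∀ z ∈ A, F' (F z) = e z) :
    BijOn D {v | (mfderiv I I' f x v : E') = 0} {v | (mfderiv I I' f (F x) v : E') = 0} := by
  have m1 : MapsTo D {v | (mfderiv I I' f x v : E') = 0}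
      {v | (mfderiv I I' f (F x) v : E') = 0} := by
    intro v hv
    have h1 : HasMFDerivWithinAt I I' (f ∘ F) A x ((modelDeriv I I' f (F x)).comp D) :=
      ((hf.mdifferentiableAt (by simp)).hasMFDerivAt (x := F x)).comp_hasMFDerivWithinAt x hD
    have h2 : HasMFDerivWithinAt I I' (f ∘ F) A x (0 : E →L[ℝ] E') :=
      (hasMFDerivWithinAt_const (f (F x)) A x).congr_of_eventuallyEq
        (by filter_upwards [self_mem_nhdsWithin] with z hz using hF z hz) rfl
    exact HasMFDerivWithinAt.eq_on_ker hf (hfs x) hA h1 h2 hv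
  have m2 : InjOn D {v | (mfderiv I I' f x v : E') = 0} := by
    have key : ∀ v, (mfderiv I I' f x v : E') = 0 → D' (D v) = v := by
      intro v hv
      have h1 : HasMFDerivWithinAt I I (F' ∘ F) A x (D'.comp D) := hD'.comp x hD hAB
      have h2 : HasMFDerivWithinAt I I (F' ∘ F) A x (ContinuousLinearMap.id ℝ E) :=
        he.hasMFDerivWithinAt.congr_of_eventuallyEq
          (by filter_upwards [self_mem_nhdsWithin] with z hz using heq z hz) (heq x hx)
      exact HasMFDerivWithinAt.eq_on_ker hf (hfs x) hA h1 h2 hv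
    intro v hv w hw hvw
    rw [← key v hv, ← key w hw, hvw]
  exact ⟨m1, m2, LinearMap.surjOn_ker_of_injOn
    (A₁ := (modelDeriv I I' f x).toLinearMap) (A₂ := (modelDeriv I I' f (F x)).toLinearMap)
    (D := D.toLinearMap) (hfs x) (hfs (F x)) m1 m2⟩

end

namespace LocalLieGroupoid

variable {n k : ℕ} {M : Type u} [TopologicalSpace M] [ChartedSpace (EuclideanSpace ℝ (Fin n)) M]
  {G : Type v} [TopologicalSpace G] [ChartedSpace (EuclideanSpace ℝ (Fin k)) G]
  {𝒢 : LocalLieGroupoid n k M G}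

theorem eventually_mem_U_of_s_eq {g h : G} (hU : (h, g) ∈ 𝒢.U) :
    ∀ᶠ z in 𝓝 h, 𝒢.s z = 𝒢.s h → (z, g) ∈ 𝒢.U := by
  have h1 : Tendsto (fun z => (z, g)) (𝓝 h) (𝓝 (h, g)) :=
    (Continuous.prodMk_left g).tendsto h
  filter_upwards [h1.eventually (𝒢.eventually_mem_U hU)] with z hz hs
  exact hz (hs.trans (𝒢.mem_U_s_eq_t hU))

theorem eventually_mem_U_of_t_eq {g h : G} (hU : (g, h) ∈ 𝒢.U) :
    ∀ᶠ z in 𝓝 h, 𝒢.t z = 𝒢.t h → (g, z) ∈ 𝒢.U := by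
  have h1 : Tendsto (fun z => (g, z)) (𝓝 h) (𝓝 (g, h)) :=
    (Continuous.prodMk_right g).tendsto h
  filter_upwards [h1.eventually (𝒢.eventually_mem_U hU)] with z hz hs
  exact hz ((𝒢.mem_U_s_eq_t hU).trans hs.symm)

end LocalLieGroupoid

/-! ### The associative completion of a fine shrinking -/

namespace LocalLieGroupoid

variable {n k : ℕ} {M : Type u} [TopologicalSpace M] [ChartedSpace (EuclideanSpace ℝ (Fin n)) M]
  {G : Type v} [TopologicalSpace G] [ChartedSpace (EuclideanSpace ℝ (Fin k)) G]
  {𝒢 : LocalLieGroupoid n k M G} {O : Opens G} {𝒢' : LocalLieGroupoid n k M O}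

namespace ShrinksTo

theorem mem_U (h : 𝒢.ShrinksTo 𝒢') {a b : O} (hab : (a, b) ∈ 𝒢'.U) : ((a : G), (b : G)) ∈ 𝒢.U :=
  ((h.2.2.2.1 a b).1 hab).1

theorem coe_m (h : 𝒢.ShrinksTo 𝒢') {a b : O} (hab : (a, b) ∈ 𝒢'.U) :
    (𝒢'.m a b : G) = 𝒢.m a b := h.2.2.2.2.1 a b hab

theorem listContracts (h : 𝒢.ShrinksTo 𝒢') {L L' : List O} (hL : 𝒢'.ListContracts L L') :
    𝒢.ListContracts (L.map Subtype.val) (L'.map Subtype.val) := by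
  obtain ⟨pre, a, b, post, hU, rfl, rfl⟩ := hL
  exact ⟨pre.map Subtype.val, a, b, post.map Subtype.val, h.mem_U hU, by simp,
    by simp [h.coe_m hU]⟩

theorem listReduces (h : 𝒢.ShrinksTo 𝒢') {L L' : List O} (hL : 𝒢'.ListReduces L L') :
    𝒢.ListReduces (L.map Subtype.val) (L'.map Subtype.val) :=
  Relation.ReflTransGen.lift (List.map Subtype.val)
    (fun _ _ (hc : 𝒢'.ListContracts _ _) => h.listContracts hc) _ _ hL

theorem coe_mem_associators (h : 𝒢.ShrinksTo 𝒢') {g : O} (hg : g ∈ 𝒢'.associators) :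
    (g : G) ∈ 𝒢.associators := by
  obtain ⟨x, h1, h2, L, h3, h4⟩ := mem_associators_iff.1 hg
  refine mem_associators_iff.2 ⟨x, (h.1 g).symm.trans h1, (h.2.1 g).symm.trans h2, _, ?_,
    h.listReduces h4⟩
  rw [← h.2.2.1]
  exact h.listReduces h3

end ShrinksTo

namespace IsFineShrinking

theorem associators_eq (hF : 𝒢.IsFineShrinking 𝒢') : 𝒢'.associators = range 𝒢'.u := by
  refine Subset.antisymm (fun g hg => ?_) ?_
  · obtain ⟨x, hx⟩ := hF.mem_range_u g (hF.shrinksTo.coe_mem_associators hg)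
    exact ⟨x, Subtype.ext ((hF.shrinksTo.2.2.1 x).trans hx)⟩
  · rintro _ ⟨x, rfl⟩
    exact u_mem_associators x

theorem productsConnectedToAxes (hF : 𝒢.IsFineShrinking 𝒢') : 𝒢'.ProductsConnectedToAxes := by
  intro g h hU
  obtain ⟨γ, hγ⟩ := hF.exists_path g h hU
  exact Or.inr ⟨γ, fun τ => (hγ τ).2⟩

/-- Right translation by `g` is undone by right translation by `i g`, which is defined in the larger
local groupoid, and likewise for left translations. -/
theorem isBiregular [IsManifold (𝓡 n) ∞ M] [IsManifold (𝓡 k) ∞ G]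
    (hF : 𝒢.IsFineShrinking 𝒢') (h3 : 𝒢.IsThreeAssociative) : 𝒢'.IsBiregular := by
  have hsh := hF.shrinksTo
  constructor
  · intro g h hU
    have hs : ∀ z : O, 𝒢'.s z = 𝒢.s z := hsh.1
    have hD : HasMFDerivWithinAt (𝓡 k) (𝓡 k) (fun z => 𝒢'.m z g) {z | (z, g) ∈ 𝒢'.U} h
        (𝒢'.dR g h) := by
      refine MDifferentiableWithinAt.hasMFDerivWithinAt
        (ContMDiffWithinAt.mdifferentiableWithinAt (n := ∞) ?_ (by simp))
      exact 𝒢'.contMDiffWithinAt_m contMDiffWithinAt_id contMDiffWithinAt_const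
        (by filter_upwards [self_mem_nhdsWithin] with z hz using 𝒢'.mem_U_s_eq_t hz) hU
    have hmem : ∀ z : O, (z, g) ∈ 𝒢'.U → ((𝒢'.m z g : G), 𝒢.i g) ∈ 𝒢.U := fun z hz =>
      hF.right_mem_U _ _ (by rw [← hs, ← hs, 𝒢'.s_m _ _ hz])
    have hD' : ∃ D', HasMFDerivWithinAt (𝓡 k) (𝓡 k) (fun z : O => 𝒢.m z (𝒢.i g))
        {z | ((z : G), 𝒢.i g) ∈ 𝒢.U} (𝒢'.m h g) D' := by
      refine ⟨_, MDifferentiableWithinAt.hasMFDerivWithinAt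
        (ContMDiffWithinAt.mdifferentiableWithinAt (n := ∞) ?_ (by simp))⟩
      exact 𝒢.contMDiffWithinAt_m contMDiff_subtype_val.contMDiffAt.contMDiffWithinAt
        contMDiffWithinAt_const
        (by filter_upwards [self_mem_nhdsWithin] with z hz using 𝒢.mem_U_s_eq_t hz) (hmem h hU)
    obtain ⟨D', hD'⟩ := hD'
    refine HasMFDerivWithinAt.bijOn_ker 𝒢'.contMDiff_s 𝒢'.submersion_s
      (eventually_mem_U_of_s_eq hU) hU hD (fun z hz => ?_) (fun z hz => hmem z hz) hD'
      (hasMFDerivAt_subtypeVal h) (fun z hz => ?_)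
    · rw [𝒢'.s_m _ _ hz, 𝒢'.s_m _ _ hU]
    · have := hmem z hz
      rw [hsh.coe_m hz] at this ⊢
      exact h3.m_i_cancel (hsh.mem_U hz) (hF.mem_V g) this
  · intro g h hU
    have ht : ∀ z : O, 𝒢'.t z = 𝒢.t z := hsh.2.1
    have hD : HasMFDerivWithinAt (𝓡 k) (𝓡 k) (fun z => 𝒢'.m g z) {z | (g, z) ∈ 𝒢'.U} h
        (𝒢'.dL g h) := by
      refine MDifferentiableWithinAt.hasMFDerivWithinAt
        (ContMDiffWithinAt.mdifferentiableWithinAt (n := ∞) ?_ (by simp))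
      exact 𝒢'.contMDiffWithinAt_m contMDiffWithinAt_const contMDiffWithinAt_id
        (by filter_upwards [self_mem_nhdsWithin] with z hz using 𝒢'.mem_U_s_eq_t hz) hU
    have hmem : ∀ z : O, (g, z) ∈ 𝒢'.U → (𝒢.i g, (𝒢'.m g z : G)) ∈ 𝒢.U := fun z hz =>
      hF.left_mem_U _ _ (by rw [← ht, ← ht, 𝒢'.t_m _ _ hz])
    have hD' : ∃ D', HasMFDerivWithinAt (𝓡 k) (𝓡 k) (fun z : O => 𝒢.m (𝒢.i g) z)
        {z | (𝒢.i g, (z : G)) ∈ 𝒢.U} (𝒢'.m g h) D' := by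
      refine ⟨_, MDifferentiableWithinAt.hasMFDerivWithinAt
        (ContMDiffWithinAt.mdifferentiableWithinAt (n := ∞) ?_ (by simp))⟩
      exact 𝒢.contMDiffWithinAt_m contMDiffWithinAt_const
        contMDiff_subtype_val.contMDiffAt.contMDiffWithinAt
        (by filter_upwards [self_mem_nhdsWithin] with z hz using 𝒢.mem_U_s_eq_t hz) (hmem h hU)
    obtain ⟨D', hD'⟩ := hD'
    refine HasMFDerivWithinAt.bijOn_ker 𝒢'.contMDiff_t 𝒢'.submersion_t
      (eventually_mem_U_of_t_eq hU) hU hD (fun z hz => ?_) (fun z hz => hmem z hz) hD'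
      (hasMFDerivAt_subtypeVal h) (fun z hz => ?_)
    · rw [𝒢'.t_m _ _ hz, 𝒢'.t_m _ _ hU]
    · have := hmem z hz
      rw [hsh.coe_m hz] at this ⊢
      exact h3.i_m_cancel (hsh.mem_U hz) (hF.mem_V g) this

/-- Two words of the shrinking that represent the same element of its associative completion are
contractions of a common word of the larger local groupoid: to undo the contraction of `(g, h)` to
`gh` at a place where a subword reduces to `gh`, insert `(h⁻¹, h)` after this subword. -/
theorem exists_common_expansion (hF : 𝒢.IsFineShrinking 𝒢') (h3 : 𝒢.IsThreeAssociative)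
    {L L' : List O} (h : Relation.EqvGen 𝒢'.ListContracts L L') :
    ∃ K, 𝒢.ListReduces K (L.map Subtype.val) ∧ 𝒢.ListReduces K (L'.map Subtype.val) := by
  have hsh := hF.shrinksTo
  -- Any word that reduces to `L` can be expanded so that it reduces to `L'`, and conversely: this
  -- stronger property passes to compositions of contractions and their inverses.
  suffices H : (∀ K, 𝒢.ListReduces K (L.map Subtype.val) →
      ∃ K', 𝒢.ListReduces K' K ∧ 𝒢.ListReduces K' (L'.map Subtype.val)) ∧
      (∀ K, 𝒢.ListReduces K (L'.map Subtype.val) →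
      ∃ K', 𝒢.ListReduces K' K ∧ 𝒢.ListReduces K' (L.map Subtype.val)) from
    H.1 (L.map Subtype.val) .refl
  induction h with
  | rel L L' h =>
    refine ⟨fun K hK => ⟨K, .refl, hK.tail (hsh.listContracts h)⟩, fun K hK => ?_⟩
    obtain ⟨pre, a, b, post, hU, rfl, rfl⟩ := h
    have hU' := hsh.mem_U hU
    rw [List.map_append, List.map_cons, ← List.singleton_append] at hK
    obtain ⟨K₁, K', rfl, r1, hK'⟩ := ListReduces.exists_of_append hK
    obtain ⟨K₂, K₃, rfl, r2, r3⟩ := ListReduces.exists_of_append hK'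
    have hbV := hF.mem_V b
    have hU2 : (𝒢.m (a : G) b, 𝒢.i b) ∈ 𝒢.U := by
      have := hF.right_mem_U (𝒢'.m a b) b
        (by rw [← hsh.1, ← hsh.1, 𝒢'.s_m _ _ hU])
      rwa [hsh.coe_m hU] at this
    have h2 : 𝒢.ListReduces [𝒢.m a b, 𝒢.i b, (b : G)] [(a : G), (b : G)] := by
      refine Relation.ReflTransGen.single ⟨[], 𝒢.m a b, 𝒢.i b, [(b : G)], hU2, rfl, ?_⟩
      rw [h3.m_i_cancel hU' hbV hU2]
      rfl
    rw [hsh.coe_m hU] at r2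
    have h1 : 𝒢.ListReduces (K₂ ++ [𝒢.i b, (b : G)]) K₂ := by
      have hlast := r2.map_s_getLast?
      cases K₂ using List.reverseRecOn with
      | nil => simp at hlast
      | append_singleton K z =>
        simp only [List.getLast?_concat, List.getLast?_singleton, Option.map_some,
          Option.some.injEq, 𝒢.s_m _ _ hU'] at hlast
        refine (Relation.ReflTransGen.single ⟨K ++ [z], 𝒢.i b, b, [], 𝒢.i_m_mem_U hbV, rfl,
          rfl⟩).trans ?_
        rw [𝒢.i_m _ hbV, ← hlast]
        refine Relation.ReflTransGen.single ⟨K, z, 𝒢.u (𝒢.s z), [], 𝒢.unit_right_mem z, by simp, ?_⟩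
        rw [𝒢.m_unit]
    refine ⟨K₁ ++ ((K₂ ++ [𝒢.i b, (b : G)]) ++ K₃),
      .append .refl (.append h1 .refl), ?_⟩
    have := ListReduces.append r1 (ListReduces.append
      ((ListReduces.append r2 (.refl : 𝒢.ListReduces [𝒢.i b, (b : G)] _)).trans h2) r3)
    simpa using this
  | refl => exact ⟨fun K hK => ⟨K, .refl, hK⟩, fun K hK => ⟨K, .refl, hK⟩⟩
  | symm _ _ _ ih => exact ih.symm
  | trans _ _ _ _ _ ih1 ih2 =>
    constructor
    · intro K hK
      obtain ⟨K₁, h1, h2⟩ := ih1.1 K hK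
      obtain ⟨K₂, h3, h4⟩ := ih2.1 K₁ h2
      exact ⟨K₂, h3.trans h1, h4⟩
    · intro K hK
      obtain ⟨K₁, h1, h2⟩ := ih2.2 K hK
      obtain ⟨K₂, h3, h4⟩ := ih1.2 K₁ h2
      exact ⟨K₂, h3.trans h1, h4⟩

/-- If `g` and `g'` have the same class, then by a common expansion `K` of the two the word
`(g⁻¹, K)` reduces both to a unit and to `g⁻¹ g'`, which is therefore an associator and hence a unit. -/
theorem letter_injective (hF : 𝒢.IsFineShrinking 𝒢') (h3 : 𝒢.IsThreeAssociative) :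
    Function.Injective fun g => 𝒢'.toCompletion (𝒢'.letter g) := by
  intro g g' hgg
  have hsh := hF.shrinksTo
  have hgg : 𝒢'.toCompletion (𝒢'.letter g) = 𝒢'.toCompletion (𝒢'.letter g') := hgg
  obtain ⟨K, h1, h2⟩ := hF.exists_common_expansion h3
    ((rep_singleton g).eqvGen (hgg ▸ rep_singleton g'))
  simp only [List.map_cons, List.map_nil] at h1 h2
  have hs : 𝒢.s g = 𝒢.s g' := by
    have := h1.map_s_getLast?.symm.trans h2.map_s_getLast?
    simpa using this
  have ht : 𝒢.t g = 𝒢.t g' := by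
    have := h1.map_t_head?.symm.trans h2.map_t_head?
    simpa using this
  have hU := hF.left_mem_U g g' ht
  have r1 : 𝒢.ListReduces (𝒢.i g :: K) [𝒢.u (𝒢.s g)] := by
    have := (ListReduces.append (.refl : 𝒢.ListReduces [𝒢.i g] _) h1).trans
      (listReduces_pair (𝒢.i_m_mem_U (hF.mem_V g)))
    rwa [𝒢.i_m _ (hF.mem_V g)] at this
  have r2 : 𝒢.ListReduces (𝒢.i g :: K) [𝒢.m (𝒢.i g) g'] :=
    (ListReduces.append (.refl : 𝒢.ListReduces [𝒢.i g] _) h2).trans (listReduces_pair hU)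
  obtain ⟨x, hx⟩ := hF.m_mem_range_u g g' ht (mem_associators_iff.2 ⟨𝒢.s g,
    by rw [𝒢.s_m _ _ hU, hs], by rw [𝒢.t_m _ _ hU, 𝒢.t_i _ (hF.mem_V g)], _, r1, r2⟩)
  obtain rfl : 𝒢.s g = x := by
    have := congrArg 𝒢.s hx
    rw [𝒢.s_u, 𝒢.s_m _ _ hU, ← hs] at this
    exact this.symm
  have := h3.m_i_m_cancel (hF.mem_V g) hU (by rw [← hx]; exact 𝒢.unit_right_mem _)
  rw [← hx, 𝒢.m_unit] at this
  exact Subtype.ext this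

/-- A local bisection `β` of the larger local groupoid through `h` gives the section
`z ↦ (z β(z)⁻¹, β(z))` of the multiplication near `gh`, where `β(z)` is the arrow of the bisection with the
source of `z`. -/
theorem exists_section [IsManifold (𝓡 n) ∞ M] [IsManifold (𝓡 k) ∞ G]
    (hF : 𝒢.IsFineShrinking 𝒢') (h3 : 𝒢.IsThreeAssociative) (g h : O) (hU : (g, h) ∈ 𝒢'.U) :
    ∃ a b : O → O, a (𝒢'.m g h) = g ∧ b (𝒢'.m g h) = h ∧
      ContMDiffAt (𝓡 k) (𝓡 k) ∞ a (𝒢'.m g h) ∧ ContMDiffAt (𝓡 k) (𝓡 k) ∞ b (𝒢'.m g h) ∧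
      ∀ᶠ z in 𝓝 (𝒢'.m g h), (a z, b z) ∈ 𝒢'.U ∧ 𝒢'.m (a z) (b z) = z := by
  have hsh := hF.shrinksTo
  obtain ⟨β, c, hβ, hc, hβs, hcs⟩ := exists_local_bisection 𝒢.contMDiff_s 𝒢.contMDiff_t
    (𝒢.submersion_s h) (𝒢.submersion_t h)
  set q : O := 𝒢'.m g h with hq
  have hqs : 𝒢.s q = 𝒢.s h := by rw [hsh.coe_m hU, 𝒢.s_m _ _ (hsh.mem_U hU)]
  set b₁ : O → G := fun z => β (c (𝒢.s z)) with hb₁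
  have hb₁q : b₁ q = h := by simp only [hb₁]; rw [hqs, hc, hβ]
  have hst : Tendsto (fun z : O => 𝒢.s z) (𝓝 q) (𝓝 (𝒢.s h)) :=
    (𝒢.contMDiff_s.continuous.comp continuous_subtype_val).tendsto' _ _ hqs
  have hb₁s : ContMDiffAt (𝓡 k) (𝓡 k) ∞ b₁ q := by
    have h1 : ContMDiffAt (𝓡 k) (𝓡 n) ∞ (fun z : O => c (𝒢.s z)) q := by
      refine ContMDiffAt.comp q ?_ (𝒢.contMDiff_s.comp contMDiff_subtype_val).contMDiffAt
      rw [hqs]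
      exact hcs.self_of_nhds.1
    refine ContMDiffAt.comp q ?_ h1
    rw [hqs, hc]
    exact hβs.self_of_nhds.1
  have hb₁e : ∀ᶠ z : O in 𝓝 q, b₁ z ∈ 𝒢.V ∧ b₁ z ∈ O ∧ 𝒢.s (b₁ z) = 𝒢.s z := by
    filter_upwards [hb₁s.continuousAt.eventually
      ((𝒢.isOpen_V.inter O.isOpen).mem_nhds (show b₁ q ∈ _ by rw [hb₁q]; exact ⟨hF.mem_V h, h.2⟩)),
      hst.eventually hcs] with z h1 h2
    exact ⟨h1.1, h1.2, h2.2⟩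
  have hibs : ContMDiffAt (𝓡 k) (𝓡 k) ∞ (fun z => 𝒢.i (b₁ z)) q := by
    refine ContMDiffAt.comp q ?_ hb₁s
    rw [hb₁q]
    exact (𝒢.contMDiffOn_i _ (hF.mem_V h)).contMDiffAt (𝒢.isOpen_V.mem_nhds (hF.mem_V h))
  have hqU : ((q : G), 𝒢.i (b₁ q)) ∈ 𝒢.U := by
    rw [hb₁q]; exact hF.right_mem_U _ _ hqs
  have hste : ∀ᶠ z : O in 𝓝[univ] q, 𝒢.s z = 𝒢.t (𝒢.i (b₁ z)) := by
    rw [nhdsWithin_univ]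
    filter_upwards [hb₁e] with z hz
    rw [𝒢.t_i _ hz.1, hz.2.2]
  set a₁ : O → G := fun z => 𝒢.m z (𝒢.i (b₁ z)) with ha₁
  have ha₁s : ContMDiffAt (𝓡 k) (𝓡 k) ∞ a₁ q := by
    have := 𝒢.contMDiffWithinAt_m (S := univ) (p₀ := q) (a := fun z : O => (z : G))
      contMDiff_subtype_val.contMDiffAt.contMDiffWithinAt hibs.contMDiffWithinAt hste hqU
    rwa [contMDiffWithinAt_univ] at this
  have ha₁q : a₁ q = g := by
    simp only [ha₁]
    have := hF.right_mem_U q h hqs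
    rw [hb₁q]
    rw [hsh.coe_m hU] at this ⊢
    exact h3.m_i_cancel (hsh.mem_U hU) (hF.mem_V h) this
  have hUe : ∀ᶠ z : O in 𝓝 q, ((z : G), 𝒢.i (b₁ z)) ∈ 𝒢.U := by
    have := 𝒢.eventually_mem_U_within (S := univ) (p₀ := q) (a := fun z : O => (z : G))
      continuous_subtype_val.continuousAt.continuousWithinAt
      hibs.continuousAt.continuousWithinAt hste hqU
    rwa [nhdsWithin_univ] at this
  have haUe : ∀ᶠ z : O in 𝓝 q, (a₁ z, b₁ z) ∈ 𝒢.U := by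
    filter_upwards [(ha₁s.continuousAt.prodMk hb₁s.continuousAt).eventually
      (𝒢.eventually_mem_U (p := (a₁ q, b₁ q)) (by rw [ha₁q, hb₁q]; exact hsh.mem_U hU)), hUe, hb₁e]
      with z h1 h2 h4
    exact h1 (by simp only [ha₁]; rw [𝒢.s_m _ _ h2, 𝒢.s_i _ h4.1])
  have haO : ∀ᶠ z : O in 𝓝 q, a₁ z ∈ O :=
    ha₁s.continuousAt.eventually (O.isOpen.mem_nhds (by rw [ha₁q]; exact g.2))
  classical
  refine ⟨fun z => if hz : a₁ z ∈ O then ⟨a₁ z, hz⟩ else z,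
    fun z => if hz : b₁ z ∈ O then ⟨b₁ z, hz⟩ else z, ?_, ?_, ?_, ?_, ?_⟩
  · exact Subtype.ext ((congrArg Subtype.val (dif_pos haO.self_of_nhds)).trans ha₁q)
  · exact Subtype.ext ((congrArg Subtype.val (dif_pos hb₁e.self_of_nhds.2.1)).trans hb₁q)
  · rw [← ContMDiffAt.subtypeVal_comp_iff]
    refine ha₁s.congr_of_eventuallyEq ?_
    filter_upwards [haO] with z hz
    simp only [Function.comp_apply, dif_pos hz]
  · rw [← ContMDiffAt.subtypeVal_comp_iff]
    refine hb₁s.congr_of_eventuallyEq ?_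
    filter_upwards [hb₁e] with z hz
    simp only [Function.comp_apply, dif_pos hz.2.1]
  · filter_upwards [haO, hb₁e, hUe, haUe] with z h1 h2 h4 h5
    rw [dif_pos h1, dif_pos h2.2.1]
    have h6 : 𝒢.m (a₁ z) (b₁ z) = z := h3.m_m_i_cancel h2.1 h4 h5
    have h7 : ((⟨a₁ z, h1⟩ : O), (⟨b₁ z, h2.2.1⟩ : O)) ∈ 𝒢'.U :=
      (hsh.2.2.2.1 _ _).2 ⟨h5, by rw [h6]; exact z.2⟩
    exact ⟨h7, Subtype.ext ((hsh.coe_m h7).trans h6)⟩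

/-- Arrows of the shrinking are connected to units inside target fibres, hence are products of
small arrows. -/
theorem exists_invertible (hF : 𝒢.IsFineShrinking 𝒢') (h3 : 𝒢.IsThreeAssociative) (g : O) :
    ∃ L : List O, (∀ v ∈ L, v ∈ 𝒢'.V) ∧ 𝒢'.Rep L (𝒢'.toCompletion (𝒢'.letter g)) := by
  have hsh := hF.shrinksTo
  obtain ⟨γ, hγ⟩ := hF.exists_path (𝒢'.u (𝒢'.t g)) g (𝒢'.unit_left_mem g)
  set Q : O → Prop := fun g => ∃ L : List O, (∀ v ∈ L, v ∈ 𝒢'.V) ∧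
    𝒢'.Rep L (𝒢'.toCompletion (𝒢'.letter g)) with hQ
  -- passing from `a` to `b = a (a⁻¹ b)`
  have step : ∀ a b c : O, 𝒢.t a = 𝒢.t b → (c : G) = 𝒢.m (𝒢.i a) b → c ∈ 𝒢'.V →
      ((a : G), (c : G)) ∈ 𝒢.U → Q a → Q b := by
    rintro a b c hab hc hcV hacU ⟨L, hL, hr⟩
    have e : 𝒢.m a c = b := by
      rw [hc]
      rw [hc] at hacU
      exact h3.m_i_m_cancel (hF.mem_V a) (hF.left_mem_U a b hab) hacU
    have hU : (a, c) ∈ 𝒢'.U := (hsh.2.2.2.1 _ _).2 ⟨hacU, by rw [e]; exact b.2⟩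
    have e' : 𝒢'.m a c = b := Subtype.ext ((hsh.coe_m hU).trans e)
    refine ⟨L ++ [c], ?_, ?_⟩
    · simp only [List.mem_append, List.mem_singleton]
      rintro v (hv | rfl)
      exacts [hL v hv, hcV]
    · have h1 : 𝒢'.Rep ([] ++ [a] ++ [c]) (𝒢'.toCompletion (𝒢'.letter b)) := by
        have := (ListContracts.rep_iff (⟨[], a, c, [], hU, rfl, rfl⟩ : 𝒢'.ListContracts _ _)
          (p := 𝒢'.toCompletion (𝒢'.letter b))).2 (by rw [e']; exact rep_singleton b)
        exact this
      exact (Rep.congr_append (rep_singleton a) hr (K := []) (K' := [c])).1 h1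
  -- The property `Q` is locally constant along `γ`, since `a⁻¹ b` is small for `a` and `b` close.
  have hloc : ∀ τ₀, ∀ᶠ τ in 𝓝 τ₀, Q (γ τ) = Q (γ τ₀) := by
    intro τ₀
    set a : O := γ τ₀ with ha
    have hγc : ContinuousAt (fun τ => (γ τ : G)) τ₀ :=
      (continuous_subtype_val.comp γ.continuous).continuousAt
    have haV := hF.mem_V a
    have hiγ : ContinuousAt (fun τ => 𝒢.i (γ τ)) τ₀ :=
      ((𝒢.contMDiffOn_i _ haV).contMDiffAt (𝒢.isOpen_V.mem_nhds haV)).continuousAt.comp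
        (f := fun τ => (γ τ : G)) hγc
    have ht : ∀ τ, 𝒢.t (γ τ) = 𝒢.t a := fun τ => by
      rw [← hsh.2.1, ← hsh.2.1, (hγ τ).1, (hγ τ₀).1]
    have hV' : IsOpen ((Subtype.val : O → G) '' 𝒢'.V) :=
      O.isOpen.isOpenEmbedding_subtypeVal.isOpenMap _ 𝒢'.isOpen_V
    have huV' : 𝒢.u (𝒢.s a) ∈ (Subtype.val : O → G) '' 𝒢'.V :=
      ⟨_, 𝒢'.u_mem_V _, hsh.2.2.1 _⟩
    have key : ∀ f₁ f₂ : unitInterval → O, ContinuousAt (fun τ => (f₁ τ : G)) τ₀ →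
        ContinuousAt (fun τ => 𝒢.i (f₁ τ)) τ₀ → ContinuousAt (fun τ => (f₂ τ : G)) τ₀ →
        f₁ τ₀ = a → f₂ τ₀ = a → (∀ τ, 𝒢.t (f₁ τ) = 𝒢.t (f₂ τ)) →
        ∀ᶠ τ in 𝓝 τ₀, Q (f₁ τ) → Q (f₂ τ) := by
      intro f₁ f₂ hf₁ hif₁ hf₂ e1 e2 htt
      have hst : ∀ᶠ τ in 𝓝[univ] τ₀, 𝒢.s (𝒢.i (f₁ τ)) = 𝒢.t (f₂ τ) :=
        Eventually.of_forall fun τ => by rw [𝒢.s_i _ (hF.mem_V _), htt]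
      have hU0 : (𝒢.i (f₁ τ₀), (f₂ τ₀ : G)) ∈ 𝒢.U := hF.left_mem_U _ _ (htt τ₀)
      have hm0 : 𝒢.m (𝒢.i (f₁ τ₀)) (f₂ τ₀) = 𝒢.u (𝒢.s a) := by
        rw [e1, e2, 𝒢.i_m _ haV]
      have hm := 𝒢.continuousWithinAt_m hif₁.continuousWithinAt hf₂.continuousWithinAt hst hU0
      rw [continuousWithinAt_univ] at hm
      have h1 : ∀ᶠ τ in 𝓝 τ₀, 𝒢.m (𝒢.i (f₁ τ)) (f₂ τ) ∈ (Subtype.val : O → G) '' 𝒢'.V :=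
        hm.eventually (hV'.mem_nhds
          (show 𝒢.m (𝒢.i (f₁ τ₀)) (f₂ τ₀) ∈ _ by rw [hm0]; exact huV'))
      have h2 := (hf₁.prodMk hm).eventually
        (𝒢.eventually_mem_U (p := ((f₁ τ₀ : G), 𝒢.m (𝒢.i (f₁ τ₀)) (f₂ τ₀)))
          (by rw [hm0, e1]; exact 𝒢.unit_right_mem _))
      filter_upwards [h1, h2] with τ h1 h2 hQτ
      obtain ⟨c, hcV, hc⟩ := h1
      refine step (f₁ τ) (f₂ τ) c (htt τ) hc hcV ?_ hQτ
      rw [hc]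
      refine h2 ?_
      rw [𝒢.t_m _ _ (hF.left_mem_U _ _ (htt τ)), 𝒢.t_i _ (hF.mem_V _)]
    have hic : ContinuousAt (fun _ : unitInterval => 𝒢.i a) τ₀ := continuousAt_const
    filter_upwards [key γ (fun _ => a) hγc hiγ continuousAt_const rfl rfl ht,
      key (fun _ => a) γ continuousAt_const hic hγc rfl rfl fun τ => (ht τ).symm] with τ h1 h2
    exact propext ⟨h1, h2⟩
  have hconst := (IsLocallyConstant.iff_eventually_eq (fun τ => Q (γ τ))).2 hloc
  have h01 : Q (γ 0) = Q (γ 1) := hconst.apply_eq_of_preconnectedSpace 0 1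
  rw [γ.source, γ.target] at h01
  refine (h01 ▸ ?_ : Q g)
  refine ⟨[_], fun v hv => ?_, rep_singleton _⟩
  rw [List.mem_singleton.1 hv]
  exact 𝒢'.u_mem_V _

theorem isCompletable [IsManifold (𝓡 n) ∞ M] [IsManifold (𝓡 k) ∞ G]
    (hF : 𝒢.IsFineShrinking 𝒢') (h3 : 𝒢.IsThreeAssociative) : 𝒢'.IsCompletable :=
  ⟨hF.exists_section h3, hF.letter_injective h3, hF.exists_invertible h3⟩

end IsFineShrinking

end LocalLieGroupoid

/-! ### The groupoid structure of the associative completion -/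

namespace LocalLieGroupoid

variable {n k : ℕ} {M : Type u} [TopologicalSpace M] [ChartedSpace (EuclideanSpace ℝ (Fin n)) M]
  {G : Type v} [TopologicalSpace G] [ChartedSpace (EuclideanSpace ℝ (Fin k)) G]
  {𝒢 : LocalLieGroupoid n k M G}

theorem Contracts.wordSource_eq {w w' : 𝒢.Word} (h : 𝒢.Contracts w w') :
    𝒢.wordSource w = 𝒢.wordSource w' := by
  have key : ∀ w : 𝒢.Word, (𝒢.toList w).getLast?.map 𝒢.s = some (𝒢.wordSource w) := fun w => by
    rw [toList, List.ofFn_succ', List.concat_eq_append, List.getLast?_concat]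
    rfl
  have := (contracts_iff.1 h).map_s_getLast?
  rwa [key, key, Option.some.injEq] at this

theorem Contracts.wordTarget_eq {w w' : 𝒢.Word} (h : 𝒢.Contracts w w') :
    𝒢.wordTarget w = 𝒢.wordTarget w' := by
  have key : ∀ w : 𝒢.Word, (𝒢.toList w).head?.map 𝒢.t = some (𝒢.wordTarget w) := fun w => by
    rw [toList, List.ofFn_succ]
    rfl
  have := (contracts_iff.1 h).map_t_head?
  rwa [key, key, Option.some.injEq] at this

/-- The source map of the associative completion. -/
def src : 𝒢.AssocCompletion → M := Quot.lift 𝒢.wordSource fun _ _ h => h.wordSource_eq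

/-- The target map of the associative completion. -/
def tgt : 𝒢.AssocCompletion → M := Quot.lift 𝒢.wordTarget fun _ _ h => h.wordTarget_eq

/-- The class of the word consisting of a single arrow. -/
def ofArrow (g : G) : 𝒢.AssocCompletion := 𝒢.toCompletion (𝒢.letter g)

theorem rep_ofArrow (g : G) : 𝒢.Rep [g] (ofArrow g) := rep_singleton g

theorem Rep.src_eq {L : List G} {a : G} {p : 𝒢.AssocCompletion} (h : 𝒢.Rep (L ++ [a]) p) :
    src p = 𝒢.s a := by
  obtain ⟨w, hw, rfl⟩ := h
  exact wordSource_eq hw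

theorem Rep.tgt_eq {L : List G} {a : G} {p : 𝒢.AssocCompletion} (h : 𝒢.Rep (a :: L) p) :
    tgt p = 𝒢.t a := by
  obtain ⟨w, hw, rfl⟩ := h
  exact wordTarget_eq hw

@[simp] theorem src_ofArrow (g : G) : src (ofArrow g : 𝒢.AssocCompletion) = 𝒢.s g := rfl

@[simp] theorem tgt_ofArrow (g : G) : tgt (ofArrow g : 𝒢.AssocCompletion) = 𝒢.t g := rfl

theorem isWord_append {L L' : List G} {p q : 𝒢.AssocCompletion} (h : 𝒢.Rep L p)
    (h' : 𝒢.Rep L' q) (hpq : src p = tgt q) : 𝒢.IsWord (L ++ L') := by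
  have hw := h.isWord
  have hw' := h'.isWord
  refine ⟨by simp [hw.1], List.isChain_append.2 ⟨hw.2, hw'.2, fun a ha b hb => ?_⟩⟩
  obtain ⟨K, rfl⟩ := List.getLast?_eq_some_iff.1 ha
  obtain ⟨K', rfl⟩ := List.head?_eq_some_iff.1 hb
  rw [← h.src_eq, ← h'.tgt_eq, hpq]

/-- The product of the associative completion, with value `p` if `p` and `q` are not composable. -/
def mul (p q : 𝒢.AssocCompletion) : 𝒢.AssocCompletion :=
  open Classical in
  if h : ∃ r, ∃ L L', 𝒢.Rep L p ∧ 𝒢.Rep L' q ∧ 𝒢.Rep (L ++ L') r then h.choose else p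

theorem Rep.mul_rep {L L' : List G} {p q : 𝒢.AssocCompletion} (h : 𝒢.Rep L p)
    (h' : 𝒢.Rep L' q) (hpq : src p = tgt q) : 𝒢.Rep (L ++ L') (mul p q) := by
  have hex : ∃ r, ∃ L L', 𝒢.Rep L p ∧ 𝒢.Rep L' q ∧ 𝒢.Rep (L ++ L') r := by
    obtain ⟨r, hr⟩ := exists_rep_of_isWord (isWord_append h h' hpq)
    exact ⟨r, L, L', h, h', hr⟩
  rw [LocalLieGroupoid.mul, dif_pos hex]
  obtain ⟨K, K', h1, h2, h3⟩ := hex.choose_spec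
  have h4 := (Rep.congr_append h1 h (K := []) (K' := K')).1 (by simpa using h3)
  have h5 := (Rep.congr_append h2 h' (K := L) (K' := [])).1 (by simpa using h4)
  simpa using h5

variable {p q r : 𝒢.AssocCompletion}

theorem Rep.ne_nil {L : List G} (h : 𝒢.Rep L p) : L ≠ [] := h.isWord.1

theorem src_mul (h : src p = tgt q) : src (mul p q) = src q := by
  obtain ⟨L, hL⟩ := exists_rep p
  obtain ⟨L', hL'⟩ := exists_rep q
  obtain ⟨K, a, rfl⟩ : ∃ K a, L' = K ++ [a] :=
    ⟨_, _, (List.dropLast_append_getLast hL'.ne_nil).symm⟩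
  have := hL.mul_rep hL' h
  rw [← List.append_assoc] at this
  rw [this.src_eq, hL'.src_eq]

theorem tgt_mul (h : src p = tgt q) : tgt (mul p q) = tgt p := by
  obtain ⟨L, hL⟩ := exists_rep p
  obtain ⟨L', hL'⟩ := exists_rep q
  obtain ⟨a, K, rfl⟩ : ∃ a K, L = a :: K := List.exists_cons_of_ne_nil hL.ne_nil
  rw [(hL.mul_rep hL' h : 𝒢.Rep (a :: (K ++ L')) _).tgt_eq, hL.tgt_eq]

theorem mul_assoc' (h : src p = tgt q) (h' : src q = tgt r) :
    mul (mul p q) r = mul p (mul q r) := by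
  obtain ⟨L, hL⟩ := exists_rep p
  obtain ⟨L', hL'⟩ := exists_rep q
  obtain ⟨L'', hL''⟩ := exists_rep r
  have h1 := (hL.mul_rep hL' h).mul_rep hL'' ((src_mul h).trans h')
  have h2 := hL.mul_rep (hL'.mul_rep hL'' h') (h.trans (tgt_mul h').symm)
  rw [List.append_assoc] at h1
  exact h1.unique h2

theorem mul_ofArrow {g h : G} (hU : (g, h) ∈ 𝒢.U) :
    mul (ofArrow g) (ofArrow h) = (ofArrow (𝒢.m g h) : 𝒢.AssocCompletion) := by
  have h1 := (rep_ofArrow (𝒢 := 𝒢) g).mul_rep (rep_ofArrow h) (𝒢.mem_U_s_eq_t hU)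
  exact ((listReduces_pair hU).rep_iff.1 h1).unique (rep_ofArrow _)

theorem mul_unit (p : 𝒢.AssocCompletion) : mul p (ofArrow (𝒢.u (src p))) = p := by
  obtain ⟨L, hL⟩ := exists_rep p
  obtain ⟨K, a, rfl⟩ : ∃ K a, L = K ++ [a] :=
    ⟨_, _, (List.dropLast_append_getLast hL.ne_nil).symm⟩
  have h1 := hL.mul_rep (rep_ofArrow (𝒢.u (src p))) (by simp [𝒢.t_u])
  have h2 : 𝒢.ListContracts (K ++ [a] ++ [𝒢.u (src p)]) (K ++ [a]) := by
    rw [hL.src_eq]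
    exact ⟨K, a, _, [], 𝒢.unit_right_mem a, by simp, by rw [𝒢.m_unit]⟩
  exact (h2.rep_iff.1 h1).unique hL

theorem unit_mul (p : 𝒢.AssocCompletion) : mul (ofArrow (𝒢.u (tgt p))) p = p := by
  obtain ⟨L, hL⟩ := exists_rep p
  obtain ⟨a, K, rfl⟩ : ∃ a K, L = a :: K := List.exists_cons_of_ne_nil hL.ne_nil
  have h1 := (rep_ofArrow (𝒢.u (tgt p))).mul_rep hL (by simp [𝒢.s_u])
  have h2 : 𝒢.ListContracts ([𝒢.u (tgt p)] ++ a :: K) (a :: K) := by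
    rw [hL.tgt_eq]
    exact ⟨[], _, a, K, 𝒢.unit_left_mem a, by simp, by rw [𝒢.unit_m]; rfl⟩
  exact (h2.rep_iff.1 h1).unique hL

/-- The reversed word of the inverses of the letters represents an inverse. -/
theorem Rep.reverse_inv : ∀ {L : List G} {p : 𝒢.AssocCompletion}, 𝒢.Rep L p →
    (∀ v ∈ L, v ∈ 𝒢.V) → ∃ q, 𝒢.Rep (L.map 𝒢.i).reverse q ∧ src q = tgt p ∧ tgt q = src p ∧
      mul q p = ofArrow (𝒢.u (src p)) ∧ mul p q = ofArrow (𝒢.u (tgt p)) := by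
  intro L
  induction L with
  | nil => exact fun h => absurd rfl h.ne_nil
  | cons a L ih =>
    intro p hp hV
    have haV := hV a (by simp)
    cases L with
    | nil =>
      obtain rfl : p = ofArrow a := hp.unique (rep_ofArrow a)
      refine ⟨ofArrow (𝒢.i a), rep_ofArrow _, 𝒢.s_i _ haV, 𝒢.t_i _ haV, ?_, ?_⟩
      · rw [mul_ofArrow (𝒢.i_m_mem_U haV), 𝒢.i_m _ haV, src_ofArrow]
      · rw [mul_ofArrow (𝒢.m_i_mem_U haV), 𝒢.m_i _ haV, tgt_ofArrow]
    | cons b L =>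
      have hw : 𝒢.IsWord (b :: L) := ⟨by simp, (List.isChain_cons_cons.1 hp.isWord.2).2⟩
      obtain ⟨p', hp'⟩ := exists_rep_of_isWord hw
      obtain ⟨q', hq', e1, e2, e3, e4⟩ := ih hp' fun v hv => hV v (List.mem_cons_of_mem _ hv)
      have hst : src (ofArrow a : 𝒢.AssocCompletion) = tgt p' := by
        rw [hp'.tgt_eq]; exact (List.isChain_cons_cons.1 hp.isWord.2).1
      obtain rfl : p = mul (ofArrow a) p' := hp.unique ((rep_ofArrow a).mul_rep hp' hst)
      have hst' : src q' = tgt (ofArrow (𝒢.i a) : 𝒢.AssocCompletion) := by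
        rw [e1, ← hst]; exact (𝒢.t_i _ haV).symm
      have hsti : src (ofArrow (𝒢.i a) : 𝒢.AssocCompletion) =
        tgt (ofArrow a : 𝒢.AssocCompletion) := 𝒢.s_i _ haV
      refine ⟨mul q' (ofArrow (𝒢.i a)), ?_, ?_, ?_, ?_, ?_⟩
      · simpa using hq'.mul_rep (rep_ofArrow (𝒢.i a)) hst'
      · rw [src_mul hst', tgt_mul hst, src_ofArrow, tgt_ofArrow, 𝒢.s_i _ haV]
      · rw [tgt_mul hst', src_mul hst, e2]
      · rw [mul_assoc' hst' (by rw [tgt_mul hst, src_ofArrow, tgt_ofArrow, 𝒢.s_i _ haV]),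
          ← mul_assoc' hsti hst, mul_ofArrow (𝒢.i_m_mem_U haV), 𝒢.i_m _ haV, src_mul hst]
        have : 𝒢.s a = tgt p' := hst
        rw [this, unit_mul, e3]
      · have h1 : src p' = tgt (mul q' (ofArrow (𝒢.i a))) := by rw [tgt_mul hst', e2]
        have h2 : tgt p' = tgt (ofArrow (𝒢.i a) : 𝒢.AssocCompletion) := by rw [← hst', e1]
        rw [mul_assoc' hst h1, ← mul_assoc' e2.symm hst', e4, h2, unit_mul,
          mul_ofArrow (𝒢.m_i_mem_U haV), 𝒢.m_i _ haV, tgt_mul hst, tgt_ofArrow]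

/-- Every element of the completion is represented by a word of invertible arrows. -/
theorem IsCompletable.exists_rep_mem_V (hC : 𝒢.IsCompletable) (p : 𝒢.AssocCompletion) :
    ∃ L, (∀ v ∈ L, v ∈ 𝒢.V) ∧ 𝒢.Rep L p := by
  obtain ⟨L, hL⟩ := exists_rep p
  induction L generalizing p with
  | nil => exact absurd rfl hL.ne_nil
  | cons a L ih =>
    obtain ⟨K, hKV, hK⟩ := hC.exists_invertible a
    cases L with
    | nil =>
      obtain rfl : p = ofArrow a := hL.unique (rep_ofArrow a)
      exact ⟨K, hKV, hK⟩
    | cons b L =>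
      have hw : 𝒢.IsWord (b :: L) := ⟨by simp, (List.isChain_cons_cons.1 hL.isWord.2).2⟩
      obtain ⟨p', hp'⟩ := exists_rep_of_isWord hw
      obtain ⟨K', hKV', hK'⟩ := ih p' hp'
      have hst : src (ofArrow a : 𝒢.AssocCompletion) = tgt p' := by
        rw [hp'.tgt_eq]; exact (List.isChain_cons_cons.1 hL.isWord.2).1
      obtain rfl : p = mul (ofArrow a) p' := hL.unique ((rep_ofArrow a).mul_rep hp' hst)
      refine ⟨K ++ K', fun v hv => ?_, Rep.mul_rep hK hK' hst⟩
      rcases List.mem_append.1 hv with h | h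
      exacts [hKV v h, hKV' v h]

/-- The inversion of the associative completion, with value `p` if `p` has no inverse. -/
def inv (p : 𝒢.AssocCompletion) : 𝒢.AssocCompletion :=
  open Classical in
  if h : ∃ q, src q = tgt p ∧ tgt q = src p ∧ mul q p = ofArrow (𝒢.u (src p)) ∧
    mul p q = ofArrow (𝒢.u (tgt p)) then h.choose else p

theorem IsCompletable.inv_spec (hC : 𝒢.IsCompletable) (p : 𝒢.AssocCompletion) :
    src (inv p) = tgt p ∧ tgt (inv p) = src p ∧ mul (inv p) p = ofArrow (𝒢.u (src p)) ∧
      mul p (inv p) = ofArrow (𝒢.u (tgt p)) := by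
  have h : ∃ q, src q = tgt p ∧ tgt q = src p ∧ mul q p = ofArrow (𝒢.u (src p)) ∧
      mul p q = ofArrow (𝒢.u (tgt p)) := by
    obtain ⟨L, hV, hL⟩ := hC.exists_rep_mem_V p
    obtain ⟨q, -, hq⟩ := hL.reverse_inv hV
    exact ⟨q, hq⟩
  rw [inv, dif_pos h]
  exact h.choose_spec

theorem IsCompletable.eq_inv (hC : 𝒢.IsCompletable) (h1 : src q = tgt p)
    (h : mul q p = ofArrow (𝒢.u (src p))) : q = inv p := by
  obtain ⟨a1, a2, a3, a4⟩ := hC.inv_spec p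
  have h2 := mul_assoc' h1 a2.symm
  rw [h, a4, ← h1, mul_unit, ← a2, unit_mul] at h2
  exact h2.symm

theorem IsCompletable.rep_inv (hC : 𝒢.IsCompletable) {L : List G} (h : 𝒢.Rep L p)
    (hV : ∀ v ∈ L, v ∈ 𝒢.V) : 𝒢.Rep (L.map 𝒢.i).reverse (inv p) := by
  obtain ⟨q, hq, h1, -, h2, -⟩ := h.reverse_inv hV
  rwa [hC.eq_inv h1 h2] at hq

theorem IsCompletable.mul_inv_mul (hC : 𝒢.IsCompletable) (h : src p = src q) :
    mul (mul p (inv q)) q = p := by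
  obtain ⟨a1, a2, a3, a4⟩ := hC.inv_spec q
  rw [mul_assoc' (h.trans a2.symm) a1, a3, ← h, mul_unit]

theorem IsCompletable.mul_mul_inv (hC : 𝒢.IsCompletable) (h : src p = tgt q) :
    mul (mul p q) (inv q) = p := by
  obtain ⟨a1, a2, a3, a4⟩ := hC.inv_spec q
  rw [mul_assoc' h a2.symm, a4, ← h, mul_unit]

theorem IsCompletable.mul_inv_cancel_left (hC : 𝒢.IsCompletable) (h : tgt p = tgt q) :
    mul p (mul (inv p) q) = q := by
  obtain ⟨a1, a2, a3, a4⟩ := hC.inv_spec p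
  rw [← mul_assoc' a2.symm (a1.trans h), a4, h, unit_mul]

end LocalLieGroupoid

/-! ### Word-smooth families -/

namespace LocalLieGroupoid

variable {n k : ℕ} {M : Type u} [TopologicalSpace M] [ChartedSpace (EuclideanSpace ℝ (Fin n)) M]
  {G : Type v} [TopologicalSpace G] [ChartedSpace (EuclideanSpace ℝ (Fin k)) G]
  {𝒢 : LocalLieGroupoid n k M G}

variable {E H : Type*} [NormedAddCommGroup E] [NormedSpace ℝ E] [TopologicalSpace H]
  {I : ModelWithCorners ℝ E H} {P : Type*} [TopologicalSpace P] [ChartedSpace H P]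
  {E' H' : Type*} [NormedAddCommGroup E'] [NormedSpace ℝ E'] [TopologicalSpace H']
  {I' : ModelWithCorners ℝ E' H'} {Q : Type*} [TopologicalSpace Q] [ChartedSpace H' Q]

variable (I) in
/-- The letters `L` are smooth at `p₀` within `S`, and represent `f` near `p₀`. -/
def IsLocalRep (L : List (P → G)) (f : P → 𝒢.AssocCompletion) (S : Set P) (p₀ : P) : Prop :=
  (∀ a ∈ L, ContMDiffWithinAt I (𝓡 k) ∞ a S p₀) ∧
    ∀ᶠ p in 𝓝[S] p₀, 𝒢.Rep (L.map fun a => a p) (f p)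

variable (I) in
/-- A family of elements of the associative completion is word-smooth within `S` at `p₀ ∈ S` if it
is represented near `p₀` by words with smooth letters. -/
def WordSmooth (f : P → 𝒢.AssocCompletion) (S : Set P) (p₀ : P) : Prop :=
  p₀ ∈ S ∧ ∃ L : List (P → G), IsLocalRep I L f S p₀

variable {f f' : P → 𝒢.AssocCompletion} {S : Set P} {p₀ : P}

theorem eventually_s_eq_t_of_rep {Lpre Lpost : List (P → G)} {A B : P → G}
    (h : ∀ᶠ p in 𝓝[S] p₀, 𝒢.Rep ((Lpre ++ A :: B :: Lpost).map fun a => a p) (f p)) :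
    ∀ᶠ p in 𝓝[S] p₀, 𝒢.s (A p) = 𝒢.t (B p) := by
  filter_upwards [h] with p hp
  have := hp.isWord.2
  rw [List.map_append, List.map_cons, List.map_cons, List.isChain_append_cons_cons] at this
  exact this.2.1

/-- A smooth contraction or expansion of letters at one point extends to the nearby points. -/
theorem IsCompletable.isLocalRep_iff (hC : 𝒢.IsCompletable) {K K' : List G}
    (hK : 𝒢.ListContracts K K') :
    (∃ L : List (P → G), (L.map fun a => a p₀) = K ∧ IsLocalRep I L f S p₀) ↔
      ∃ L : List (P → G), (L.map fun a => a p₀) = K' ∧ IsLocalRep I L f S p₀ := by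
  obtain ⟨pre, a, b, post, hU, rfl, rfl⟩ := hK
  constructor
  · rintro ⟨L, hL, hs, hr⟩
    obtain ⟨Lpre, L₁, rfl, rfl, h1⟩ := List.map_eq_append_iff.1 hL
    obtain ⟨A, L₂, rfl, rfl, h2⟩ := List.map_eq_cons_iff.1 h1
    obtain ⟨B, Lpost, rfl, rfl, rfl⟩ := List.map_eq_cons_iff.1 h2
    have hst := eventually_s_eq_t_of_rep hr
    have hA := hs A (by simp)
    have hB := hs B (by simp)
    refine ⟨Lpre ++ (fun p => 𝒢.m (A p) (B p)) :: Lpost, by simp, ?_, ?_⟩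
    · intro c hc
      rcases List.mem_append.1 hc with hc | hc
      · exact hs c (by simp [hc])
      · rcases List.mem_cons.1 hc with rfl | hc
        · exact 𝒢.contMDiffWithinAt_m hA hB hst hU
        · exact hs c (by simp [hc])
    · filter_upwards [hr, 𝒢.eventually_mem_U_within hA.continuousWithinAt hB.continuousWithinAt
        hst hU] with p h3 h4
      refine (ListContracts.rep_iff ⟨Lpre.map fun a => a p, A p, B p, Lpost.map fun a => a p, h4,
        ?_, ?_⟩).1 h3 <;> simp
  · rintro ⟨L, hL, hs, hr⟩
    obtain ⟨Lpre, L₁, rfl, rfl, h1⟩ := List.map_eq_append_iff.1 hL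
    obtain ⟨Z, Lpost, rfl, hZ, rfl⟩ := List.map_eq_cons_iff.1 h1
    obtain ⟨α, β, hα, hβ, hαs, hβs, hαβ⟩ := hC.exists_section a b hU
    have hZs := hs Z (by simp)
    rw [← hZ] at hα hβ hαs hβs hαβ
    refine ⟨Lpre ++ (fun p => α (Z p)) :: (fun p => β (Z p)) :: Lpost, by simp [hα, hβ], ?_, ?_⟩
    · intro c hc
      simp only [List.mem_append, List.mem_cons] at hc
      rcases hc with hc | rfl | rfl | hc
      · exact hs c (by simp [hc])
      · exact hαs.comp_contMDiffWithinAt p₀ hZs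
      · exact hβs.comp_contMDiffWithinAt p₀ hZs
      · exact hs c (by simp [hc])
    · filter_upwards [hr, hZs.continuousWithinAt.eventually hαβ] with p h3 h4
      refine (ListContracts.rep_iff ⟨Lpre.map fun a => a p, α (Z p), β (Z p),
        Lpost.map fun a => a p, h4.1, ?_, ?_⟩).2 h3 <;> simp [h4.2]

/-- A word-smooth family can be represented near `p₀` by smooth letters whose values at `p₀` are
those of any given word representing its value at `p₀`. -/
theorem WordSmooth.exists_isLocalRep (hC : 𝒢.IsCompletable) (hf : WordSmooth I f S p₀)
    {K : List G} (hK : 𝒢.Rep K (f p₀)) :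
    ∃ L : List (P → G), (L.map fun a => a p₀) = K ∧ IsLocalRep I L f S p₀ := by
  obtain ⟨hp₀, L, hL⟩ := hf
  have h0 := hL.2.self_of_nhdsWithin hp₀
  have key : ∀ {K K' : List G}, Relation.EqvGen 𝒢.ListContracts K K' →
      ((∃ L : List (P → G), (L.map fun a => a p₀) = K ∧ IsLocalRep I L f S p₀) ↔
      ∃ L : List (P → G), (L.map fun a => a p₀) = K' ∧ IsLocalRep I L f S p₀) := by
    intro K K' h
    induction h with
    | rel _ _ h => exact hC.isLocalRep_iff h
    | refl => rfl
    | symm _ _ _ ih => exact ih.symm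
    | trans _ _ _ _ _ ih1 ih2 => exact ih1.trans ih2
  exact (key (h0.eqvGen hK)).1 ⟨L, rfl, hL⟩

theorem WordSmooth.ofArrow {a : P → G} (hp₀ : p₀ ∈ S) (ha : ContMDiffWithinAt I (𝓡 k) ∞ a S p₀) :
    WordSmooth I (fun p => (ofArrow (a p) : 𝒢.AssocCompletion)) S p₀ :=
  ⟨hp₀, [a], by simpa using ha, Eventually.of_forall fun p => rep_ofArrow _⟩

theorem WordSmooth.congr (hf : WordSmooth I f S p₀) (h : ∀ᶠ p in 𝓝[S] p₀, f' p = f p) :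
    WordSmooth I f' S p₀ := by
  obtain ⟨hp₀, L, h1, h2⟩ := hf
  refine ⟨hp₀, L, h1, ?_⟩
  filter_upwards [h, h2] with p h3 h4
  rwa [h3]

theorem WordSmooth.mul (hf : WordSmooth I f S p₀) (hf' : WordSmooth I f' S p₀)
    (h : ∀ᶠ p in 𝓝[S] p₀, src (f p) = tgt (f' p)) :
    WordSmooth I (fun p => LocalLieGroupoid.mul (f p) (f' p)) S p₀ := by
  obtain ⟨hp₀, L, h1, h2⟩ := hf
  obtain ⟨-, L', h1', h2'⟩ := hf'
  refine ⟨hp₀, L ++ L', fun a ha => (List.mem_append.1 ha).elim (h1 a) (h1' a), ?_⟩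
  filter_upwards [h, h2, h2'] with p h3 h4 h5
  rw [List.map_append]
  exact h4.mul_rep h5 h3

theorem WordSmooth.comp {g : Q → P} {T : Set Q} {q₀ : Q} (hf : WordSmooth I f S (g q₀))
    (hq₀ : q₀ ∈ T) (hg : ContMDiffWithinAt I' I ∞ g T q₀) (hT : MapsTo g T S) :
    WordSmooth I' (fun q => f (g q)) T q₀ := by
  obtain ⟨-, L, h1, h2⟩ := hf
  refine ⟨hq₀, L.map fun a => a ∘ g, fun a ha => ?_, ?_⟩
  · obtain ⟨b, hb, rfl⟩ := List.mem_map.1 ha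
    exact (h1 b hb).comp q₀ hg hT
  · filter_upwards [(hg.continuousWithinAt.tendsto_nhdsWithin hT).eventually h2] with q hq
    simpa [Function.comp_def] using hq

theorem WordSmooth.src (hf : WordSmooth I f S p₀) :
    ContMDiffWithinAt I (𝓡 n) ∞ (fun p => src (f p)) S p₀ := by
  obtain ⟨hp₀, L, h1, h2⟩ := hf
  have hne : L ≠ [] := by simpa using (h2.self_of_nhdsWithin hp₀).ne_nil
  obtain ⟨K, a, rfl⟩ : ∃ K a, L = K ++ [a] := ⟨_, _, (List.dropLast_append_getLast hne).symm⟩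
  have h3 : ContMDiffWithinAt I (𝓡 n) ∞ (fun p => 𝒢.s (a p)) S p₀ :=
    𝒢.contMDiff_s.contMDiffAt.comp_contMDiffWithinAt p₀ (h1 a (by simp))
  have h4 : ∀ᶠ p in 𝓝[S] p₀, LocalLieGroupoid.src (f p) = 𝒢.s (a p) := by
    filter_upwards [h2] with p hp
    rw [List.map_append] at hp
    exact hp.src_eq
  exact h3.congr_of_eventuallyEq h4 (h4.self_of_nhdsWithin hp₀)

theorem WordSmooth.tgt (hf : WordSmooth I f S p₀) :
    ContMDiffWithinAt I (𝓡 n) ∞ (fun p => tgt (f p)) S p₀ := by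
  obtain ⟨hp₀, L, h1, h2⟩ := hf
  have hne : L ≠ [] := by simpa using (h2.self_of_nhdsWithin hp₀).ne_nil
  obtain ⟨a, K, rfl⟩ : ∃ a K, L = a :: K := List.exists_cons_of_ne_nil hne
  have h3 : ContMDiffWithinAt I (𝓡 n) ∞ (fun p => 𝒢.t (a p)) S p₀ :=
    𝒢.contMDiff_t.contMDiffAt.comp_contMDiffWithinAt p₀ (h1 a (by simp))
  have h4 : ∀ᶠ p in 𝓝[S] p₀, LocalLieGroupoid.tgt (f p) = 𝒢.t (a p) := by
    filter_upwards [h2] with p hp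
    exact hp.tgt_eq
  exact h3.congr_of_eventuallyEq h4 (h4.self_of_nhdsWithin hp₀)

/-- The letters may be chosen to be invertible at `p₀`, and are then invertible nearby. -/
theorem WordSmooth.inv (hC : 𝒢.IsCompletable) (hf : WordSmooth I f S p₀) :
    WordSmooth I (fun p => inv (f p)) S p₀ := by
  obtain ⟨K, hKV, hK⟩ := hC.exists_rep_mem_V (f p₀)
  obtain ⟨L, rfl, h1, h2⟩ := hf.exists_isLocalRep hC hK
  have hV : ∀ a ∈ L, a p₀ ∈ 𝒢.V := fun a ha => hKV _ (List.mem_map.2 ⟨a, ha, rfl⟩)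
  refine ⟨hf.1, (L.map fun a => 𝒢.i ∘ a).reverse, fun a ha => ?_, ?_⟩
  · obtain ⟨b, hb, rfl⟩ := List.mem_map.1 (List.mem_reverse.1 ha)
    exact ((𝒢.contMDiffOn_i _ (hV b hb)).contMDiffAt
      (𝒢.isOpen_V.mem_nhds (hV b hb))).comp_contMDiffWithinAt p₀ (h1 b hb)
  · have h3 : ∀ᶠ p in 𝓝[S] p₀, ∀ a ∈ L, a p ∈ 𝒢.V := by
      have : ∀ᶠ p in 𝓝[S] p₀, ∀ a ∈ {a | a ∈ L}, a p ∈ 𝒢.V :=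
        (eventually_all_finite L.finite_toSet).2 fun a ha =>
          (h1 a ha).continuousWithinAt.eventually (𝒢.isOpen_V.mem_nhds (hV a ha))
      exact this
    filter_upwards [h2, h3] with p h4 h5
    have := hC.rep_inv h4 (by simpa using h5)
    simpa [Function.comp_def] using this

/-- A word-smooth family is given by a single smooth letter near each point where its value is the
class of a letter. -/
theorem WordSmooth.exists_ofArrow (hC : 𝒢.IsCompletable) (hf : WordSmooth I f S p₀) {g : G}
    (hg : f p₀ = LocalLieGroupoid.ofArrow g) :
    ∃ a : P → G, a p₀ = g ∧ ContMDiffWithinAt I (𝓡 k) ∞ a S p₀ ∧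
      ∀ᶠ p in 𝓝[S] p₀, f p = LocalLieGroupoid.ofArrow (a p) := by
  obtain ⟨L, hL, h1, h2⟩ := hf.exists_isLocalRep hC (hg ▸ rep_ofArrow g)
  obtain ⟨a, L', rfl, rfl, hL'⟩ := List.map_eq_cons_iff.1 hL
  obtain rfl := List.map_eq_nil_iff.1 hL'
  refine ⟨a, rfl, h1 a (by simp), ?_⟩
  filter_upwards [h2] with p hp using hp.unique (rep_ofArrow _)

/-- The completion has the quotient topology from the space of words, and a word-smooth family
lifts to words of constant length with continuous letters. -/
theorem WordSmooth.continuousWithinAt (hf : WordSmooth I f S p₀) : ContinuousWithinAt f S p₀ := by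
  obtain ⟨hp₀, L, h1, h2⟩ := hf
  have hne : L ≠ [] := by simpa using (h2.self_of_nhdsWithin hp₀).ne_nil
  obtain ⟨l, hl⟩ := Nat.exists_eq_succ_of_ne_zero (List.length_pos_iff.2 hne).ne'
  set W : P → Fin (l + 1) → G := fun p j => L.get (j.cast hl.symm) p with hW
  have hWL : ∀ p, List.ofFn (W p) = L.map fun a => a p := fun p => by
    refine List.ext_getElem (by simp [hl]) fun i i1 i2 => ?_
    rw [List.getElem_ofFn, List.getElem_map]
    rfl
  have hrep : ∀ᶠ p in 𝓝[S] p₀, ∃ h : 𝒢.IsComposable (W p), 𝒢.toCompletion ⟨l, W p, h⟩ = f p := by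
    filter_upwards [h2] with p hp
    rw [← hWL] at hp
    obtain ⟨⟨l', w, hw⟩, e1, e2⟩ := hp
    have e3 := List.ofFn_inj'.1 e1
    obtain rfl : l' = l := by
      have := congrArg Sigma.fst e3
      simpa using this
    obtain rfl : w = W p := by simpa using e3
    exact ⟨hw, e2⟩
  have hWc : ContinuousWithinAt W S p₀ :=
    continuousWithinAt_pi.2 fun j => (h1 _ (List.get_mem _ _)).continuousWithinAt
  obtain ⟨hc₀, hf₀⟩ := hrep.self_of_nhdsWithin hp₀
  have hquot : Continuous fun w : {w : Fin (l + 1) → G // 𝒢.IsComposable w} =>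
      𝒢.toCompletion ⟨l, w⟩ :=
    continuous_quot_mk.comp continuous_sigmaMk
  refine fun N hN => ?_
  -- the lift to words is continuous, and so is the projection from words of this length
  rw [← hf₀] at hN
  obtain ⟨T, hT, hTN⟩ := mem_nhds_subtype _ _ _ |>.1
    (hquot.continuousAt (x := ⟨W p₀, hc₀⟩) hN)
  rw [mem_map]
  filter_upwards [hrep, hWc.preimage_mem_nhdsWithin hT] with p ⟨h3, h4⟩ h5
  rw [mem_preimage, ← h4]
  exact hTN (show (⟨W p, h3⟩ : {w : Fin (l + 1) → G // 𝒢.IsComposable w}) ∈ _ from h5)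

end LocalLieGroupoid

/-! ### Translation by bisections of the completion -/

section Pi

variable {E H : Type*} [NormedAddCommGroup E] [NormedSpace ℝ E] [TopologicalSpace H]
  {I : ModelWithCorners ℝ E H} {X : Type*} [TopologicalSpace X] [ChartedSpace H X]
  {E' H' : Type*} [NormedAddCommGroup E'] [NormedSpace ℝ E'] [TopologicalSpace H']
  {I' : ModelWithCorners ℝ E' H'} {P : Type*} [TopologicalSpace P] [ChartedSpace H' P]
  {ι : Type*} [Fintype ι]

theorem contMDiff_eval [I.Boundaryless] (j : ι) :
    ContMDiff (ModelWithCorners.pi fun _ : ι => I) I ∞ (fun w : ι → X => w j) := by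
  intro w
  refine contMDiffAt_iff.2 ⟨(continuous_apply j).continuousAt, ?_⟩
  have h1 : ContDiff ℝ ∞ (fun z : ι → E => z j) := contDiff_apply ℝ E j
  refine (h1.contDiffWithinAt (s := range _)).congr_of_eventuallyEq ?_ ?_
  · refine mem_nhdsWithin_of_mem_nhds ?_
    have h2 : Tendsto (fun z : ι → E => z j) (𝓝 (fun i => extChartAt I (w i) (w i)))
        (𝓝 (extChartAt I (w j) (w j))) := (continuous_apply j).tendsto _
    filter_upwards [h2.eventually (extChartAt_target_mem_nhds (I := I) (w j))] with z hz
    exact (extChartAt I (w j)).right_inv hz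
  · exact (extChartAt I (w j)).right_inv (mem_extChartAt_target (I := I) (w j))

theorem HasMFDerivAt.pi_mk {f : ι → P → X} {D : ι → E' →L[ℝ] E} {p : P}
    (h : ∀ j, HasMFDerivAt I' I (f j) p (D j)) :
    HasMFDerivAt I' (ModelWithCorners.pi fun _ : ι => I) (fun p j => f j p) p
      (ContinuousLinearMap.pi D) := by
  refine ⟨continuousAt_pi.2 fun j => (h j).1, ?_⟩
  exact hasFDerivWithinAt_pi.2 fun j => (h j).2

end Pi

namespace LocalLieGroupoid

variable {n k : ℕ} {M : Type u} [TopologicalSpace M] [ChartedSpace (EuclideanSpace ℝ (Fin n)) M]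
  {G : Type v} [TopologicalSpace G] [ChartedSpace (EuclideanSpace ℝ (Fin k)) G]
  {𝒢 : LocalLieGroupoid n k M G}

/-- The projection from words to the associative completion is word-smooth. -/
theorem wordSmooth_toCompletion {l : ℕ} {f : (Fin (l + 1) → G) → 𝒢.AssocCompletion}
    (hf : ∀ w (hw : 𝒢.IsComposable w), f w = 𝒢.toCompletion ⟨l, w, hw⟩) {w : Fin (l + 1) → G}
    (hw : 𝒢.IsComposable w) :
    WordSmooth (ModelWithCorners.pi fun _ : Fin (l + 1) => 𝓡 k) f {w | 𝒢.IsComposable w} w := by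
  refine ⟨hw, List.ofFn fun j w => w j, fun a ha => ?_, ?_⟩
  · obtain ⟨j, rfl⟩ := (List.mem_ofFn' _ _).1 ha
    exact (contMDiff_eval (I := 𝓡 k) j w).contMDiffWithinAt
  · filter_upwards [self_mem_nhdsWithin] with w' hw'
    rw [hf w' hw', List.map_ofFn]
    exact rep_toList ⟨l, w', hw'⟩

/-- A set of elements of the completion is open if every word-smooth family that meets it stays in
it. -/
theorem isOpen_of_wordSmooth {N : Set 𝒢.AssocCompletion}
    (h : ∀ (l : ℕ) (f : (Fin (l + 1) → G) → 𝒢.AssocCompletion) (w : Fin (l + 1) → G),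
      WordSmooth (ModelWithCorners.pi fun _ : Fin (l + 1) => 𝓡 k) f {w | 𝒢.IsComposable w} w →
      f w ∈ N → ∀ᶠ w' in 𝓝[{w | 𝒢.IsComposable w}] w, f w' ∈ N) : IsOpen N := by
  classical
  have hN : IsOpen (𝒢.toCompletion ⁻¹' N) → IsOpen N := fun h => h
  refine hN (isOpen_sigma_iff.2 fun l => isOpen_iff_mem_nhds.2 fun w hw => ?_)
  let f : (Fin (l + 1) → G) → 𝒢.AssocCompletion := fun w' =>
    if hw' : 𝒢.IsComposable w' then 𝒢.toCompletion ⟨l, w', hw'⟩ else 𝒢.toCompletion ⟨l, w⟩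
  have hf : ∀ w (hw : 𝒢.IsComposable w), f w = 𝒢.toCompletion ⟨l, w, hw⟩ := fun w hw =>
    dif_pos hw
  have h1 := h l f w.1 (wordSmooth_toCompletion hf w.2) (by rw [hf _ w.2]; exact hw)
  have h2 : Tendsto Subtype.val (𝓝 w) (𝓝[{w | 𝒢.IsComposable w}] w.1) :=
    tendsto_nhdsWithin_iff.2 ⟨continuous_subtype_val.continuousAt, Eventually.of_forall Subtype.prop⟩
  filter_upwards [h2.eventually h1] with w' hw'
  rwa [hf _ w'.2] at hw'

/-- A local bisection of the associative completion: a word-smooth section `c` of the target map on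
`W` whose composition with the source map is a diffeomorphism onto `W'`, with inverse `b`. -/
structure Bisection (𝒢 : LocalLieGroupoid n k M G) where
  c : M → 𝒢.AssocCompletion
  b : M → M
  W : Set M
  W' : Set M
  isOpen_W : IsOpen W
  isOpen_W' : IsOpen W'
  wordSmooth_c : ∀ y ∈ W, WordSmooth (𝓡 n) c univ y
  tgt_c : ∀ y ∈ W, tgt (c y) = y
  src_c_mem : ∀ y ∈ W, src (c y) ∈ W'
  b_src_c : ∀ y ∈ W, b (src (c y)) = y
  contMDiffAt_b : ∀ z ∈ W', ContMDiffAt (𝓡 n) (𝓡 n) ∞ b z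
  b_mem : ∀ z ∈ W', b z ∈ W
  src_c_b : ∀ z ∈ W', src (c (b z)) = z

namespace Bisection

/-- The bisection of units. -/
def unit (𝒢 : LocalLieGroupoid n k M G) : Bisection 𝒢 where
  c x := ofArrow (𝒢.u x)
  b := id
  W := univ
  W' := univ
  isOpen_W := isOpen_univ
  isOpen_W' := isOpen_univ
  wordSmooth_c y _ := .ofArrow (mem_univ y) (𝒢.contMDiff_u y)
  tgt_c y _ := 𝒢.t_u y
  src_c_mem _ _ := mem_univ _
  b_src_c y _ := 𝒢.s_u y
  contMDiffAt_b _ _ := contMDiffAt_id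
  b_mem _ _ := mem_univ _
  src_c_b y _ := 𝒢.s_u y

/-- The product of two bisections. -/
def mul (B B' : Bisection 𝒢) : Bisection 𝒢 where
  c y := LocalLieGroupoid.mul (B.c y) (B'.c (src (B.c y)))
  b z := B.b (B'.b z)
  W := B.W ∩ (fun y => src (B.c y)) ⁻¹' B'.W
  W' := B'.W' ∩ B'.b ⁻¹' B.W'
  isOpen_W := ContinuousOn.isOpen_inter_preimage (fun y hy =>
    ((B.wordSmooth_c y hy).src.continuousWithinAt).mono (subset_univ _)) B.isOpen_W B'.isOpen_W
  isOpen_W' := ContinuousOn.isOpen_inter_preimage (fun z hz =>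
    (B'.contMDiffAt_b z hz).continuousAt.continuousWithinAt) B'.isOpen_W' B.isOpen_W'
  wordSmooth_c y hy := by
    refine (B.wordSmooth_c y hy.1).mul (WordSmooth.comp (g := fun y => src (B.c y))
      (B'.wordSmooth_c _ hy.2) (mem_univ y) (B.wordSmooth_c y hy.1).src (mapsTo_univ _ _)) ?_
    filter_upwards [(B.wordSmooth_c y hy.1).src.continuousWithinAt.eventually
      (B'.isOpen_W.mem_nhds hy.2)] with z hz
    rw [B'.tgt_c _ hz]
  tgt_c y hy := by rw [tgt_mul (B'.tgt_c _ hy.2).symm, B.tgt_c y hy.1]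
  src_c_mem y hy := by
    rw [src_mul (B'.tgt_c _ hy.2).symm]
    refine ⟨B'.src_c_mem _ hy.2, ?_⟩
    rw [mem_preimage, B'.b_src_c _ hy.2]
    exact B.src_c_mem _ hy.1
  b_src_c y hy := by rw [src_mul (B'.tgt_c _ hy.2).symm, B'.b_src_c _ hy.2, B.b_src_c _ hy.1]
  contMDiffAt_b z hz := (B.contMDiffAt_b _ hz.2).comp z (B'.contMDiffAt_b z hz.1)
  b_mem z hz := ⟨B.b_mem _ hz.2, by
    rw [mem_preimage, B.src_c_b _ hz.2]; exact B'.b_mem z hz.1⟩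
  src_c_b z hz := by
    have h := B.src_c_b _ hz.2
    have h2 := B'.b_mem z hz.1
    rw [src_mul (by rw [h, B'.tgt_c _ h2]), h, B'.src_c_b z hz.1]

/-- A local bisection of arrows through `g` is a bisection of the completion. -/
theorem exists_ofArrow [IsManifold (𝓡 n) ∞ M] [IsManifold (𝓡 k) ∞ G] (g : G) :
    ∃ B : Bisection 𝒢, 𝒢.t g ∈ B.W ∧ B.c (𝒢.t g) = ofArrow g := by
  obtain ⟨β, b, hβ, hb, hβe, hbe⟩ := exists_local_bisection 𝒢.contMDiff_s 𝒢.contMDiff_t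
    (𝒢.submersion_s g) (𝒢.submersion_t g)
  obtain ⟨W₁, hW₁, hW₁o, hW₁m⟩ := eventually_nhds_iff.1 hβe
  obtain ⟨W₁', hW₁', hW₁o', hW₁m'⟩ := eventually_nhds_iff.1 hbe
  refine ⟨{ c := fun y => ofArrow (β y), b := b, W := W₁ ∩ (fun y => 𝒢.s (β y)) ⁻¹' W₁',
            W' := W₁' ∩ b ⁻¹' W₁, isOpen_W := ?_, isOpen_W' := ?_, wordSmooth_c := ?_, tgt_c := ?_,
            src_c_mem := ?_, b_src_c := ?_, contMDiffAt_b := ?_, b_mem := ?_, src_c_b := ?_ },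
            ?_, ?_⟩
  · exact ContinuousOn.isOpen_inter_preimage (fun y hy =>
      (𝒢.contMDiff_s.continuous.continuousAt.comp
        (hW₁ y hy).1.continuousAt).continuousWithinAt) hW₁o hW₁o'
  · exact ContinuousOn.isOpen_inter_preimage (fun y hy =>
      (hW₁' y hy).1.continuousAt.continuousWithinAt) hW₁o' hW₁o
  · exact fun y hy => .ofArrow (mem_univ y) (hW₁ y hy.1).1.contMDiffWithinAt
  · exact fun y hy => (hW₁ y hy.1).2.1
  · exact fun y hy => ⟨hy.2, show b (𝒢.s (β y)) ∈ W₁ by rw [(hW₁ y hy.1).2.2]; exact hy.1⟩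
  · exact fun y hy => (hW₁ y hy.1).2.2
  · exact fun z hz => (hW₁' z hz.1).1
  · exact fun z hz => ⟨hz.2, show 𝒢.s (β (b z)) ∈ W₁' by rw [(hW₁' z hz.1).2]; exact hz.1⟩
  · exact fun z hz => (hW₁' z hz.1).2
  · exact ⟨hW₁m, show 𝒢.s (β (𝒢.t g)) ∈ W₁' by rw [hβ]; exact hW₁m'⟩
  · exact congrArg ofArrow hβ

/-- There is a bisection through every element of the completion. -/
theorem exists_c_eq [IsManifold (𝓡 n) ∞ M] [IsManifold (𝓡 k) ∞ G] (p : 𝒢.AssocCompletion) :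
    ∃ B : Bisection 𝒢, tgt p ∈ B.W ∧ B.c (tgt p) = p := by
  obtain ⟨L, hL⟩ := exists_rep p
  induction L generalizing p with
  | nil => exact absurd rfl hL.ne_nil
  | cons a L ih =>
    obtain ⟨B, hB, hBa⟩ := exists_ofArrow (𝒢 := 𝒢) a
    cases L with
    | nil =>
      obtain rfl : p = ofArrow a := hL.unique (rep_ofArrow a)
      exact ⟨B, hB, hBa⟩
    | cons b L =>
      have hw : 𝒢.IsWord (b :: L) := ⟨by simp, (List.isChain_cons_cons.1 hL.isWord.2).2⟩
      obtain ⟨p', hp'⟩ := exists_rep_of_isWord hw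
      obtain ⟨B', hB', hBp'⟩ := ih p' hp'
      have hst : src (ofArrow a : 𝒢.AssocCompletion) = tgt p' := by
        rw [hp'.tgt_eq]; exact (List.isChain_cons_cons.1 hL.isWord.2).1
      obtain rfl : p = LocalLieGroupoid.mul (ofArrow a) p' :=
        hL.unique ((rep_ofArrow a).mul_rep hp' hst)
      refine ⟨B.mul B', ?_, ?_⟩
      · rw [tgt_mul hst]
        exact ⟨hB, show src (B.c (𝒢.t a)) ∈ B'.W by rw [hBa, hst]; exact hB'⟩
      · rw [tgt_mul hst]
        show LocalLieGroupoid.mul (B.c (𝒢.t a)) (B'.c (src (B.c (𝒢.t a)))) = _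
        rw [hBa, hst, hBp']

end Bisection

end LocalLieGroupoid

/-! ### Charts of the completion -/

namespace LocalLieGroupoid

variable {n k : ℕ} {M : Type u} [TopologicalSpace M] [ChartedSpace (EuclideanSpace ℝ (Fin n)) M]
  {G : Type v} [TopologicalSpace G] [ChartedSpace (EuclideanSpace ℝ (Fin k)) G]
  {𝒢 : LocalLieGroupoid n k M G}

namespace Bisection

/-- Right translation by a bisection, as a map from arrows to the completion. -/
def translate (B : Bisection 𝒢) (g : G) : 𝒢.AssocCompletion :=
  LocalLieGroupoid.mul (ofArrow g) (B.c (𝒢.s g))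

variable {B : Bisection 𝒢} {g : G}

theorem src_translate (hg : 𝒢.s g ∈ B.W) : src (B.translate g) = src (B.c (𝒢.s g)) :=
  src_mul (B.tgt_c _ hg).symm

theorem src_ofArrow_eq_tgt_c (hg : 𝒢.s g ∈ B.W) :
    src (ofArrow g : 𝒢.AssocCompletion) = tgt (B.c (𝒢.s g)) := (B.tgt_c _ hg).symm

theorem wordSmooth_translate (hg : 𝒢.s g ∈ B.W) : WordSmooth (𝓡 k) B.translate univ g := by
  refine WordSmooth.mul (.ofArrow (mem_univ g) contMDiffWithinAt_id)
    (WordSmooth.comp (g := 𝒢.s) (B.wordSmooth_c _ hg) (mem_univ g)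
      𝒢.contMDiff_s.contMDiffAt.contMDiffWithinAt (mapsTo_univ _ _)) ?_
  rw [nhdsWithin_univ]
  filter_upwards [𝒢.contMDiff_s.continuous.continuousAt.eventually (B.isOpen_W.mem_nhds hg)]
    with z hz
  exact (B.tgt_c _ hz).symm

variable {E H : Type*} [NormedAddCommGroup E] [NormedSpace ℝ E] [TopologicalSpace H]
  {I : ModelWithCorners ℝ E H} {P : Type*} [TopologicalSpace P] [ChartedSpace H P]
  {f : P → 𝒢.AssocCompletion} {S : Set P} {p₀ : P}

/-- A word-smooth family lifts along the translation by a bisection to a smooth family of arrows. -/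
theorem exists_translate [hC : 𝒢.IsCompletable] (hf : WordSmooth I f S p₀) (hg : 𝒢.s g ∈ B.W)
    (hfg : f p₀ = B.translate g) :
    ∃ a : P → G, a p₀ = g ∧ ContMDiffWithinAt I (𝓡 k) ∞ a S p₀ ∧
      ∀ᶠ p in 𝓝[S] p₀, 𝒢.s (a p) ∈ B.W ∧ f p = B.translate (a p) := by
  have hsrc : src (f p₀) = src (B.c (𝒢.s g)) := by rw [hfg, src_translate hg]
  have hW' : src (f p₀) ∈ B.W' := by rw [hsrc]; exact B.src_c_mem _ hg
  have hb : B.b (src (f p₀)) = 𝒢.s g := by rw [hsrc, B.b_src_c _ hg]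
  have hbs : ContMDiffWithinAt I (𝓡 n) ∞ (fun p => B.b (src (f p))) S p₀ :=
    (B.contMDiffAt_b _ hW').comp_contMDiffWithinAt p₀ hf.src
  have hcs : WordSmooth I (fun p => B.c (B.b (src (f p)))) S p₀ :=
    WordSmooth.comp (g := fun p => B.b (src (f p))) (B.wordSmooth_c _ (by rw [hb]; exact hg)) hf.1
      hbs (mapsTo_univ _ _)
  have hW'e : ∀ᶠ p in 𝓝[S] p₀, src (f p) ∈ B.W' :=
    hf.src.continuousWithinAt.eventually (B.isOpen_W'.mem_nhds hW')
  have hh := hf.mul (hcs.inv hC) (by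
    filter_upwards [hW'e] with p hp
    rw [(hC.inv_spec _).2.1, B.src_c_b _ hp])
  -- `f p · c(b(s(f p)))⁻¹` is word-smooth with value `g` at `p₀`, hence a smooth family of arrows.
  obtain ⟨a, ha, has, hae⟩ := hh.exists_ofArrow hC (g := g) (by
    rw [hb, hfg, translate, hC.mul_mul_inv (src_ofArrow_eq_tgt_c hg)])
  refine ⟨a, ha, has, ?_⟩
  filter_upwards [hae, hW'e] with p h1 h2
  have h3 := hC.mul_inv_mul (p := f p) (q := B.c (B.b (src (f p)))) (B.src_c_b _ h2).symm
  have h4 : 𝒢.s (a p) = B.b (src (f p)) := by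
    have := congrArg src h1
    rw [src_mul (by rw [(hC.inv_spec _).2.1, B.src_c_b _ h2]), (hC.inv_spec _).1,
      B.tgt_c _ (B.b_mem _ h2)] at this
    exact this.symm
  refine ⟨h4 ▸ B.b_mem _ h2, ?_⟩
  rw [h1] at h3
  rw [translate, h4, h3]

theorem injOn_translate [hC : 𝒢.IsCompletable] (B : Bisection 𝒢) :
    InjOn B.translate (𝒢.s ⁻¹' B.W) := by
  intro g hg g' hg' h
  have h1 := congrArg src h
  rw [src_translate hg, src_translate hg'] at h1
  have h2 : 𝒢.s g = 𝒢.s g' := by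
    have := congrArg B.b h1
    rwa [B.b_src_c _ hg, B.b_src_c _ hg'] at this
  have h3 := congrArg (fun p => LocalLieGroupoid.mul p (LocalLieGroupoid.inv (B.c (𝒢.s g)))) h
  simp only [translate] at h3
  rw [hC.mul_mul_inv (src_ofArrow_eq_tgt_c hg), ← h2, hC.mul_mul_inv (by
    rw [B.tgt_c _ hg, h2]; rfl)] at h3
  exact hC.injective h3

theorem continuousOn_translate (B : Bisection 𝒢) : ContinuousOn B.translate (𝒢.s ⁻¹' B.W) :=
  fun _ hg => (wordSmooth_translate hg).continuousWithinAt.mono (subset_univ _)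

theorem isOpen_image_translate [hC : 𝒢.IsCompletable] (B : Bisection 𝒢) {A : Set G} (hA : IsOpen A)
    (hAW : A ⊆ 𝒢.s ⁻¹' B.W) : IsOpen (B.translate '' A) := by
  refine isOpen_of_wordSmooth fun l f w hf hw => ?_
  obtain ⟨g, hg, hgw⟩ := hw
  obtain ⟨a, rfl, has, hae⟩ := exists_translate hf (hAW hg) hgw.symm
  filter_upwards [hae, has.continuousWithinAt.eventually (hA.mem_nhds hg)] with p h1 h2
  exact ⟨a p, h2, h1.2.symm⟩

/-- Translation by a bisection, as an open partial homeomorphism. The arrow `g` only shows that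
there are arrows. -/
def translateHomeo [hC : 𝒢.IsCompletable] (B : Bisection 𝒢) (g : G) :
    OpenPartialHomeomorph G 𝒢.AssocCompletion :=
  haveI : Nonempty G := ⟨g⟩
  OpenPartialHomeomorph.ofContinuousOpenRestrict
    (InjOn.toPartialEquiv B.translate (𝒢.s ⁻¹' B.W) B.injOn_translate)
    B.continuousOn_translate
    (fun A hA => by
      have hW : IsOpen (𝒢.s ⁻¹' B.W) := B.isOpen_W.preimage 𝒢.contMDiff_s.continuous
      have h1 := B.isOpen_image_translate (hW.isOpenEmbedding_subtypeVal.isOpenMap A hA)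
        (by rintro _ ⟨z, -, rfl⟩; exact z.2)
      convert h1 using 1
      ext p
      constructor
      · rintro ⟨a, ha, rfl⟩
        exact ⟨a, ⟨a, ha, rfl⟩, rfl⟩
      · rintro ⟨_, ⟨a, ha, rfl⟩, rfl⟩
        exact ⟨a, ha, rfl⟩)
    (B.isOpen_W.preimage 𝒢.contMDiff_s.continuous)

end Bisection

theorem translate_unit (g : G) : (Bisection.unit 𝒢).translate g = ofArrow g :=
  LocalLieGroupoid.mul_unit (ofArrow g)

variable [IsManifold (𝓡 n) ∞ M] [IsManifold (𝓡 k) ∞ G]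

/-- Near `p` the completion is the translate by a bisection of a neighbourhood of an arrow. For the
class of an arrow the bisection of units is chosen, so that the preferred charts at such classes
are charts of arrows. -/
theorem exists_chart_data (p : 𝒢.AssocCompletion) : ∃ z : G × Bisection 𝒢,
    𝒢.s z.1 ∈ z.2.W ∧ z.2.translate z.1 = p ∧
      (p ∈ range (ofArrow (𝒢 := 𝒢)) → z.2 = Bisection.unit 𝒢) := by
  by_cases hp : p ∈ range (ofArrow (𝒢 := 𝒢))
  · obtain ⟨g, rfl⟩ := hp
    exact ⟨(g, Bisection.unit 𝒢), mem_univ _, translate_unit g, fun _ => rfl⟩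
  · obtain ⟨B, hB, hBp⟩ := Bisection.exists_c_eq p
    refine ⟨(𝒢.u (tgt p), B), ?_, ?_, fun h => absurd h hp⟩
    · simpa only [𝒢.s_u] using hB
    · simp only [Bisection.translate, 𝒢.s_u, hBp, unit_mul]

/-- The arrow at which the chart at `p` is centred. -/
def chartArrow (p : 𝒢.AssocCompletion) : G := (exists_chart_data p).choose.1

/-- The bisection by which the chart at `p` is translated from the arrows to `p`. -/
def chartBisection (p : 𝒢.AssocCompletion) : Bisection 𝒢 := (exists_chart_data p).choose.2

theorem chartArrow_mem (p : 𝒢.AssocCompletion) : 𝒢.s (chartArrow p) ∈ (chartBisection p).W :=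
  (exists_chart_data p).choose_spec.1

theorem translate_chartArrow (p : 𝒢.AssocCompletion) :
    (chartBisection p).translate (chartArrow p) = p :=
  (exists_chart_data p).choose_spec.2.1

theorem chartBisection_ofArrow (g : G) :
    chartBisection (ofArrow g : 𝒢.AssocCompletion) = Bisection.unit 𝒢 :=
  (exists_chart_data _).choose_spec.2.2 (mem_range_self g)

variable [hC : 𝒢.IsCompletable]

theorem chartArrow_ofArrow (g : G) : chartArrow (ofArrow g : 𝒢.AssocCompletion) = g := by
  have := translate_chartArrow (ofArrow g : 𝒢.AssocCompletion)
  rw [chartBisection_ofArrow, translate_unit] at this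
  exact hC.injective this

/-- The translation of a neighbourhood of an arrow to a neighbourhood of `p`. -/
def arrowHomeo (p : 𝒢.AssocCompletion) : OpenPartialHomeomorph G 𝒢.AssocCompletion :=
  (chartBisection p).translateHomeo (chartArrow p)

theorem mem_source_arrowHomeo (p : 𝒢.AssocCompletion) :
    chartArrow p ∈ (arrowHomeo p).source := chartArrow_mem p

theorem arrowHomeo_chartArrow (p : 𝒢.AssocCompletion) : arrowHomeo p (chartArrow p) = p :=
  translate_chartArrow p

theorem mem_target_arrowHomeo (p : 𝒢.AssocCompletion) : p ∈ (arrowHomeo p).target := by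
  have := (arrowHomeo p).map_source (mem_source_arrowHomeo p)
  rwa [arrowHomeo_chartArrow] at this

theorem arrowHomeo_symm_self (p : 𝒢.AssocCompletion) : (arrowHomeo p).symm p = chartArrow p := by
  have := (arrowHomeo p).left_inv (mem_source_arrowHomeo p)
  rwa [arrowHomeo_chartArrow] at this

/-- The charts of the associative completion are the charts of the arrows, translated by
bisections; those centred at the class of an arrow are not translated at all. -/
instance : ChartedSpace (EuclideanSpace ℝ (Fin k)) 𝒢.AssocCompletion where
  atlas := range fun p => (arrowHomeo p).symm ≫ₕ chartAt _ (chartArrow p)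
  chartAt p := (arrowHomeo p).symm ≫ₕ chartAt _ (chartArrow p)
  mem_chart_source p := by
    rw [OpenPartialHomeomorph.trans_source]
    refine ⟨mem_target_arrowHomeo p, ?_⟩
    rw [mem_preimage, arrowHomeo_symm_self]
    exact mem_chart_source _ _
  chart_mem_atlas p := mem_range_self p

theorem extChartAt_completion (p q : 𝒢.AssocCompletion) :
    extChartAt (𝓡 k) p q = extChartAt (𝓡 k) (chartArrow p) ((arrowHomeo p).symm q) := rfl

variable {E H : Type*} [NormedAddCommGroup E] [NormedSpace ℝ E] [TopologicalSpace H]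
  {I : ModelWithCorners ℝ E H} {P : Type*} [TopologicalSpace P] [ChartedSpace H P]
  {f : P → 𝒢.AssocCompletion} {S : Set P} {p₀ : P}

theorem WordSmooth.exists_arrowHomeo (hf : WordSmooth I f S p₀) {p : 𝒢.AssocCompletion}
    (hp : f p₀ ∈ (arrowHomeo p).target) :
    ContMDiffWithinAt I (𝓡 k) ∞ (fun x => (arrowHomeo p).symm (f x)) S p₀ := by
  have h1 := (arrowHomeo p).map_target hp
  obtain ⟨a, ha, has, hae⟩ := Bisection.exists_translate hf h1 ((arrowHomeo p).right_inv hp).symm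
  have h2 : ∀ᶠ x in 𝓝[S] p₀, (arrowHomeo p).symm (f x) = a x := by
    filter_upwards [hae] with x hx
    rw [hx.2]
    exact (arrowHomeo p).left_inv hx.1
  exact has.congr_of_eventuallyEq h2 ha.symm

theorem WordSmooth.contMDiffWithinAt (hf : WordSmooth I f S p₀) :
    ContMDiffWithinAt I (𝓡 k) ∞ f S p₀ := by
  refine contMDiffWithinAt_iff_target.2 ⟨hf.continuousWithinAt, ?_⟩
  have h1 := hf.exists_arrowHomeo (mem_target_arrowHomeo (f p₀))
  refine ContMDiffAt.comp_contMDiffWithinAt (g := extChartAt (𝓡 k) (chartArrow (f p₀))) p₀ ?_ h1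
  have h2 : ContMDiffAt (𝓡 k) (𝓡 k) ∞ (extChartAt (𝓡 k) (chartArrow (f p₀)))
      ((arrowHomeo (f p₀)).symm (f p₀)) := by
    rw [arrowHomeo_symm_self]
    exact contMDiffAt_extChartAt
  exact h2

instance : IsManifold (𝓡 k) ∞ 𝒢.AssocCompletion := by
  refine isManifold_of_contDiffOn (𝓡 k) ∞ _ ?_
  rintro _ _ ⟨p, rfl⟩ ⟨q, rfl⟩ z ⟨hz, -⟩
  refine ContDiffAt.contDiffWithinAt ?_
  simp only [modelWithCornersSelf_coe_symm, preimage_id_eq, id_eq] at hz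
  set e := (arrowHomeo p).symm ≫ₕ chartAt (EuclideanSpace ℝ (Fin k)) (chartArrow p) with he
  set e' := (arrowHomeo q).symm ≫ₕ chartAt (EuclideanSpace ℝ (Fin k)) (chartArrow q) with he'
  rw [OpenPartialHomeomorph.trans_source] at hz
  have hz1 : z ∈ e.target := hz.1
  have hz2 : e.symm z ∈ e'.source := hz.2
  rw [he, OpenPartialHomeomorph.trans_target] at hz1
  rw [he', OpenPartialHomeomorph.trans_source] at hz2
  have h1 : ContMDiffAt (𝓡 k) (𝓡 k) ∞
      (chartAt (EuclideanSpace ℝ (Fin k)) (chartArrow p)).symm z :=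
    contMDiffOn_chart_symm.contMDiffAt
      ((chartAt (EuclideanSpace ℝ (Fin k)) (chartArrow p)).open_target.mem_nhds hz1.1)
  have h2 : WordSmooth (𝓡 k) e.symm univ z :=
    WordSmooth.comp (g := (chartAt (EuclideanSpace ℝ (Fin k)) (chartArrow p)).symm)
      (Bisection.wordSmooth_translate (B := chartBisection p) hz1.2)
      (mem_univ z) h1.contMDiffWithinAt (mapsTo_univ _ _)
  have h3 := (h2.exists_arrowHomeo (p := q) hz2.1).contMDiffAt univ_mem
  have h4 : ContMDiffAt (𝓡 k) (𝓡 k) ∞ (chartAt (EuclideanSpace ℝ (Fin k)) (chartArrow q))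
      ((arrowHomeo q).symm (e.symm z)) :=
    contMDiffOn_chart.contMDiffAt
      ((chartAt (EuclideanSpace ℝ (Fin k)) (chartArrow q)).open_source.mem_nhds hz2.2)
  exact (ContMDiffAt.comp z h4 h3).contDiffAt

/-- The smooth structure is such that smooth maps to the completion are the word-smooth families:
near `p` its elements are translates by a bisection of arrows that depend smoothly on them. -/
theorem wordSmooth_id (p : 𝒢.AssocCompletion) : WordSmooth (𝓡 k) id univ p := by
  have h1 : ContMDiffAt (𝓡 k) (𝓡 k) ∞ (arrowHomeo p).symm p := by
    refine contMDiffAt_iff_target.2 ⟨(arrowHomeo p).symm.continuousAt (mem_target_arrowHomeo p), ?_⟩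
    rw [arrowHomeo_symm_self]
    exact contMDiffAt_extChartAt (I := 𝓡 k) (x := p)
  have h2 : WordSmooth (𝓡 k) (fun q => arrowHomeo p ((arrowHomeo p).symm q)) univ p := by
    refine WordSmooth.comp (g := (arrowHomeo p).symm) (Bisection.wordSmooth_translate
      (B := chartBisection p) ?_) (mem_univ p) h1.contMDiffWithinAt (mapsTo_univ _ _)
    rw [arrowHomeo_symm_self]
    exact chartArrow_mem p
  refine h2.congr ?_
  rw [nhdsWithin_univ]
  filter_upwards [(arrowHomeo p).open_target.mem_nhds (mem_target_arrowHomeo p)] with q hq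
  exact ((arrowHomeo p).right_inv hq).symm

theorem wordSmooth_of_contMDiffWithinAt (hp₀ : p₀ ∈ S) (hf : ContMDiffWithinAt I (𝓡 k) ∞ f S p₀) :
    WordSmooth I f S p₀ :=
  WordSmooth.comp (g := f) (wordSmooth_id (f p₀)) hp₀ hf (mapsTo_univ _ _)

end LocalLieGroupoid

/-! ### The completion as a Lie groupoid -/

/-- The derivative of a local section `ρ` of `f` is a right inverse of the derivative of `f`. -/
theorem HasMFDerivWithinAt.apply_section {E H : Type*} [NormedAddCommGroup E] [NormedSpace ℝ E]
    [TopologicalSpace H] {I : ModelWithCorners ℝ E H} {X : Type*} [TopologicalSpace X]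
    [ChartedSpace H X] {E' H' : Type*} [NormedAddCommGroup E'] [NormedSpace ℝ E']
    [TopologicalSpace H'] {I' : ModelWithCorners ℝ E' H'} {Y : Type*} [TopologicalSpace Y]
    [ChartedSpace H' Y] {f : X → Y} {S : Set X} {x : X} {D : E →L[ℝ] E'}
    (hD : HasMFDerivWithinAt I I' f S x D) {ρ : Y → X} {R : E' →L[ℝ] E} {y : Y} (hρ : ρ y = x)
    (hR : HasMFDerivAt I' I ρ y R) (h : ∀ᶠ z in 𝓝 y, ρ z ∈ S ∧ f (ρ z) = z) (v : E') :
    D (R v) = v := by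
  subst hρ
  have h1 := hD.comp y (hR.hasMFDerivWithinAt (s := ρ ⁻¹' S)) Subset.rfl
  have h2 : HasMFDerivAt I' I' (f ∘ ρ) y (D.comp R) :=
    h1.hasMFDerivAt (by filter_upwards [h] with z hz using hz.1)
  have h3 : HasMFDerivAt I' I' (f ∘ ρ) y (ContinuousLinearMap.id ℝ E') :=
    (hasMFDerivAt_id y).congr_of_eventuallyEq (by filter_upwards [h] with z hz using hz.2)
  exact congrArg (fun T : E' →L[ℝ] E' => T v) (hasMFDerivAt_unique h2 h3)

theorem ContMDiff.hasMFDerivAt_modelDeriv {E E' H H' X Y : Type*} [NormedAddCommGroup E]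
    [NormedSpace ℝ E] [TopologicalSpace H] {I : ModelWithCorners ℝ E H} [TopologicalSpace X]
    [ChartedSpace H X] [NormedAddCommGroup E'] [NormedSpace ℝ E'] [TopologicalSpace H']
    {I' : ModelWithCorners ℝ E' H'} [TopologicalSpace Y] [ChartedSpace H' Y] {f : X → Y}
    (hf : ContMDiff I I' ∞ f) (x : X) :
    HasMFDerivAt I I' f x (modelDeriv I I' f x : E →L[ℝ] E') :=
  (hf.mdifferentiableAt (by simp)).hasMFDerivAt

/-- A fibre is Hausdorff if limits in it are unique, where limits are taken in the whole space. -/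
theorem t2Space_fiber {M X : Type*} [TopologicalSpace X] {φ : X → M} {x : M}
    (h : ∀ (F : Filter X) [F.NeBot] (p q : X), F ≤ 𝓝 p → F ≤ 𝓝 q → (∀ᶠ z in F, φ z = x) → p = q) :
    T2Space {z : X // φ z = x} := by
  refine t2_iff_nhds.2 fun {p q} hF => Subtype.ext ?_
  have hc : Continuous (Subtype.val : {z : X // φ z = x} → X) := continuous_subtype_val
  refine h (map Subtype.val (𝓝 p ⊓ 𝓝 q)) p q ((hc.tendsto p).mono_left inf_le_left)
    ((hc.tendsto q).mono_left inf_le_right) ?_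
  exact eventually_map.2 (Eventually.of_forall fun z => z.2)

namespace LocalLieGroupoid

variable {n k : ℕ} {M : Type u} [TopologicalSpace M] [ChartedSpace (EuclideanSpace ℝ (Fin n)) M]
  {G : Type v} [TopologicalSpace G] [ChartedSpace (EuclideanSpace ℝ (Fin k)) G]
  {𝒢 : LocalLieGroupoid n k M G} [IsManifold (𝓡 n) ∞ M] [IsManifold (𝓡 k) ∞ G]
  [hC : 𝒢.IsCompletable]

theorem contMDiff_src : ContMDiff (𝓡 k) (𝓡 n) ∞ (src : 𝒢.AssocCompletion → M) := fun p =>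
  (wordSmooth_id p).src.contMDiffAt univ_mem

theorem contMDiff_tgt : ContMDiff (𝓡 k) (𝓡 n) ∞ (tgt : 𝒢.AssocCompletion → M) := fun p =>
  (wordSmooth_id p).tgt.contMDiffAt univ_mem

theorem contMDiff_ofArrow : ContMDiff (𝓡 k) (𝓡 k) ∞ (ofArrow : G → 𝒢.AssocCompletion) := fun g =>
  (WordSmooth.ofArrow (mem_univ g) contMDiffWithinAt_id).contMDiffWithinAt.contMDiffAt univ_mem

theorem contMDiff_inv : ContMDiff (𝓡 k) (𝓡 k) ∞ (inv : 𝒢.AssocCompletion → _) := fun p =>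
  ((wordSmooth_id p).inv hC).contMDiffWithinAt.contMDiffAt univ_mem

section

variable {E H : Type*} [NormedAddCommGroup E] [NormedSpace ℝ E] [TopologicalSpace H]
  {I : ModelWithCorners ℝ E H} {P : Type*} [TopologicalSpace P] [ChartedSpace H P]
  {f f' : P → 𝒢.AssocCompletion} {S : Set P} {p₀ : P}

theorem contMDiffWithinAt_mul (hp₀ : p₀ ∈ S) (hf : ContMDiffWithinAt I (𝓡 k) ∞ f S p₀)
    (hf' : ContMDiffWithinAt I (𝓡 k) ∞ f' S p₀) (h : ∀ᶠ p in 𝓝[S] p₀, src (f p) = tgt (f' p)) :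
    ContMDiffWithinAt I (𝓡 k) ∞ (fun p => mul (f p) (f' p)) S p₀ :=
  ((wordSmooth_of_contMDiffWithinAt hp₀ hf).mul
    (wordSmooth_of_contMDiffWithinAt hp₀ hf') h).contMDiffWithinAt

end

theorem t1Space_completion : T1Space 𝒢.AssocCompletion :=
  ChartedSpace.t1Space (EuclideanSpace ℝ (Fin k)) _

/-- The source fibres of the completion are Hausdorff: if `z` tends both to `p` and to `q` in the
source fibre of `x`, then `p` and `q` have the same target and the constant `z⁻¹ z = u x` tends to
`p⁻¹ q`. -/
theorem eq_of_le_nhds_of_src [T2Space M] {F : Filter 𝒢.AssocCompletion} [F.NeBot]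
    {p q : 𝒢.AssocCompletion} (hp : F ≤ 𝓝 p) (hq : F ≤ 𝓝 q) {x : M}
    (hx : ∀ᶠ z in F, src z = x) : p = q := by
  have := t1Space_completion (𝒢 := 𝒢)
  have ht : tgt p = tgt q := tendsto_nhds_unique
    ((contMDiff_tgt.continuous.tendsto p).mono_left hp)
    ((contMDiff_tgt.continuous.tendsto q).mono_left hq)
  have hs : src p = x := tendsto_nhds_unique
    ((contMDiff_src.continuous.tendsto p).mono_left hp)
    (tendsto_const_nhds.congr' (by filter_upwards [hx] with z hz using hz.symm))
  set S : Set (𝒢.AssocCompletion × 𝒢.AssocCompletion) := {r | tgt r.1 = tgt r.2} with hS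
  have h1 : ContMDiffWithinAt ((𝓡 k).prod (𝓡 k)) (𝓡 k) ∞
      (fun r : 𝒢.AssocCompletion × 𝒢.AssocCompletion => mul (inv r.1) r.2) S (p, q) := by
    refine contMDiffWithinAt_mul (show (p, q) ∈ S from ht)
      ((contMDiff_inv.comp contMDiff_fst) _).contMDiffWithinAt contMDiffWithinAt_snd ?_
    filter_upwards [self_mem_nhdsWithin] with r hr
    exact (hC.inv_spec r.1).1.trans hr
  have h2 : Tendsto (fun z : 𝒢.AssocCompletion => (z, z)) F (𝓝[S] (p, q)) :=
    tendsto_nhdsWithin_iff.2 ⟨Tendsto.prodMk_nhds hp hq, Eventually.of_forall fun _ => rfl⟩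
  have h3 : Tendsto (fun _ : 𝒢.AssocCompletion => (ofArrow (𝒢.u x) : 𝒢.AssocCompletion)) F
      (𝓝 (mul (inv p) q)) := by
    refine (h1.continuousWithinAt.tendsto.comp h2).congr' ?_
    filter_upwards [hx] with z hz
    rw [Function.comp_apply, (hC.inv_spec z).2.2.1, hz]
  have h4 := tendsto_const_nhds_iff.1 h3
  have h5 := hC.mul_inv_cancel_left ht
  rw [← h4, ← hs, mul_unit] at h5
  exact h5

/-- The target fibres of the completion are Hausdorff, since the inversion exchanges them with the
source fibres. -/
theorem eq_of_le_nhds_of_tgt [T2Space M] {F : Filter 𝒢.AssocCompletion} [F.NeBot]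
    {p q : 𝒢.AssocCompletion} (hp : F ≤ 𝓝 p) (hq : F ≤ 𝓝 q) {x : M}
    (hx : ∀ᶠ z in F, tgt z = x) : p = q := by
  have hinv : ∀ z : 𝒢.AssocCompletion, inv (inv z) = z := fun z => by
    obtain ⟨a1, a2, a3, a4⟩ := hC.inv_spec z
    exact (hC.eq_inv a2.symm (by rw [a4, a1])).symm
  have h : inv p = inv q := eq_of_le_nhds_of_src (F := F.map inv) (x := x)
    ((contMDiff_inv.continuous.tendsto p).mono_left hp)
    ((contMDiff_inv.continuous.tendsto q).mono_left hq)
    (by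
      rw [eventually_map]
      filter_upwards [hx] with z hz
      rw [(hC.inv_spec z).1, hz])
  rw [← hinv p, h, hinv]

/-- The completion is Lindelöf as a quotient of the space of words, so countably many charts cover
it. -/
theorem secondCountable_completion : SecondCountableTopology 𝒢.AssocCompletion := by
  have := 𝒢.secondCountable
  have hlin : LindelofSpace 𝒢.AssocCompletion := by
    have h : range 𝒢.toCompletion = univ := Set.range_eq_univ.2 Quot.mk_surjective
    have hc : Continuous 𝒢.toCompletion := continuous_quot_mk
    exact isLindelof_univ_iff.1 (h ▸ isLindelof_range hc)
  obtain ⟨t, htc, ht⟩ := LindelofSpace.elim_nhds_subcover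
    (fun p : 𝒢.AssocCompletion => (chartAt (EuclideanSpace ℝ (Fin k)) p).source)
    (fun p => chart_source_mem_nhds _ p)
  exact ChartedSpace.secondCountable_of_countable_cover _ ht htc

/-- A bisection through `p` gives a smooth section of the source map through `p`. -/
theorem exists_src_section (p : 𝒢.AssocCompletion) : ∃ σ : M → 𝒢.AssocCompletion, σ (src p) = p ∧
    ContMDiffAt (𝓡 n) (𝓡 k) ∞ σ (src p) ∧ ∀ᶠ z in 𝓝 (src p), src (σ z) = z := by
  obtain ⟨B, hB, hBp⟩ := Bisection.exists_c_eq p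
  have h1 := B.src_c_mem _ hB
  have h2 := B.b_src_c _ hB
  rw [hBp] at h1 h2
  refine ⟨fun z => B.c (B.b z), (congrArg B.c h2).trans hBp, ?_, ?_⟩
  · refine ContMDiffAt.comp (src p) ?_ (B.contMDiffAt_b _ h1)
    rw [h2]
    exact (B.wordSmooth_c _ hB).contMDiffWithinAt.contMDiffAt univ_mem
  · filter_upwards [B.isOpen_W'.mem_nhds h1] with z hz using B.src_c_b z hz

theorem exists_tgt_section (p : 𝒢.AssocCompletion) : ∃ σ : M → 𝒢.AssocCompletion, σ (tgt p) = p ∧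
    ContMDiffAt (𝓡 n) (𝓡 k) ∞ σ (tgt p) ∧ ∀ᶠ z in 𝓝 (tgt p), tgt (σ z) = z := by
  obtain ⟨B, hB, hBp⟩ := Bisection.exists_c_eq p
  refine ⟨B.c, hBp, (B.wordSmooth_c _ hB).contMDiffWithinAt.contMDiffAt univ_mem, ?_⟩
  filter_upwards [B.isOpen_W.mem_nhds hB] with z hz using B.tgt_c z hz

theorem surjective_mfderiv_of_section {f : 𝒢.AssocCompletion → M} (hf : ContMDiff (𝓡 k) (𝓡 n) ∞ f)
    {p : 𝒢.AssocCompletion} (h : ∃ σ : M → 𝒢.AssocCompletion, σ (f p) = p ∧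
      ContMDiffAt (𝓡 n) (𝓡 k) ∞ σ (f p) ∧ ∀ᶠ z in 𝓝 (f p), f (σ z) = z) :
    Function.Surjective (mfderiv (𝓡 k) (𝓡 n) f p) := by
  obtain ⟨σ, h1, h2, h3⟩ := h
  have hD : HasMFDerivWithinAt (𝓡 k) (𝓡 n) f univ p (modelDeriv (𝓡 k) (𝓡 n) f p) :=
    (hf.mdifferentiableAt (by simp)).hasMFDerivAt.hasMFDerivWithinAt
  intro v
  exact ⟨_, hD.apply_section h1 (h2.mdifferentiableAt (by simp)).hasMFDerivAt
    (by filter_upwards [h3] with z hz using ⟨mem_univ _, hz⟩) v⟩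

theorem contMDiffOn_mul : ContMDiffOn ((𝓡 k).prod (𝓡 k)) (𝓡 k) ∞
    (fun p : 𝒢.AssocCompletion × 𝒢.AssocCompletion => mul p.1 p.2)
    {p | src p.1 = tgt p.2} := fun p hp =>
  contMDiffWithinAt_mul hp contMDiffWithinAt_fst contMDiffWithinAt_snd
    (by filter_upwards [self_mem_nhdsWithin] with q hq using hq)

/-- The product of the completion is a submersion: a section `σ` of the source map through `q` gives
the section `r ↦ (r σ(s(r))⁻¹, σ(s(r)))` through `(p, q)`. -/
theorem isSubmersionOn_mul : IsSubmersionOn ((𝓡 k).prod (𝓡 k)) (𝓡 k)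
    (fun p : 𝒢.AssocCompletion × 𝒢.AssocCompletion => mul p.1 p.2) {p | src p.1 = tgt p.2}
    (fun p => {v | (mfderiv (𝓡 k) (𝓡 n) src p.1 v.1 : EuclideanSpace ℝ (Fin n)) =
      mfderiv (𝓡 k) (𝓡 n) tgt p.2 v.2}) := by
  refine ⟨contMDiffOn_mul, ?_⟩
  rintro ⟨p, q⟩ hpq
  have hpq : src p = tgt q := hpq
  obtain ⟨σ, hσ1, hσ2, hσ3⟩ := exists_src_section q
  have hD := ((contMDiffOn_mul (𝒢 := 𝒢) (p, q) hpq).mdifferentiableWithinAt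
    (by simp)).hasMFDerivWithinAt
  refine ⟨_, hD, fun v => ?_⟩
  set r := mul p q with hr
  have hsr : src r = src q := src_mul hpq
  have hsrt : Tendsto src (𝓝 r) (𝓝 (src q)) := hsr ▸ contMDiff_src.continuous.tendsto r
  have hB : ContMDiffAt (𝓡 k) (𝓡 k) ∞ (fun z => σ (src z)) r := by
    refine ContMDiffAt.comp r ?_ (contMDiff_src r)
    rw [hsr]
    exact hσ2
  have hAst : ∀ᶠ z in 𝓝 r, src z = tgt (inv (σ (src z))) := by
    filter_upwards [hsrt.eventually hσ3] with z hz
    rw [(hC.inv_spec _).2.1, hz]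
  have hA : ContMDiffAt (𝓡 k) (𝓡 k) ∞ (fun z => mul z (inv (σ (src z)))) r := by
    have := contMDiffWithinAt_mul (mem_univ r) contMDiffWithinAt_id
      ((contMDiff_inv _).comp r hB).contMDiffWithinAt (by rw [nhdsWithin_univ]; exact hAst)
    exact this.contMDiffAt univ_mem
  have hAr : mul r (inv (σ (src r))) = p := by rw [hsr, hσ1, hr, hC.mul_mul_inv hpq]
  have hBr : σ (src r) = q := by rw [hsr, hσ1]
  have hAd := (hA.mdifferentiableAt (by simp)).hasMFDerivAt
  have hBd := (hB.mdifferentiableAt (by simp)).hasMFDerivAt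
  have hst : ∀ᶠ z in 𝓝 r, src (mul z (inv (σ (src z)))) = tgt (σ (src z)) := by
    filter_upwards [hAst] with z hz
    rw [src_mul hz, (hC.inv_spec _).1]
  have hmul : ∀ᶠ z in 𝓝 r, mul (mul z (inv (σ (src z)))) (σ (src z)) = z := by
    filter_upwards [hsrt.eventually hσ3] with z hz
    exact hC.mul_inv_mul hz.symm
  refine ⟨_, ?_, hD.apply_section (ρ := fun z => (mul z (inv (σ (src z))), σ (src z))) (y := r)
    (Prod.ext hAr hBr) (hAd.prodMk hBd) (hst.and hmul) v⟩
  have e1 := HasMFDerivAt.comp r (hAr.symm ▸ contMDiff_src.hasMFDerivAt_modelDeriv p :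
    HasMFDerivAt (𝓡 k) (𝓡 n) src (mul r (inv (σ (src r)))) (modelDeriv (𝓡 k) (𝓡 n) src p)) hAd
  have e2 := HasMFDerivAt.comp r (hBr.symm ▸ contMDiff_tgt.hasMFDerivAt_modelDeriv q :
    HasMFDerivAt (𝓡 k) (𝓡 n) tgt (σ (src r)) (modelDeriv (𝓡 k) (𝓡 n) tgt q)) hBd
  -- The section takes composable values, so its derivative takes values in the tangent space of the
  -- composable pairs.
  have e3 := hasMFDerivAt_unique e1 (e2.congr_of_eventuallyEq hst)
  exact congrArg (fun T : EuclideanSpace ℝ (Fin k) →L[ℝ] EuclideanSpace ℝ (Fin n) => T v) e3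

variable (𝒢) in
/-- The associative completion as a Lie groupoid. -/
def completion [T2Space M] : LocalLieGroupoid n k M 𝒢.AssocCompletion where
  secondCountable := secondCountable_completion
  s := src
  t := tgt
  u x := ofArrow (𝒢.u x)
  U := {p | src p.1 = tgt p.2}
  m := mul
  V := univ
  i := inv
  contMDiff_s := contMDiff_src
  submersion_s p := surjective_mfderiv_of_section contMDiff_src (exists_src_section p)
  contMDiff_t := contMDiff_tgt
  submersion_t p := surjective_mfderiv_of_section contMDiff_tgt (exists_tgt_section p)
  t2_source_fiber _ := t2Space_fiber fun _ _ _ _ hp hq hx => eq_of_le_nhds_of_src hp hq hx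
  t2_target_fiber _ := t2Space_fiber fun _ _ _ _ hp hq hx => eq_of_le_nhds_of_tgt hp hq hx
  contMDiff_u := contMDiff_ofArrow.comp 𝒢.contMDiff_u
  s_u := 𝒢.s_u
  t_u := 𝒢.t_u
  isOpen_U := ⟨univ, isOpen_univ, (univ_inter _).symm⟩
  unit_right_mem p := (𝒢.t_u (src p)).symm
  unit_left_mem p := 𝒢.s_u (tgt p)
  submersion_m := isSubmersionOn_mul
  isOpen_V := isOpen_univ
  u_mem_V _ := mem_univ _
  i_mem_V _ _ := mem_univ _
  contMDiffOn_i := contMDiff_inv.contMDiffOn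
  V_subset _ _ _ _ h := h
  s_m _ _ h := src_mul h
  t_m _ _ h := tgt_mul h
  assoc_near_units := ⟨univ, isOpen_univ, fun _ => mem_univ _, fun _ => mem_univ _,
    fun _ => mem_univ _, fun _ _ _ _ h h' =>
      ⟨h, (src_mul h).trans h', h', h.trans (tgt_mul h').symm, mul_assoc' h h'⟩⟩
  m_unit := mul_unit
  unit_m := unit_mul
  s_i p _ := (hC.inv_spec p).1
  t_i p _ := (hC.inv_spec p).2.1
  i_m p _ := (hC.inv_spec p).2.2.1
  m_i p _ := (hC.inv_spec p).2.2.2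

theorem isLieGroupoid_completion [T2Space M] : 𝒢.completion.IsLieGroupoid :=
  ⟨fun _ _ h => h, fun _ => mem_univ _, fun _ _ _ h h' => mul_assoc' h h'⟩

theorem isCompletionStructure_completion [T2Space M] :
    𝒢.IsCompletionStructure 𝒢.completion := by
  refine ⟨fun _ => rfl, fun _ => rfl, fun _ => rfl, fun w w' h => ?_⟩
  have h1 := (rep_toList w).mul_rep (rep_toList w') h
  rw [← toList_append w w' h] at h1
  exact h1.unique (rep_toList _)

/-- The smooth structure of the completion is the quotient structure: the identity of the completion
is represented near the class of a word by smooth letters through that word, and these form a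
section of the projection from words. -/
theorem isSmoothQuotient_completion : 𝒢.IsSmoothQuotient := by
  intro l f hf
  have hws : ∀ w, 𝒢.IsComposable w →
      WordSmooth (ModelWithCorners.pi fun _ : Fin (l + 1) => 𝓡 k) f {w | 𝒢.IsComposable w} w :=
    fun w hw => wordSmooth_toCompletion (𝒢 := 𝒢) hf hw
  refine ⟨fun w hw => (hws w hw).contMDiffWithinAt, fun w hw => ?_⟩
  have hD := ((hws w hw).contMDiffWithinAt.mdifferentiableWithinAt (by simp)).hasMFDerivWithinAt
  refine ⟨_, hD, fun v => ?_⟩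
  obtain ⟨L, hL, hLs, hLr⟩ := (wordSmooth_id (f w)).exists_isLocalRep hC
    (K := List.ofFn w) (by rw [id, hf w hw]; exact rep_toList ⟨l, w, hw⟩)
  have hlen : L.length = l + 1 := by
    have := congrArg List.length hL
    simpa using this
  rw [nhdsWithin_univ] at hLr
  set a : Fin (l + 1) → 𝒢.AssocCompletion → G := fun j => L.get (j.cast hlen.symm) with ha
  have haL : ∀ p, (L.map fun c => c p) = List.ofFn fun j => a j p := fun p => by
    refine List.ext_getElem (by simp [hlen]) fun i i1 i2 => ?_
    rw [List.getElem_ofFn, List.getElem_map]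
    rfl
  have haw : (fun j => a j (f w)) = w := by
    rw [haL] at hL
    exact List.ofFn_injective hL
  have has : ∀ j, ContMDiffAt (𝓡 k) (𝓡 k) ∞ (a j) (f w) := fun j =>
    (hLs _ (List.get_mem _ _)).contMDiffAt univ_mem
  have had' : ∀ j, ∃ D : EuclideanSpace ℝ (Fin k) →L[ℝ] EuclideanSpace ℝ (Fin k),
      HasMFDerivAt (𝓡 k) (𝓡 k) (a j) (f w) D := fun j =>
    ⟨_, ((has j).mdifferentiableAt (by simp)).hasMFDerivAt⟩
  choose D' had using had'
  have hρ : ∀ᶠ q in 𝓝 (f w), 𝒢.IsComposable (fun j => a j q) ∧ f (fun j => a j q) = q := by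
    filter_upwards [hLr] with q hq
    rw [haL] at hq
    obtain ⟨w', hw', hq'⟩ := hq
    obtain ⟨w'', hw''⟩ : ∃ hc : 𝒢.IsComposable (fun j => a j q), w' = ⟨l, fun j => a j q, hc⟩ := by
      obtain ⟨l', b, hb⟩ := w'
      have e := List.ofFn_inj'.1 hw'
      obtain rfl : l' = l := by
        have := congrArg Sigma.fst e
        simpa using this
      obtain rfl : b = fun j => a j q := by simpa using e
      exact ⟨hb, rfl⟩
    exact ⟨w'', by rw [hf _ w'', ← hw'', hq']; rfl⟩
  refine ⟨_, fun j => ?_, hD.apply_section haw (HasMFDerivAt.pi_mk (I := 𝓡 k) had) hρ v⟩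
  have e5 : ∀ j, a j (f w) = w j := fun j => congrFun haw j
  have e1 := HasMFDerivAt.comp (f w) (e5 j.castSucc ▸ 𝒢.contMDiff_s.hasMFDerivAt_modelDeriv
    (w j.castSucc) : HasMFDerivAt (𝓡 k) (𝓡 n) 𝒢.s (a j.castSucc (f w))
      (modelDeriv (𝓡 k) (𝓡 n) 𝒢.s (w j.castSucc))) (had j.castSucc)
  have e2 := HasMFDerivAt.comp (f w) (e5 j.succ ▸ 𝒢.contMDiff_t.hasMFDerivAt_modelDeriv
    (w j.succ) : HasMFDerivAt (𝓡 k) (𝓡 n) 𝒢.t (a j.succ (f w))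
      (modelDeriv (𝓡 k) (𝓡 n) 𝒢.t (w j.succ))) (had j.succ)
  -- The section takes values in words, so its derivative takes values in their tangent space.
  have e3 := hasMFDerivAt_unique e1 (e2.congr_of_eventuallyEq (by
    filter_upwards [hρ] with q hq using hq.1 j))
  exact congrArg (fun T : EuclideanSpace ℝ (Fin k) →L[ℝ] EuclideanSpace ℝ (Fin n) => T v) e3

end LocalLieGroupoid

/-! ### Comparison of Lie algebroids -/

section Bracket

variable {E H : Type*} [NormedAddCommGroup E] [NormedSpace ℝ E] [TopologicalSpace H]
  {I : ModelWithCorners ℝ E H} [I.Boundaryless] {X : Type*} [TopologicalSpace X]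
  [ChartedSpace H X] {Y : Type*} [TopologicalSpace Y] [ChartedSpace H Y]

variable (I) in
/-- A vector field in the preferred chart at `x`. -/
def fieldInChart (x : X) (V : X → E) : E → E := fun z =>
  (modelDeriv 𝓘(ℝ, E) I (extChartAt I x).symm z).inverse (V ((extChartAt I x).symm z))

/-- The Lie bracket at `x` is the bracket of the fields in the preferred chart at `x`; no
differential is left in front of it, since that of the chart at `x` is the identity. -/
theorem mlieBracket_eq_lieBracket_fieldInChart (x : X) (V W : X → E) :
    (VectorField.mlieBracket I V W x : E) =
      VectorField.lieBracket ℝ (fieldInChart I x V) (fieldInChart I x W) (extChartAt I x x) := by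
  have h1 := VectorField.mlieBracketWithin_apply (I := I) (V := V) (W := W) (s := univ) (x₀ := x)
  have h0 := congrFun (VectorField.mlieBracketWithin_univ (I := I) (V := V) (W := W)) x
  have h2 : ∀ v : E, (ContinuousLinearMap.id ℝ E).inverse v = v := fun v => by
    rw [ContinuousLinearMap.inverse_id]; rfl
  have h3 : ∀ A : X → E, (VectorField.mpullbackWithin 𝓘(ℝ, E) I (extChartAt I x).symm A
      (range I) : E → E) = fieldInChart I x A := fun A => by
    funext z
    refine congrArg (fun T : E →L[ℝ] E => T.inverse (A ((extChartAt I x).symm z)))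
      (?_ : mfderivWithin 𝓘(ℝ, E) I (extChartAt I x).symm (range I) z = _)
    rw [I.range_eq_univ, mfderivWithin_univ]
  have h4 : ∀ {A B A' B' : E → E} {S : Set E}, A = A' → B = B' → S = univ → ∀ z,
      VectorField.lieBracketWithin ℝ A B S z = VectorField.lieBracket ℝ A' B' z := by
    rintro A B _ _ _ rfl rfl rfl z
    rw [VectorField.lieBracketWithin_univ]
  refine h0.symm.trans (h1.trans ((congrArg (fun T : E →L[ℝ] E => T.inverse _)
    (hasMFDerivAt_extChartAt_self x).mfderiv).trans ((h2 _).trans (h4 (h3 V) (h3 W) ?_ _))))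
  rw [preimage_univ, univ_inter, I.range_eq_univ]

theorem isInvertible_modelDeriv_extChartAt_symm [IsManifold I ∞ X] {x : X} {z : E}
    (hz : z ∈ (extChartAt I x).target) :
    (modelDeriv 𝓘(ℝ, E) I (extChartAt I x).symm z).IsInvertible := by
  have := IsManifold.of_le (I := I) (M := X) (m := 1) (n := ∞) (by simp)
  have := isInvertible_mfderivWithin_extChartAt_symm (I := I) hz
  rwa [I.range_eq_univ, mfderivWithin_univ] at this

/-- A map that matches the preferred charts at `x` and `y` has the identity as its differential. -/
theorem hasMFDerivAt_of_matched_charts {φ : X → Y} {x : X} {y : Y}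
    (he : extChartAt I y y = extChartAt I x x)
    (hch : (extChartAt I y).symm =ᶠ[𝓝 (extChartAt I x x)] φ ∘ (extChartAt I x).symm) :
    HasMFDerivAt I I φ x (ContinuousLinearMap.id ℝ E) := by
  have h1 : HasMFDerivAt 𝓘(ℝ, E) I (extChartAt I y).symm (extChartAt I x x)
      (ContinuousLinearMap.id ℝ E) := he ▸ hasMFDerivAt_extChartAt_symm_self y
  have h2 := h1.comp x (hasMFDerivAt_extChartAt_self (I := I) x)
  refine HasMFDerivAt.congr_of_eventuallyEq h2 ?_
  filter_upwards [(continuousAt_extChartAt (I := I) x).eventually hch,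
    extChartAt_source_mem_nhds (I := I) x] with z h3 h4
  rw [Function.comp_apply, h3, Function.comp_apply, (extChartAt I x).left_inv h4]

variable [IsManifold I ∞ X] [IsManifold I ∞ Y]

/-- If the charts at `x` and `y` are matched by `φ`, then `φ`-related vector fields are equal in
these charts. -/
theorem fieldInChart_eventuallyEq {φ : X → Y} {x : X} {y : Y}
    (he : extChartAt I y y = extChartAt I x x)
    (hch : (extChartAt I y).symm =ᶠ[𝓝 (extChartAt I x x)] φ ∘ (extChartAt I x).symm)
    (hφ : ∀ᶠ z in 𝓝 x, MDifferentiableAt I I φ z) {V : X → E} {V' : Y → E}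
    (hV : ∀ᶠ z in 𝓝 x, V' (φ z) = modelDeriv I I φ z (V z)) :
    fieldInChart I y V' =ᶠ[𝓝 (extChartAt I x x)] fieldInChart I x V := by
  have hc : Tendsto (extChartAt I x).symm (𝓝 (extChartAt I x x)) (𝓝 x) := by
    simpa using (continuousAt_extChartAt_symm (I := I) x).tendsto
  filter_upwards [hch.eventually_nhds, hc.eventually hφ, hc.eventually hV,
    extChartAt_target_mem_nhds (I := I) x, he ▸ extChartAt_target_mem_nhds (I := I) y]
    with z h1 h2 h3 h4 h5
  have j1 := isInvertible_modelDeriv_extChartAt_symm h4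
  have j2 := isInvertible_modelDeriv_extChartAt_symm h5
  have d1 : HasMFDerivAt 𝓘(ℝ, E) I (extChartAt I x).symm z
      (modelDeriv 𝓘(ℝ, E) I (extChartAt I x).symm z : E →L[ℝ] E) :=
    (mdifferentiableAt_of_isInvertible_mfderiv j1).hasMFDerivAt
  have d2 : HasMFDerivAt I I φ ((extChartAt I x).symm z)
      (modelDeriv I I φ ((extChartAt I x).symm z) : E →L[ℝ] E) := h2.hasMFDerivAt
  have d3 : modelDeriv 𝓘(ℝ, E) I (extChartAt I y).symm z =
      (modelDeriv I I φ ((extChartAt I x).symm z)).comp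
        (modelDeriv 𝓘(ℝ, E) I (extChartAt I x).symm z) :=
    ((d2.comp z d1).congr_of_eventuallyEq h1).mfderiv
  simp only [fieldInChart]
  rw [j2.inverse_apply_eq, h1.self_of_nhds, Function.comp_apply, h3, d3,
    ContinuousLinearMap.comp_apply, j1.self_apply_inverse]

/-- If the charts at `x` and `y` are matched by `φ`, then `φ`-related pairs of vector fields have
the same bracket at `x` and `y`, as vectors of the model space. -/
theorem mlieBracket_eq_of_matched_charts {φ : X → Y} {x : X} {y : Y}
    (he : extChartAt I y y = extChartAt I x x)
    (hch : (extChartAt I y).symm =ᶠ[𝓝 (extChartAt I x x)] φ ∘ (extChartAt I x).symm)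
    (hφ : ∀ᶠ z in 𝓝 x, MDifferentiableAt I I φ z) {V W : X → E} {V' W' : Y → E}
    (hV : ∀ᶠ z in 𝓝 x, V' (φ z) = modelDeriv I I φ z (V z))
    (hW : ∀ᶠ z in 𝓝 x, W' (φ z) = modelDeriv I I φ z (W z)) :
    (VectorField.mlieBracket I V' W' y : E) = (VectorField.mlieBracket I V W x : E) := by
  rw [mlieBracket_eq_lieBracket_fieldInChart, mlieBracket_eq_lieBracket_fieldInChart, he]
  exact (fieldInChart_eventuallyEq he hch hφ hV).lieBracket_vectorField_eq
    (fieldInChart_eventuallyEq he hch hφ hW)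

end Bracket

namespace LocalLieGroupoid

variable {n k : ℕ} {M : Type u} [TopologicalSpace M] [ChartedSpace (EuclideanSpace ℝ (Fin n)) M]

section RightField

variable {G : Type v} [TopologicalSpace G] [ChartedSpace (EuclideanSpace ℝ (Fin k)) G]
  (𝒢 : LocalLieGroupoid n k M G)

theorem rightField_of_t_eq (a : M → EuclideanSpace ℝ (Fin k)) {g : G} {x : M} (hx : 𝒢.t g = x) :
    (𝒢.rightField a g : EuclideanSpace ℝ (Fin k)) = (𝒢.dR g (𝒢.u x) (a x) :) := by
  subst hx
  rfl

theorem hasMFDerivWithinAt_dR {g h : G} (hU : (h, g) ∈ 𝒢.U) :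
    HasMFDerivWithinAt (𝓡 k) (𝓡 k) (fun h' => 𝒢.m h' g) {h' | (h', g) ∈ 𝒢.U} h (𝒢.dR g h) := by
  have h1 : ContMDiffWithinAt (𝓡 k) (𝓡 k) ∞ (fun h' => 𝒢.m h' g) {h' | (h', g) ∈ 𝒢.U} h :=
    𝒢.contMDiffWithinAt_m contMDiffWithinAt_id contMDiffWithinAt_const
      (by filter_upwards [self_mem_nhdsWithin] with z hz using 𝒢.mem_U_s_eq_t hz) hU
  exact (h1.mdifferentiableWithinAt (by simp)).hasMFDerivWithinAt

end RightField

/-- A morphism of germs along the units, from the open neighbourhood `O` of the units of `𝒢` to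
`𝒢₁`, that is the identity in the preferred charts at the units. -/
structure IsGermMorphism {G : Type v} [TopologicalSpace G]
    [ChartedSpace (EuclideanSpace ℝ (Fin k)) G] {G₁ : Type w} [TopologicalSpace G₁]
    [ChartedSpace (EuclideanSpace ℝ (Fin k)) G₁] (𝒢 : LocalLieGroupoid n k M G)
    (𝒢₁ : LocalLieGroupoid n k M G₁) (O : Set G) (φ : G → G₁) : Prop where
  isOpen : IsOpen O
  u_mem : ∀ x, 𝒢.u x ∈ O
  contMDiffOn : ContMDiffOn (𝓡 k) (𝓡 k) ∞ φ O
  map_u : ∀ x, φ (𝒢.u x) = 𝒢₁.u x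
  s_map : ∀ g ∈ O, 𝒢₁.s (φ g) = 𝒢.s g
  t_map : ∀ g ∈ O, 𝒢₁.t (φ g) = 𝒢.t g
  map_m : ∀ g ∈ O, ∀ h ∈ O, (g, h) ∈ 𝒢.U → 𝒢.m g h ∈ O →
    (φ g, φ h) ∈ 𝒢₁.U ∧ 𝒢₁.m (φ g) (φ h) = φ (𝒢.m g h)
  extChartAt_u : ∀ x, extChartAt (𝓡 k) (𝒢₁.u x) (𝒢₁.u x) = extChartAt (𝓡 k) (𝒢.u x) (𝒢.u x)
  extChartAt_symm : ∀ x, (extChartAt (𝓡 k) (𝒢₁.u x)).symm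
    =ᶠ[𝓝 (extChartAt (𝓡 k) (𝒢.u x) (𝒢.u x))] φ ∘ (extChartAt (𝓡 k) (𝒢.u x)).symm

namespace IsGermMorphism

variable {G : Type v} [TopologicalSpace G] [ChartedSpace (EuclideanSpace ℝ (Fin k)) G]
  {G₁ : Type w} [TopologicalSpace G₁] [ChartedSpace (EuclideanSpace ℝ (Fin k)) G₁]
  {𝒢 : LocalLieGroupoid n k M G} {𝒢₁ : LocalLieGroupoid n k M G₁} {O : Set G} {φ : G → G₁}

theorem hasMFDerivAt_u (hφ : IsGermMorphism 𝒢 𝒢₁ O φ) (x : M) : HasMFDerivAt (𝓡 k) (𝓡 k) φ (𝒢.u x)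
    (ContinuousLinearMap.id ℝ (EuclideanSpace ℝ (Fin k))) :=
  hasMFDerivAt_of_matched_charts (hφ.extChartAt_u x) (hφ.extChartAt_symm x)

theorem hasMFDerivAt (hφ : IsGermMorphism 𝒢 𝒢₁ O φ) {g : G} (hg : g ∈ O) :
    HasMFDerivAt (𝓡 k) (𝓡 k) φ g
    (modelDeriv (𝓡 k) (𝓡 k) φ g :
      EuclideanSpace ℝ (Fin k) →L[ℝ] EuclideanSpace ℝ (Fin k)) :=
  (((hφ.contMDiffOn g hg).contMDiffAt (hφ.isOpen.mem_nhds hg)).mdifferentiableAt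
    (by simp)).hasMFDerivAt

theorem modelDeriv_u_eq (hφ : IsGermMorphism 𝒢 𝒢₁ O φ) {f : G → M} {f₁ : G₁ → M}
    (hf₁ : ContMDiff (𝓡 k) (𝓡 n) ∞ f₁)
    (h : ∀ g ∈ O, f₁ (φ g) = f g) (x : M) :
    modelDeriv (𝓡 k) (𝓡 n) f₁ (𝒢₁.u x) = modelDeriv (𝓡 k) (𝓡 n) f (𝒢.u x) := by
  have h1 : HasMFDerivAt (𝓡 k) (𝓡 n) f₁ (φ (𝒢.u x)) (modelDeriv (𝓡 k) (𝓡 n) f₁ (𝒢₁.u x)) :=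
    (hφ.map_u x).symm ▸ hf₁.hasMFDerivAt_modelDeriv (𝒢₁.u x)
  have h2 := (h1.comp _ (hφ.hasMFDerivAt_u x)).congr_of_eventuallyEq (f₁ := f) (by
    filter_upwards [hφ.isOpen.mem_nhds (hφ.u_mem x)] with g hg using (h g hg).symm)
  exact h2.mfderiv.symm

/-- Right-invariant fields with the same values at the units are `φ`-related: both sides are
derivatives of `h ↦ φ (h g) = φ h φ g` along the source fibre of the unit. -/
theorem rightField_eq [IsManifold (𝓡 n) ∞ M] [IsManifold (𝓡 k) ∞ G]
    (hφ : IsGermMorphism 𝒢 𝒢₁ O φ) {g : G} (hg : g ∈ O) {a : M → EuclideanSpace ℝ (Fin k)}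
    (ha : ∀ x, a x ∈ 𝒢.tangentSource (𝒢.u x)) :
    (𝒢₁.rightField a (φ g) : EuclideanSpace ℝ (Fin k)) =
      modelDeriv (𝓡 k) (𝓡 k) φ g (𝒢.rightField a g) := by
  obtain ⟨y, hy⟩ : ∃ y, 𝒢.t g = y := ⟨_, rfl⟩
  rw [𝒢₁.rightField_of_t_eq a ((hφ.t_map g hg).trans hy), 𝒢.rightField_of_t_eq a hy]
  have hug : 𝒢.m (𝒢.u y) g = g := hy ▸ 𝒢.unit_m g
  have hU : (𝒢.u y, g) ∈ 𝒢.U := hy ▸ 𝒢.unit_left_mem g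
  have hU₁ : (𝒢₁.u y, φ g) ∈ 𝒢₁.U := hy ▸ hφ.t_map g hg ▸ 𝒢₁.unit_left_mem (φ g)
  set S : Set G := {h | (h, g) ∈ 𝒢.U ∧ h ∈ O ∧ 𝒢.m h g ∈ O} with hS
  have hR := 𝒢.hasMFDerivWithinAt_dR hU
  have hSe : ∀ᶠ z in 𝓝 (𝒢.u y), 𝒢.s z = 𝒢.s (𝒢.u y) → z ∈ S := by
    have h1 := eventually_nhdsWithin_iff.1
      (hR.1.eventually (hφ.isOpen.mem_nhds (show 𝒢.m (𝒢.u y) g ∈ O from hug.symm ▸ hg)))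
    filter_upwards [h1, eventually_mem_U_of_s_eq hU, hφ.isOpen.mem_nhds (hφ.u_mem y)]
      with z h2 h3 h4 h5
    exact ⟨h3 h5, h4, h2 (h3 h5)⟩
  have e1 : HasMFDerivWithinAt (𝓡 k) (𝓡 k) (fun h => φ (𝒢.m h g)) S (𝒢.u y)
      ((modelDeriv (𝓡 k) (𝓡 k) φ g).comp (𝒢.dR g (𝒢.u y) :
        EuclideanSpace ℝ (Fin k) →L[ℝ] EuclideanSpace ℝ (Fin k))) := by
    have h1 : HasMFDerivAt (𝓡 k) (𝓡 k) φ (𝒢.m (𝒢.u y) g) (modelDeriv (𝓡 k) (𝓡 k) φ g) :=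
      hug.symm ▸ hφ.hasMFDerivAt hg
    exact HasMFDerivAt.comp_hasMFDerivWithinAt (f := fun h => 𝒢.m h g) (𝒢.u y) h1
      (hR.mono fun z (hz : z ∈ S) => hz.1)
  have e2 : HasMFDerivWithinAt (𝓡 k) (𝓡 k) (fun h => φ (𝒢.m h g)) S (𝒢.u y)
      (𝒢₁.dR (φ g) (𝒢₁.u y) : EuclideanSpace ℝ (Fin k) →L[ℝ] EuclideanSpace ℝ (Fin k)) := by
    have h1 : HasMFDerivWithinAt (𝓡 k) (𝓡 k) (fun h => 𝒢₁.m h (φ g)) {h | (h, φ g) ∈ 𝒢₁.U}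
        (φ (𝒢.u y)) (𝒢₁.dR (φ g) (𝒢₁.u y) :
          EuclideanSpace ℝ (Fin k) →L[ℝ] EuclideanSpace ℝ (Fin k)) :=
      (hφ.map_u y).symm ▸ 𝒢₁.hasMFDerivWithinAt_dR hU₁
    have h2 := h1.comp (𝒢.u y) ((hφ.hasMFDerivAt_u y).hasMFDerivWithinAt (s := S))
      fun z hz => (hφ.map_m z hz.2.1 g hg hz.1 hz.2.2).1
    exact h2.congr_of_eventuallyEq (by
      filter_upwards [self_mem_nhdsWithin] with z hz
        using (hφ.map_m z hz.2.1 g hg hz.1 hz.2.2).2.symm)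
      (hφ.map_m _ (hφ.u_mem y) g hg hU (hug.symm ▸ hg)).2.symm
  exact HasMFDerivWithinAt.eq_on_ker 𝒢.contMDiff_s (𝒢.submersion_s _) hSe e2 e1 (ha y)

/-- Under `φ` the tangent spaces at the units, the anchors and the brackets correspond, by the
identity of the model space. -/
theorem integrates [IsManifold (𝓡 n) ∞ M] [IsManifold (𝓡 k) ∞ G] [IsManifold (𝓡 k) ∞ G₁]
    {F : Type*} [NormedAddCommGroup F] [NormedSpace ℝ F]
    {V : M → Type*} [∀ x, AddCommGroup (V x)] [∀ x, Module ℝ (V x)]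
    [TopologicalSpace (Bundle.TotalSpace F V)] [∀ x, TopologicalSpace (V x)]
    [FiberBundle F V] [VectorBundle ℝ F V] {A : LieAlgebroid n M F V}
    (hφ : IsGermMorphism 𝒢 𝒢₁ O φ) (hA : 𝒢.Integrates A) :
    𝒢₁.Integrates A := by
  obtain ⟨θ, h1, h2, h3, h4⟩ := hA
  refine ⟨fun x => (θ x : V x →ₗ[ℝ] EuclideanSpace ℝ (Fin k)), ?_, fun x => ⟨(h2 x).1, ?_⟩,
    fun x v => ?_, fun α β x => ?_⟩
  · have e1 := (hφ.contMDiffOn.contMDiffOn_tangentMapWithin (m := ∞) (by simp)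
      hφ.isOpen.uniqueMDiffOn).comp_contMDiff h1 fun p => hφ.u_mem p.1
    refine e1.congr fun p => ?_
    have e2 : ∀ {q q' : G₁} (_ : q = q') (v : EuclideanSpace ℝ (Fin k)),
        (⟨q, v⟩ : TangentBundle (𝓡 k) G₁) = ⟨q', v⟩ := by
      rintro q _ rfl v
      rfl
    refine (e2 (hφ.map_u p.1).symm _).trans ?_
    have e3 : (mfderivWithin (𝓡 k) (𝓡 k) φ O (𝒢.u p.1) :
        EuclideanSpace ℝ (Fin k) →L[ℝ] EuclideanSpace ℝ (Fin k)) =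
        ContinuousLinearMap.id ℝ _ :=
      (hφ.hasMFDerivAt_u p.1).hasMFDerivWithinAt.mfderivWithin
        (hφ.isOpen.uniqueMDiffWithinAt (hφ.u_mem p.1))
    exact congrArg (fun v : EuclideanSpace ℝ (Fin k) =>
      (⟨φ (𝒢.u p.1), v⟩ : TangentBundle (𝓡 k) G₁))
      (congrArg (fun T : EuclideanSpace ℝ (Fin k) →L[ℝ] EuclideanSpace ℝ (Fin k) =>
        T (θ p.1 p.2)) e3).symm
  · refine (h2 x).2.trans ?_
    have e1 := hφ.modelDeriv_u_eq 𝒢₁.contMDiff_s hφ.s_map x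
    ext v
    exact Eq.congr_left (congrArg (fun T : EuclideanSpace ℝ (Fin k) →L[ℝ]
      EuclideanSpace ℝ (Fin n) => T v) e1.symm)
  · exact (congrArg (fun T : EuclideanSpace ℝ (Fin k) →L[ℝ] EuclideanSpace ℝ (Fin n) =>
      T (θ x v)) (hφ.modelDeriv_u_eq 𝒢₁.contMDiff_t hφ.t_map x)).trans (h3 x v)
  · refine Eq.trans ?_ (h4 α β x)
    have e1 : ∀ (γ : ContMDiffSection (𝓡 n) F ∞ V), ∀ᶠ g in 𝓝 (𝒢.u x),
        (𝒢₁.rightField (fun y => (θ y (γ y) : EuclideanSpace ℝ (Fin k))) (φ g) :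
          EuclideanSpace ℝ (Fin k)) = modelDeriv (𝓡 k) (𝓡 k) φ g
            (𝒢.rightField (fun y => (θ y (γ y) : EuclideanSpace ℝ (Fin k))) g) := by
      intro γ
      filter_upwards [hφ.isOpen.mem_nhds (hφ.u_mem x)] with g hg
      exact hφ.rightField_eq hg fun y => (h2 y).2 ▸ mem_range_self (γ y)
    exact mlieBracket_eq_of_matched_charts (hφ.extChartAt_u x) (hφ.extChartAt_symm x)
      (by filter_upwards [hφ.isOpen.mem_nhds (hφ.u_mem x)] with g hg
          using (hφ.hasMFDerivAt hg).mdifferentiableAt) (e1 α) (e1 β)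

end IsGermMorphism

end LocalLieGroupoid

/-! ### Associators in Lie groupoids, and integration -/

namespace LocalLieGroupoid

variable {n k : ℕ} {M : Type u} [TopologicalSpace M] [ChartedSpace (EuclideanSpace ℝ (Fin n)) M]
  {G : Type v} [TopologicalSpace G] [ChartedSpace (EuclideanSpace ℝ (Fin k)) G]
  {𝒢 : LocalLieGroupoid n k M G}

namespace IsLieGroupoid

theorem isThreeAssociative (hG : 𝒢.IsLieGroupoid) : 𝒢.IsThreeAssociative :=
  fun g h l h1 _ h2 _ => hG.2.2 g h l (𝒢.mem_U_s_eq_t h1) (𝒢.mem_U_s_eq_t h2)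

/-- The source of a product `c d₁ ⋯ dₗ` of letters of a word is the target of the letter that
follows. -/
theorem s_foldl (hG : 𝒢.IsLieGroupoid) {pre post : List G} {a c : G}
    (h : 𝒢.IsWord (c :: (pre ++ a :: post))) : 𝒢.s (pre.foldl 𝒢.m c) = 𝒢.t a := by
  induction pre generalizing c with
  | nil => exact (List.isChain_cons_cons.1 h.2).1
  | cons d pre ih =>
    rw [IsWord, List.cons_append, List.isChain_cons_cons] at h
    refine ih (c := 𝒢.m c d) ⟨List.cons_ne_nil _ _, ?_⟩
    have h1 := h.2.2
    rw [List.isChain_cons] at h1 ⊢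
    rw [𝒢.s_m _ _ (hG.1 _ _ h.2.1)]
    exact h1

/-- In a Lie groupoid, a contraction does not change the product of the letters. -/
theorem foldl_eq_of_listContracts (hG : 𝒢.IsLieGroupoid) {c c' : G} {L L' : List G}
    (hw : 𝒢.IsWord (c :: L)) (h : 𝒢.ListContracts (c :: L) (c' :: L')) :
    L.foldl 𝒢.m c = L'.foldl 𝒢.m c' := by
  obtain ⟨pre, a, b, post, hU, h1, h2⟩ := h
  cases pre with
  | nil =>
    rw [List.nil_append, List.cons.injEq] at h1 h2
    rw [h1.1, h1.2, h2.1, h2.2, List.foldl_cons]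
  | cons d pre =>
    rw [List.cons_append, List.cons.injEq] at h1 h2
    rw [h1.2, h1.1] at hw
    rw [h1.1, h1.2, h2.1, h2.2]
    simp only [List.foldl_append, List.foldl_cons]
    rw [hG.2.2 _ _ _ (hG.s_foldl hw) (𝒢.mem_U_s_eq_t hU)]

theorem foldl_eq_of_listReduces (hG : 𝒢.IsLieGroupoid) {g : G} {L : List G}
    (h : 𝒢.ListReduces L [g]) : ∃ c K, L = c :: K ∧ K.foldl 𝒢.m c = g := by
  induction h using Relation.ReflTransGen.head_induction_on with
  | refl => exact ⟨g, [], rfl, rfl⟩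
  | head h1 h2 ih =>
    obtain ⟨c', K', rfl, hK⟩ := ih
    have hw := h1.isWord_iff.2 ((ListReduces.isWord_iff h2).2 (isWord_singleton g))
    obtain ⟨c, K, rfl⟩ := List.exists_cons_of_ne_nil hw.1
    exact ⟨c, K, rfl, (hG.foldl_eq_of_listContracts hw h1).trans hK⟩

theorem associators_eq (hG : 𝒢.IsLieGroupoid) : 𝒢.associators = range 𝒢.u := by
  refine Subset.antisymm (fun g hg => ?_) ?_
  · obtain ⟨x, -, -, L, h1, h2⟩ := mem_associators_iff.1 hg
    obtain ⟨c, K, rfl, hK⟩ := hG.foldl_eq_of_listReduces h1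
    obtain ⟨c', K', h, hK'⟩ := hG.foldl_eq_of_listReduces h2
    rw [List.cons.injEq] at h
    rw [← h.1, ← h.2, hK] at hK'
    exact ⟨x, hK'⟩
  · rintro _ ⟨x, rfl⟩
    exact u_mem_associators x

theorem hasUniformlyDiscreteAssociators (hG : 𝒢.IsLieGroupoid) :
    𝒢.HasUniformlyDiscreteAssociators :=
  ⟨univ, isOpen_univ, subset_univ _, by rw [univ_inter, hG.associators_eq]⟩

end IsLieGroupoid

section Completion

variable [T2Space M] [IsManifold (𝓡 n) ∞ M] [IsManifold (𝓡 k) ∞ G] {O : Opens G}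
  {𝒢' : LocalLieGroupoid n k M O} [hC : 𝒢'.IsCompletable]

/-- The preferred charts at the unit of `𝒢` and at its class in the completion are matched by the
map `G ⊇ O → 𝒢'.AssocCompletion`, so the completion has the Lie algebroid of `𝒢`. -/
theorem ShrinksTo.isGermMorphism (hsh : 𝒢.ShrinksTo 𝒢') {φ : G → 𝒢'.AssocCompletion}
    (hφ : ∀ g : O, φ g = ofArrow g) : IsGermMorphism 𝒢 𝒢'.completion O φ where
  isOpen := O.isOpen
  u_mem x := hsh.2.2.1 x ▸ (𝒢'.u x).2
  contMDiffOn g hg := by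
    have h1 : ContMDiffAt (𝓡 k) (𝓡 k) ∞ (fun z : O => φ z) ⟨g, hg⟩ := by
      rw [show (fun z : O => φ z) = ofArrow from funext hφ]
      exact contMDiff_ofArrow _
    exact (contMDiffAt_subtype_iff.1 h1).contMDiffWithinAt
  map_u x := by rw [← hsh.2.2.1, hφ]; rfl
  s_map g hg := by rw [hφ ⟨g, hg⟩]; exact hsh.1 ⟨g, hg⟩
  t_map g hg := by rw [hφ ⟨g, hg⟩]; exact hsh.2.1 ⟨g, hg⟩
  map_m g hg h hh hU hm := by
    have hU' : ((⟨g, hg⟩ : O), (⟨h, hh⟩ : O)) ∈ 𝒢'.U := (hsh.2.2.2.1 _ _).2 ⟨hU, hm⟩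
    rw [hφ ⟨g, hg⟩, hφ ⟨h, hh⟩, show 𝒢.m g h = (𝒢'.m ⟨g, hg⟩ ⟨h, hh⟩ : G) from
      (hsh.2.2.2.2.1 _ _ hU').symm, hφ]
    exact ⟨𝒢'.mem_U_s_eq_t hU', mul_ofArrow hU'⟩
  extChartAt_u x := by
    have h1 : ∀ a : O, extChartAt (𝓡 k) (ofArrow a : 𝒢'.AssocCompletion) (ofArrow a) =
        extChartAt (𝓡 k) (a : G) a := fun a => by
      rw [extChartAt_completion, arrowHomeo_symm_self, chartArrow_ofArrow]
      rfl
    exact (h1 (𝒢'.u x)).trans (by rw [hsh.2.2.1])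
  extChartAt_symm x := by
    rw [← hsh.2.2.1]
    set a := 𝒢'.u x
    have h1 : ∀ z, (extChartAt (𝓡 k) (ofArrow a : 𝒢'.AssocCompletion)).symm z =
        ofArrow ((extChartAt (𝓡 k) a).symm z) := fun z => by
      have e : (extChartAt (𝓡 k) (ofArrow a : 𝒢'.AssocCompletion)).symm z =
          (chartBisection (ofArrow a : 𝒢'.AssocCompletion)).translate
            ((extChartAt (𝓡 k) (chartArrow (ofArrow a : 𝒢'.AssocCompletion))).symm z) := rfl
      rw [e, chartBisection_ofArrow, translate_unit, chartArrow_ofArrow]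
    have h2 := Opens.chartAt_subtype_val_symm_eventuallyEq (H := EuclideanSpace ℝ (Fin k)) O
      (x := a)
    filter_upwards [h2] with z hz
    have h3 : (((extChartAt (𝓡 k) a).symm z : O) : G) = (extChartAt (𝓡 k) (a : G)).symm z :=
      hz.symm
    rw [Function.comp_apply, ← h3, hφ]
    exact h1 z

theorem ShrinksTo.completion_integrates {F : Type*} [NormedAddCommGroup F] [NormedSpace ℝ F]
    {V : M → Type*} [∀ x, AddCommGroup (V x)] [∀ x, Module ℝ (V x)]
    [TopologicalSpace (Bundle.TotalSpace F V)] [∀ x, TopologicalSpace (V x)]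
    [FiberBundle F V] [VectorBundle ℝ F V] {A : LieAlgebroid n M F V}
    (hsh : 𝒢.ShrinksTo 𝒢') (hA : 𝒢.Integrates A) : 𝒢'.completion.Integrates A := by
  classical
  -- The value of the map outside `O` is irrelevant.
  refine (hsh.isGermMorphism (φ := fun g =>
    if h : g ∈ O then ofArrow ⟨g, h⟩ else ofArrow (𝒢'.u (𝒢.s g))) fun g => ?_).integrates hA
  exact dif_pos g.2

end Completion

end LocalLieGroupoid

end

theorem mainTheorem11 {n : ℕ} {M : Type u} [TopologicalSpace M]
    [ChartedSpace (EuclideanSpace ℝ (Fin n)) M] [IsManifold (𝓡 n) ∞ M]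
    [T2Space M] [SecondCountableTopology M]
    {F : Type v} [NormedAddCommGroup F] [NormedSpace ℝ F] [FiniteDimensional ℝ F]
    {V : M → Type w} [∀ x, AddCommGroup (V x)] [∀ x, Module ℝ (V x)]
    [TopologicalSpace (Bundle.TotalSpace F V)] [∀ x, TopologicalSpace (V x)]
    [FiberBundle F V] [VectorBundle ℝ F V] [ContMDiffVectorBundle ∞ F V (𝓡 n)]
    (A : LieAlgebroid n M F V) :
    (A.IsIntegrable ↔
      ∃ (k : ℕ) (G : Type u) (_ : TopologicalSpace G)
        (_ : ChartedSpace (EuclideanSpace ℝ (Fin k)) G) (_ : IsManifold (𝓡 k) ∞ G)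
        (𝒢 : LocalLieGroupoid n k M G),
        𝒢.IsThreeAssociative ∧ 𝒢.Integrates A ∧ 𝒢.HasUniformlyDiscreteAssociators) ∧
    ∀ (k : ℕ) (G : Type u) [TopologicalSpace G] [ChartedSpace (EuclideanSpace ℝ (Fin k)) G]
      [IsManifold (𝓡 k) ∞ G] (𝒢 : LocalLieGroupoid n k M G),
      𝒢.IsThreeAssociative → 𝒢.Integrates A → 𝒢.HasUniformlyDiscreteAssociators →
      ∃ (O : TopologicalSpace.Opens G) (𝒢' : LocalLieGroupoid n k M O),
        𝒢.ShrinksTo 𝒢' ∧ 𝒢'.IsBiregular ∧ 𝒢'.ProductsConnectedToAxes ∧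
        𝒢'.associators = Set.range 𝒢'.u ∧
        ∃ (_ : ChartedSpace (EuclideanSpace ℝ (Fin k)) 𝒢'.AssocCompletion)
          (_ : IsManifold (𝓡 k) ∞ 𝒢'.AssocCompletion)
          (ℋ : LocalLieGroupoid n k M 𝒢'.AssocCompletion),
          𝒢'.IsSmoothQuotient ∧ 𝒢'.IsCompletionStructure ℋ ∧ ℋ.IsLieGroupoid ∧
          ℋ.Integrates A := by
  have key : ∀ (k : ℕ) (G : Type u) [TopologicalSpace G] [ChartedSpace (EuclideanSpace ℝ (Fin k)) G]
      [IsManifold (𝓡 k) ∞ G] (𝒢 : LocalLieGroupoid n k M G),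
      𝒢.IsThreeAssociative → 𝒢.Integrates A → 𝒢.HasUniformlyDiscreteAssociators →
      ∃ (O : TopologicalSpace.Opens G) (𝒢' : LocalLieGroupoid n k M O),
        𝒢.ShrinksTo 𝒢' ∧ 𝒢'.IsBiregular ∧ 𝒢'.ProductsConnectedToAxes ∧
        𝒢'.associators = Set.range 𝒢'.u ∧
        ∃ (_ : ChartedSpace (EuclideanSpace ℝ (Fin k)) 𝒢'.AssocCompletion)
          (_ : IsManifold (𝓡 k) ∞ 𝒢'.AssocCompletion)
          (ℋ : LocalLieGroupoid n k M 𝒢'.AssocCompletion),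
          𝒢'.IsSmoothQuotient ∧ 𝒢'.IsCompletionStructure ℋ ∧ ℋ.IsLieGroupoid ∧
          ℋ.Integrates A := by
    intro k G _ _ _ 𝒢 h3 hA hd
    obtain ⟨O, 𝒢', hF⟩ := h3.exists_isFineShrinking hd
    have := hF.isCompletable h3
    exact ⟨O, 𝒢', hF.shrinksTo, hF.isBiregular h3, hF.productsConnectedToAxes, hF.associators_eq,
      inferInstance, inferInstance, 𝒢'.completion,
      LocalLieGroupoid.isSmoothQuotient_completion,
      LocalLieGroupoid.isCompletionStructure_completion,
      LocalLieGroupoid.isLieGroupoid_completion, hF.shrinksTo.completion_integrates hA⟩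
  refine ⟨⟨?_, ?_⟩, key⟩
  · rintro ⟨k, G, _, _, _, 𝒢, hG, hA⟩
    exact ⟨k, G, _, _, _, 𝒢, hG.isThreeAssociative, hA, hG.hasUniformlyDiscreteAssociators⟩
  · rintro ⟨k, G, _, _, _, 𝒢, h3, hA, hd⟩
    obtain ⟨O, 𝒢', -, -, -, -, _, _, ℋ, -, -, hℋ, hℋA⟩ := key k G 𝒢 h3 hA hd
    exact ⟨k, 𝒢'.AssocCompletion, _, _, _, ℋ, hℋ, hℋA⟩
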